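/- **Setting.** Let $\Omega$ be either a connected open subset of $\mathbb{R}^d$ with smooth boundary or a $d$-dimensional flat torus. Let $U_0,U_1\in C^\infty(\Omega,\mathbb{R})$ satisfy $\int_\Omega e^{-U_0}=1$, $\mathcal{Z}_1:=\int_\Omega e^{-U_1}<\infty$ and $\mathbb{E}_0[e^{-2(U_1-U_0)}]-\mathcal{Z}_1^2\in(0,\infty)$, where $\mathbb{E}_0$ is the expectation under the density $\rho_0=e^{-U_0}$. Let $\mathfrak{B}$ be the space of vector fields $b\in C^\infty(\overline\Omega,\mathbb{R}^d)$ that are tangent to $\partial\Omega$ and satisfy $\sup_\Omega|\nabla b|<\infty$. For $b\in\mathfrak{B}$ let $X_t$ be its flow ($\partial_tX_t(x)=b(X_t(x))$, $X_0(x)=x$), and let $$J_t(x)=|\det\nabla_xX_t(x)|,\qquad F^k_t(x)=e^{-U_k(X_t(x))}J_t(x)\quad(k=0,1),$$ $$B(x)=\int_{-\infty}^{\infty}F^0_t(x)\,dt,\qquad A(x)=A_b(x)=\frac{1}{B(x)}\int_{-\infty}^{\infty}F^1_t(x)\,dt .$$ Let $\mho(b)$ be the (open) set of points near which the four functions $z\mapsto\int_0^\infty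 F^k_t(z)\,dt$ and $z\mapsto\int_{-\infty}^0F^k_t(z)\,dt$, $k=0,1$, are finite and continuous, and let $\mathfrak{B}_\infty$ be the set of $b\in\mathfrak{B}$ such that $\Omega\setminus\mho(b)$ has Lebesgue measure zero. Put $M(b)=\mathbb{E}_0[A_b^2]$, and let $\mathrm{Var}(b)$ be the variance of $A_b$ under $\rho_0$. For $\Phi\in\{M,\mathrm{Var}\}$ and $V\subseteq\Omega$ open, a vector field $g$ on $V$ is called a functional derivative $\delta\Phi/\delta b$ at $b$ on $V$ if, for every $\delta b\in C_c^\infty(V,\mathbb{R}^d)$ such that $b+\varepsilon\,\delta b\in\mathfrak{B}_\infty$ for all sufficiently small $|\varepsilon|$, the function $\langle g,\delta b\rangle$ is integrable, and $\varepsilon\mapsto\Phi(b+\varepsilon\,\delta b)$ is differentiable at $0$ with $$\frac{d}{d\varepsilon}\Phi(b+\varepsilon\,\delta b)\Big|_{\varepsilon=0}=\int_\Omega\langle g,\delta b\rangle .$$ **Statement.** Let $b\in\mathfrak{B}_\infty$, let $V\subseteq\mho(b)$ be open, and put $$G(x)=\frac{2\nabla A(x)}{B(x)}\left(\int_0^\infty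 F^0_t(x)\,dt\int_{-\infty}^0F^1_t(x)\,dt-\int_{-\infty}^0F^0_t(x)\,dt\int_0^\infty F^1_t(x)\,dt\right).$$ The second moment $M(b')$ is finite for every $b'\in\mathfrak{B}_\infty$, and: 1. If the four functions $\int_0^\infty F^k_t\,dt$ and $\int_{-\infty}^0F^k_t\,dt$ ($k=0,1$) are $C^1$ on $V$, then $G$ is a functional derivative on $V$ of $M$, and also of $\mathrm{Var}$: $$\frac{\delta\,\mathrm{Var}(b)}{\delta b}=\frac{\delta M(b)}{\delta b}=G\quad\text{on }V.$$ 2. If merely $A$ is $C^1$ on $V$, and if $M$ or $\mathrm{Var}$ has a functional derivative $g$ at $b$ on $V$, then $g=G$ almost everywhere on $V$. -/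

import Mathlib

open MeasureTheory Set Filter
open scoped Topology ContDiff RealInnerProductSpace

noncomputable section

/-- `ρ` is a smooth defining function of the set `Ω` near the point `p`: near `p` the set `Ω` is
`{ρ < 0}`, and the differential of `ρ` at `p` is nonzero. The outward unit normal of `Ω` at a
boundary point `p` is then `∇ρ(p) / |∇ρ(p)|`. -/
structure IsDefiningFunctionAt {d : ℕ} (Ω : Set (EuclideanSpace ℝ (Fin d)))
    (p : EuclideanSpace ℝ (Fin d)) (ρ : EuclideanSpace ℝ (Fin d) → ℝ) : Prop where
  contDiff : ContDiff ℝ ∞ ρ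
  fderiv_ne_zero : fderiv ℝ ρ p ≠ 0
  mem_iff : ∀ᶠ x in 𝓝 p, x ∈ Ω ↔ ρ x < 0

/-- The boundary of `Ω` is smooth (it may be empty). -/
def HasSmoothBoundary {d : ℕ} (Ω : Set (EuclideanSpace ℝ (Fin d))) : Prop :=
  ∀ p ∈ frontier Ω, ∃ ρ, IsDefiningFunctionAt Ω p ρ

/-- The domains: either a (nonempty) connected open subset of `ℝ^d` with smooth boundary, or the
`d`-dimensional torus `ℝ^d / Λ`, where `Λ` is the lattice spanned by a basis of `ℝ^d`. -/
inductive FlowDomain (d : ℕ) where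
  | euclidean (Ω : Set (EuclideanSpace ℝ (Fin d))) (isOpen : IsOpen Ω)
      (isConnected : IsConnected Ω) (smoothBoundary : HasSmoothBoundary Ω) : FlowDomain d
  | torus (v : Module.Basis (Fin d) ℝ (EuclideanSpace ℝ (Fin d))) : FlowDomain d

namespace FlowDomain

variable {d : ℕ}

/-- The open set on which functions are written down: `Ω` itself, or the universal cover `ℝ^d` of
the torus. A function on the torus is a function on `ℝ^d` that is invariant under `periods`. -/
def cover : FlowDomain d → Set (EuclideanSpace ℝ (Fin d))
  | euclidean Ω _ _ _ => Ω
  | torus _ => univ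

/-- The group of periods: trivial for a subset of `ℝ^d`, the lattice for a torus. -/
def periods : FlowDomain d → AddSubgroup (EuclideanSpace ℝ (Fin d))
  | euclidean _ _ _ _ => ⊥
  | torus v => (Submodule.span ℤ (range v)).toAddSubgroup

/-- A set of representatives, over which one integrates: `Ω` itself, or the half-open
parallelepiped spanned by the basis. -/
def cell : FlowDomain d → Set (EuclideanSpace ℝ (Fin d))
  | euclidean Ω _ _ _ => Ω
  | torus v => ZSpan.fundamentalDomain v

/-- The function `f` descends to the domain. -/
def IsPeriodic {α : Type*} (D : FlowDomain d) (f : EuclideanSpace ℝ (Fin d) → α) : Prop :=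
  ∀ l ∈ D.periods, ∀ x, f (x + l) = f x

/-- `V` is (the preimage in `cover` of) an open subset of the domain. -/
structure IsOpenSubset (D : FlowDomain d) (V : Set (EuclideanSpace ℝ (Fin d))) : Prop where
  isOpen : IsOpen V
  subset : V ⊆ D.cover
  periodic : ∀ l ∈ D.periods, ∀ x ∈ V, x + l ∈ V

/-- The space of velocity fields: smooth up to the boundary, tangent to the boundary, with bounded
gradient. -/
structure IsVelocityField (D : FlowDomain d)
    (b : EuclideanSpace ℝ (Fin d) → EuclideanSpace ℝ (Fin d)) : Prop where
  smooth : ContDiffOn ℝ ∞ b (closure D.cover)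
  periodic : D.IsPeriodic b
  tangent : ∀ p ∈ frontier D.cover, ∀ ρ, IsDefiningFunctionAt D.cover p ρ → fderiv ℝ ρ p (b p) = 0
  bounded_gradient : ∃ C : ℝ, ∀ x ∈ D.cover, ‖fderiv ℝ b x‖ ≤ C

/-- `γ` is a solution, for all times, of `γ' = b(γ)` in the domain with `γ 0 = x`. -/
def IsTrajectory (D : FlowDomain d) (b : EuclideanSpace ℝ (Fin d) → EuclideanSpace ℝ (Fin d))
    (x : EuclideanSpace ℝ (Fin d)) (γ : ℝ → EuclideanSpace ℝ (Fin d)) : Prop :=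
  γ 0 = x ∧ ∀ t, γ t ∈ D.cover ∧ HasDerivAt γ (b (γ t)) t

open Classical in
/-- The flow map `X_t(x)` of `b`. For a velocity field and `x` in the domain the trajectory exists
and is unique; in all other cases the value is a dummy. -/
def flow (D : FlowDomain d) (b : EuclideanSpace ℝ (Fin d) → EuclideanSpace ℝ (Fin d))
    (t : ℝ) (x : EuclideanSpace ℝ (Fin d)) : EuclideanSpace ℝ (Fin d) :=
  if h : ∃ γ, D.IsTrajectory b x γ then h.choose t else x

/-- The Jacobian `J_t(x) = |det ∇ X_t(x)|`. -/
def jacobian (D : FlowDomain d) (b : EuclideanSpace ℝ (Fin d) → EuclideanSpace ℝ (Fin d))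
    (t : ℝ) (x : EuclideanSpace ℝ (Fin d)) : ℝ :=
  |(fderiv ℝ (D.flow b t) x).det|

/-- The flow-weighted density `F^k_t(x) = exp(-U_k(X_t(x))) J_t(x)`. -/
def weightedDensity (D : FlowDomain d) (U : Fin 2 → EuclideanSpace ℝ (Fin d) → ℝ)
    (b : EuclideanSpace ℝ (Fin d) → EuclideanSpace ℝ (Fin d))
    (k : Fin 2) (t : ℝ) (x : EuclideanSpace ℝ (Fin d)) : ℝ :=
  Real.exp (-U k (D.flow b t x)) * D.jacobian b t x

/-- `∫_0^∞ F^k_t(x) dt`. -/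
def forwardIntegral (D : FlowDomain d) (U : Fin 2 → EuclideanSpace ℝ (Fin d) → ℝ)
    (b : EuclideanSpace ℝ (Fin d) → EuclideanSpace ℝ (Fin d))
    (k : Fin 2) (x : EuclideanSpace ℝ (Fin d)) : ℝ :=
  ∫ t in Ioi (0 : ℝ), D.weightedDensity U b k t x

/-- `∫_{-∞}^0 F^k_t(x) dt`. -/
def backwardIntegral (D : FlowDomain d) (U : Fin 2 → EuclideanSpace ℝ (Fin d) → ℝ)
    (b : EuclideanSpace ℝ (Fin d) → EuclideanSpace ℝ (Fin d))
    (k : Fin 2) (x : EuclideanSpace ℝ (Fin d)) : ℝ :=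
  ∫ t in Iio (0 : ℝ), D.weightedDensity U b k t x

/-- `∫_{-∞}^∞ F^k_t(x) dt`; for `k = 0` this is `B(x)`. -/
def totalIntegral (D : FlowDomain d) (U : Fin 2 → EuclideanSpace ℝ (Fin d) → ℝ)
    (b : EuclideanSpace ℝ (Fin d) → EuclideanSpace ℝ (Fin d))
    (k : Fin 2) (x : EuclideanSpace ℝ (Fin d)) : ℝ :=
  ∫ t : ℝ, D.weightedDensity U b k t x

/-- The infinite-time estimator `A(x) = ∫ F^1_t(x) dt / ∫ F^0_t(x) dt`. -/
def estimator (D : FlowDomain d) (U : Fin 2 → EuclideanSpace ℝ (Fin d) → ℝ)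
    (b : EuclideanSpace ℝ (Fin d) → EuclideanSpace ℝ (Fin d))
    (x : EuclideanSpace ℝ (Fin d)) : ℝ :=
  D.totalIntegral U b 1 x / D.totalIntegral U b 0 x

/-- The set `℧(b)` of the points around which all four half-line integrals are finite and depend
continuously on the point. -/
def regularSet (D : FlowDomain d) (U : Fin 2 → EuclideanSpace ℝ (Fin d) → ℝ)
    (b : EuclideanSpace ℝ (Fin d) → EuclideanSpace ℝ (Fin d)) : Set (EuclideanSpace ℝ (Fin d)) :=
  {x | ∃ W ∈ 𝓝 x, W ⊆ D.cover ∧ ∀ k,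
    (∀ z ∈ W, IntegrableOn (fun t => D.weightedDensity U b k t z) (Ioi 0) ∧
      IntegrableOn (fun t => D.weightedDensity U b k t z) (Iio 0)) ∧
    ContinuousOn (D.forwardIntegral U b k) W ∧ ContinuousOn (D.backwardIntegral U b k) W}

/-- The velocity fields `b` for which the complement of `℧(b)` is a null set. -/
def infiniteTimeFields (D : FlowDomain d) (U : Fin 2 → EuclideanSpace ℝ (Fin d) → ℝ) :
    Set (EuclideanSpace ℝ (Fin d) → EuclideanSpace ℝ (Fin d)) :=
  {b | D.IsVelocityField b ∧ volume (D.cover \ D.regularSet U b) = 0}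

/-- The base distribution, with density `ρ₀ = exp(-U_0)` on the domain. -/
def baseMeasure (D : FlowDomain d) (U : Fin 2 → EuclideanSpace ℝ (Fin d) → ℝ) :
    Measure (EuclideanSpace ℝ (Fin d)) :=
  (volume.restrict D.cell).withDensity fun x => ENNReal.ofReal (Real.exp (-U 0 x))

/-- The standing assumptions on the potentials: smoothness, `∫ exp(-U_0) = 1`,
`∫ exp(-U_1) < ∞`, and the variance of the vanilla importance sampling estimator
`exp(-(U_1 - U_0))` lies in `(0, ∞)`. -/
structure PotentialAssumptions (D : FlowDomain d)
    (U : Fin 2 → EuclideanSpace ℝ (Fin d) → ℝ) : Prop where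
  smooth : ∀ k, ContDiffOn ℝ ∞ (U k) D.cover
  periodic : ∀ k, D.IsPeriodic (U k)
  normalized : ∫ x in D.cell, Real.exp (-U 0 x) = 1
  integrable : IntegrableOn (fun x => Real.exp (-U 1 x)) D.cell
  vanilla_finite : Integrable (fun x => Real.exp (-2 * (U 1 x - U 0 x))) (D.baseMeasure U)
  vanilla_pos : 0 < (∫ x, Real.exp (-2 * (U 1 x - U 0 x)) ∂(D.baseMeasure U)) -
    (∫ x in D.cell, Real.exp (-U 1 x)) ^ 2

/-- The second moment `M(b) = E_0[A²]` of the infinite-time estimator. -/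
def secondMoment (D : FlowDomain d) (U : Fin 2 → EuclideanSpace ℝ (Fin d) → ℝ)
    (b : EuclideanSpace ℝ (Fin d) → EuclideanSpace ℝ (Fin d)) : ℝ :=
  ∫ x, D.estimator U b x ^ 2 ∂(D.baseMeasure U)

/-- The variance of the infinite-time estimator under the base distribution. -/
def estimatorVariance (D : FlowDomain d) (U : Fin 2 → EuclideanSpace ℝ (Fin d) → ℝ)
    (b : EuclideanSpace ℝ (Fin d) → EuclideanSpace ℝ (Fin d)) : ℝ :=
  ProbabilityTheory.variance (D.estimator U b) (D.baseMeasure U)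

/-- `c` is a smooth vector field with compact support in the open subset `V` of the domain
(the support is compact modulo the periods). -/
structure IsTestField (D : FlowDomain d) (V : Set (EuclideanSpace ℝ (Fin d)))
    (c : EuclideanSpace ℝ (Fin d) → EuclideanSpace ℝ (Fin d)) : Prop where
  smooth : ContDiff ℝ ∞ c
  periodic : D.IsPeriodic c
  support_subset : tsupport c ⊆ V
  compact_support : ∃ K, IsCompact K ∧ ∀ x ∈ tsupport c, ∃ l ∈ D.periods, x + l ∈ K

/-- `g` is a functional derivative `δΦ/δb` of `Φ` at `b` on the open subset `V` of the domain: for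
every smooth compactly supported perturbation `c` in `V` with `b + ε c` an infinite-time field for
all small `ε`, one has `d/dε Φ(b + ε c) = ∫ ⟨g, c⟩` at `ε = 0`. -/
def IsFunctionalDerivativeOn (D : FlowDomain d) (U : Fin 2 → EuclideanSpace ℝ (Fin d) → ℝ)
    (Φ : (EuclideanSpace ℝ (Fin d) → EuclideanSpace ℝ (Fin d)) → ℝ)
    (b : EuclideanSpace ℝ (Fin d) → EuclideanSpace ℝ (Fin d))
    (V : Set (EuclideanSpace ℝ (Fin d)))
    (g : EuclideanSpace ℝ (Fin d) → EuclideanSpace ℝ (Fin d)) : Prop :=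
  ∀ c, D.IsTestField V c →
    (∀ᶠ ε : ℝ in 𝓝 0, b + ε • c ∈ D.infiniteTimeFields U) →
    IntegrableOn (fun x => ⟪g x, c x⟫) D.cell ∧
    HasDerivAt (fun ε : ℝ => Φ (b + ε • c)) (∫ x in D.cell, ⟪g x, c x⟫) 0

/-- The vector field
`(2 ∇A / B) (∫_0^∞ F^0 · ∫_{-∞}^0 F^1 - ∫_{-∞}^0 F^0 · ∫_0^∞ F^1)`. -/
def explicitDerivative (D : FlowDomain d) (U : Fin 2 → EuclideanSpace ℝ (Fin d) → ℝ)
    (b : EuclideanSpace ℝ (Fin d) → EuclideanSpace ℝ (Fin d))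
    (x : EuclideanSpace ℝ (Fin d)) : EuclideanSpace ℝ (Fin d) :=
  ((2 / D.totalIntegral U b 0 x) *
    (D.forwardIntegral U b 0 x * D.backwardIntegral U b 1 x -
      D.backwardIntegral U b 0 x * D.forwardIntegral U b 1 x)) • gradient (D.estimator U b) x

end FlowDomain

end

/-!
# The first variation of the infinite-time estimator

Fix an infinite-time field `b`, a test field `c` supported in `V ⊆ ℧(b)`, and write `A` for the
estimator of `b`, `w = exp(-(U₁ - U₀))` for the likelihood ratio, and `E₀` for the expectation under
the base distribution.

*The estimator is a conditional expectation.* Velocity fields tangent to the boundary with bounded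
gradient have complete flows (`IsVelocityField.isCompleteFlow`), and Liouville's formula
(`IsCompleteFlow.det_fderiv`) makes the Jacobian a positive cocycle. Hence `A` is constant along
trajectories, and moving mass along the flow (`IsVelocityField.lintegral_transport`) gives
`E₀[f A] = E₀[f w]` for every `f` that is constant along trajectories (`integral_mul_estimator`).
With `f = min(A, n)` this bounds `E₀[A²]` by `E₀[w²]` (`memLp_estimator`); with `f = 1` it shows that
the mean of `A` does not depend on `b`, so that the variance and the second moment differ by a constant
(`estimatorVariance_eq`) and only the second moment `M` has to be considered.

*Perturbations are admissible.* On a compact subset of `℧(b)` the half-line integrals are bounded below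
and have uniformly small tails, so a trajectory that returned after a long time would have a Jacobian
that is both less than `1` and greater than `1` (`IsVelocityField.exists_isTransient`). For small `ε`
the field `b + ε c` inherits this: its trajectories spend a bounded time between the first and the last
visit to the support of `c`, and outside they are trajectories of `b`. Therefore
`℧(b) ⊆ ℧(b + ε c)`, every small multiple of a test field is admissible
(`IsTestField.eventually_mem_infiniteTimeFields`), and the half-line integrals of `b + ε c` converge
uniformly on the support of `c`.

*An exact expansion.* Suppose `A` is `C¹` on `V`. Since `∇A · b = 0`, along trajectories of `b + ε c`
the function `A` changes at the rate `ε ∇A · c`. Subtracting `ε I`, where `I(x)` is the integral of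
`∇A · c` over the past of `x`, gives a function `Ã = A - ε I` that is constant along the trajectories
of `b + ε c`. Let `A'` be the estimator of `b + ε c`. From `E₀[Ã A'] = E₀[Ã w]` and `E₀[A²] = E₀[A w]`
one obtains
`M(b + ε c) = M(b) + 2 ε (E₀[Ã I] - E₀[I w]) + ε² E₀[I²] + E₀[(A' - Ã)²]`,
and mass transport turns the linear terms into integrals over the support of `c` of `∇A · c` against
forward integrals of `b + ε c` (`IsTestField.secondMoment_add_smul`). As `ε → 0` the coefficient of `ε`
tends to `∫ ⟨G, c⟩` (`IsTestField.tendsto_momentSlope`).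

*The two claims.* The last two terms are nonnegative, so if `M` has a derivative in the direction `c`
at all, then the difference between `M(b + ε c)` and the linear term has a local minimum at `ε = 0`, and
the derivative equals `∫ ⟨G, c⟩` (`IsTestField.eq_of_hasDerivAt_secondMoment`). As all test fields are
admissible up to scaling, the fundamental lemma of the calculus of variations
(`ae_eq_zero_of_integral_inner_eq_zero`) yields uniqueness of the functional derivative. If the
half-line integrals are `C¹` on `V`, then along the perturbed flow they satisfy a transport equation
with a source term of size `O(ε)`; so they, and with them `A' - Ã`, change by `O(ε)`
(`IsTestField.exists_abs_estimator_sub_transportedEstimator_le`), the last two terms are `O(ε²)`, and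
`M` is differentiable (`IsTestField.hasDerivAt_secondMoment`).
-/

open scoped ENNReal

/-! ### Ordinary differential equations on open sets -/

section ODE

variable {E : Type*} [NormedAddCommGroup E] [NormedSpace ℝ E]

/-- Grönwall's inequality in both directions of time. -/
theorem norm_le_gronwallBound_of_abs_le {f f' : ℝ → E} {T K η : ℝ}
    (hK : 0 ≤ K) (hη : 0 ≤ η)
    (hf : ∀ t ∈ Icc (-T) T, HasDerivAt f (f' t) t)
    (hb : ∀ t ∈ Icc (-T) T, ‖f' t‖ ≤ K * ‖f t‖ + η) :
    ∀ t ∈ Icc (-T) T, ‖f t‖ ≤ gronwallBound ‖f 0‖ K η T := by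
  intro t ht
  have hT : 0 ≤ T := by linarith [ht.1, ht.2]
  rcases le_total 0 t with h0 | h0
  · have h1 := norm_le_gronwallBound_of_norm_deriv_right_le (f := f) (f' := f') (δ := ‖f 0‖)
      (K := K) (ε := η) (a := 0) (b := T)
      (fun s hs => (hf s ⟨by linarith [hs.1], hs.2⟩).continuousAt.continuousWithinAt)
      (fun s hs => (hf s ⟨by linarith [hs.1], hs.2.le⟩).hasDerivWithinAt) le_rfl
      (fun s hs => hb s ⟨by linarith [hs.1], hs.2.le⟩) t ⟨h0, ht.2⟩
    exact h1.trans (gronwallBound_mono (norm_nonneg _) hη hK (by linarith [ht.2]))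
  · have h1 := norm_le_gronwallBound_of_norm_deriv_right_le (f := fun s => f (-s))
      (f' := fun s => -f' (-s)) (δ := ‖f 0‖)
      (K := K) (ε := η) (a := 0) (b := T)
      (fun s hs => by
        have := (hf (-s) ⟨by linarith [hs.2], by linarith [hs.1]⟩).continuousAt
        exact (ContinuousAt.comp' (f := fun s : ℝ => -s) this
          continuous_neg.continuousAt).continuousWithinAt)
      (fun s hs => by
        have := (hf (-s) ⟨by linarith [hs.2], by linarith [hs.1]⟩).scomp s (hasDerivAt_neg s)
        simpa [Function.comp_def] using this.hasDerivWithinAt) (by simp)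
      (fun s hs => by
        simpa using hb (-s) ⟨by linarith [hs.2], by linarith [hs.1]⟩) (-t)
      ⟨by linarith, by linarith [ht.1]⟩
    simp only [neg_neg] at h1
    exact h1.trans (gronwallBound_mono (norm_nonneg _) hη hK (by linarith [ht.1]))

/-- Grönwall's inequality for a differential inequality that is only known as long as the function
stays below the threshold `δ`: a small initial value never reaches the threshold. -/
theorem norm_le_mul_exp_of_trapped {f f' : ℝ → E} {T K δ : ℝ} (hK : 0 ≤ K)
    (hf : ∀ t ∈ Icc (-T) T, HasDerivAt f (f' t) t)
    (hb : ∀ t ∈ Icc (-T) T, ‖f t‖ ≤ δ → ‖f' t‖ ≤ K * ‖f t‖)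
    (h0 : ‖f 0‖ * Real.exp (K * T) < δ) :
    ∀ t ∈ Icc (-T) T, ‖f t‖ ≤ ‖f 0‖ * Real.exp (K * T) := by
  intro t ht
  have hT : 0 ≤ T := by linarith [ht.1, ht.2]
  -- on the largest symmetric interval on which `f` stays below the threshold, Grönwall applies
  have key : ∀ S, 0 ≤ S → S ≤ T → (∀ s ∈ Ioo (-S) S, ‖f s‖ ≤ δ) →
      ∀ s ∈ Icc (-S) S, ‖f s‖ ≤ ‖f 0‖ * Real.exp (K * T) := by
    intro S hS0 hS h s hs
    have hcl : ∀ s ∈ Icc (-S) S, ‖f s‖ ≤ δ := by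
      rcases hS0.eq_or_lt with rfl | hpos
      · intro s hs
        have : s = 0 := le_antisymm (by simpa using hs.2) (by simpa using hs.1)
        rw [this]
        have : ‖f 0‖ * 1 ≤ ‖f 0‖ * Real.exp (K * T) := by
          gcongr
          exact Real.one_le_exp (by positivity)
        linarith
      · intro s hs
        have hc : ContinuousWithinAt (fun s => ‖f s‖) (Ioo (-S) S) s :=
          (hf s ⟨by linarith [hs.1], by linarith [hs.2]⟩).continuousAt.norm.continuousWithinAt
        refine hc.closure_le ?_ continuousWithinAt_const h
        rwa [closure_Ioo (by linarith)]
    have h1 := norm_le_gronwallBound_of_abs_le (T := S) hK le_rfl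
      (fun s hs => hf s ⟨by linarith [hs.1], by linarith [hs.2]⟩)
      (fun s hs => by
        simpa using hb s ⟨by linarith [hs.1], by linarith [hs.2]⟩ (hcl s hs)) s hs
    rw [gronwallBound_ε0] at h1
    refine h1.trans ?_
    gcongr
  by_contra hcon
  push Not at hcon
  set Z := {s : ℝ | 0 ≤ s ∧ s ≤ T ∧ (δ ≤ ‖f s‖ ∨ δ ≤ ‖f (-s)‖)} with hZ
  have hZne : Z.Nonempty := by
    by_contra hne
    rw [Set.not_nonempty_iff_eq_empty] at hne
    have : ∀ s ∈ Ioo (-T) T, ‖f s‖ ≤ δ := by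
      intro s hs
      by_contra hlt
      push Not at hlt
      have : |s| ∈ Z := by
        refine ⟨abs_nonneg _, (abs_lt.2 hs).le, ?_⟩
        rcases abs_choice s with h | h <;> rw [h]
        · exact Or.inl hlt.le
        · right; simpa using hlt.le
      rw [hne] at this
      exact this
    exact absurd (key T hT le_rfl this t ht) (not_le.2 hcon)
  have hZc : IsClosed Z := by
    have hcont : ContinuousOn (fun s => max ‖f s‖ ‖f (-s)‖) (Icc 0 T) := by
      intro s hs
      refine ContinuousWithinAt.sup
        (hf s ⟨by linarith [hs.1], hs.2⟩).continuousAt.norm.continuousWithinAt ?_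
      exact (ContinuousAt.comp' (f := fun s : ℝ => -s) (g := fun s => ‖f s‖)
        (hf (-s) ⟨by linarith [hs.2], by linarith [hs.1]⟩).continuousAt.norm
          continuous_neg.continuousAt).continuousWithinAt
    have : Z = Icc 0 T ∩ (fun s => max ‖f s‖ ‖f (-s)‖) ⁻¹' Ici δ := by
      ext s; simp [hZ, and_assoc]
    rw [this]
    exact hcont.preimage_isClosed_of_isClosed isClosed_Icc isClosed_Ici
  have hbd : BddBelow Z := ⟨0, fun s hs => hs.1⟩
  have hmem := hZc.csInf_mem hZne hbd
  set S := sInf Z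
  have hlt : ∀ s ∈ Ioo (-S) S, ‖f s‖ ≤ δ := by
    intro s hs
    by_contra hlt
    push Not at hlt
    have hsS : |s| < S := abs_lt.2 hs
    have : |s| ∈ Z := by
      refine ⟨abs_nonneg _, hsS.le.trans hmem.2.1, ?_⟩
      rcases abs_choice s with h | h <;> rw [h]
      · exact Or.inl hlt.le
      · right; simpa using hlt.le
    exact absurd (csInf_le hbd this) (not_le.2 hsS)
  have := key S hmem.1 hmem.2.1 hlt
  rcases hmem.2.2 with h | h
  · exact absurd (h.trans (this S ⟨by linarith [hmem.1], le_rfl⟩)) (not_le.2 h0)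
  · exact absurd (h.trans (this (-S) ⟨le_rfl, by linarith [hmem.1]⟩)) (not_le.2 h0)

theorem hasDerivAt_comp_neg_of_solution {v : E → E} {γ : ℝ → E} {t : ℝ}
    (h : HasDerivAt γ (v (γ (-t))) (-t)) :
    HasDerivAt (fun s => γ (-s)) ((-v) (γ (-t))) t := by
  simpa [Function.comp_def] using h.scomp t (hasDerivAt_neg t)

variable [FiniteDimensional ℝ E]

theorem IsCompact.exists_cthickening_subset_isCompact {O C : Set E} (hC : IsCompact C)
    (hO : IsOpen O) (hCO : C ⊆ O) :
    ∃ δ > 0, Metric.cthickening δ C ⊆ O ∧ IsCompact (Metric.cthickening δ C) := by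
  obtain ⟨δ, hδ, h⟩ := hC.exists_cthickening_subset_open hO hCO
  have : ProperSpace E := FiniteDimensional.proper ℝ E
  exact ⟨δ, hδ, h, hC.cthickening⟩

/-- A `C¹` map on an open set is Lipschitz, with a uniform constant, between the points of a compact
set and the points near them. -/
theorem exists_lipschitz_near_compact {F : Type*} [NormedAddCommGroup F] [NormedSpace ℝ F]
    {v : E → F} {O C : Set E} (hO : IsOpen O)
    (hv : ContDiffOn ℝ 1 v O) (hC : IsCompact C) (hCO : C ⊆ O) :
    ∃ δ > 0, ∃ K ≥ 0, ∀ p ∈ C, ∀ q, ‖q - p‖ ≤ δ → q ∈ O ∧ ‖v q - v p‖ ≤ K * ‖q - p‖ := by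
  obtain ⟨δ, hδ, hsub, hcpt⟩ := hC.exists_cthickening_subset_isCompact hO hCO
  have hcont : ContinuousOn (fderiv ℝ v) O := hv.continuousOn_fderiv_of_isOpen hO le_rfl
  obtain ⟨K, hK⟩ := hcpt.exists_bound_of_continuousOn (hcont.mono hsub)
  refine ⟨δ, hδ, max K 0, le_max_right _ _, fun p hp q hq => ?_⟩
  have hball : Metric.closedBall p δ ⊆ Metric.cthickening δ C :=
    Metric.closedBall_subset_cthickening hp δ
  have hq' : q ∈ Metric.closedBall p δ := by rwa [mem_closedBall_iff_norm]
  refine ⟨hsub (hball hq'), ?_⟩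
  exact (convex_closedBall p δ).norm_image_sub_le_of_norm_fderiv_le (𝕜 := ℝ)
    (fun x hx => (hv.differentiableOn one_ne_zero).differentiableAt
      (hO.mem_nhds (hsub (hball hx))))
    (fun x hx => (hK x (hball hx)).trans (le_max_left _ _))
    (Metric.mem_closedBall_self hδ.le) hq'

/-- A `C¹` map on an open set is differentiable uniformly on compact sets. -/
theorem exists_fderiv_approx_near_compact {F : Type*} [NormedAddCommGroup F] [NormedSpace ℝ F]
    {v : E → F} {O C : Set E} (hO : IsOpen O)
    (hv : ContDiffOn ℝ 1 v O) (hC : IsCompact C) (hCO : C ⊆ O) {η : ℝ} (hη : 0 < η) :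
    ∃ δ > 0, ∀ p ∈ C, ∀ q, ‖q - p‖ ≤ δ →
      ‖v q - v p - fderiv ℝ v p (q - p)‖ ≤ η * ‖q - p‖ := by
  obtain ⟨δ, hδ, hsub, hcpt⟩ := hC.exists_cthickening_subset_isCompact hO hCO
  have hcont : ContinuousOn (fderiv ℝ v) O := hv.continuousOn_fderiv_of_isOpen hO le_rfl
  have hu := hcpt.uniformContinuousOn_of_continuous (hcont.mono hsub)
  rw [Metric.uniformContinuousOn_iff_le] at hu
  obtain ⟨δ', hδ', hu⟩ := hu η hη
  refine ⟨min δ δ', lt_min hδ hδ', fun p hp q hq => ?_⟩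
  have hball : Metric.closedBall p (min δ δ') ⊆ Metric.cthickening δ C :=
    (Metric.closedBall_subset_closedBall (min_le_left _ _)).trans
      (Metric.closedBall_subset_cthickening hp δ)
  have hpm : p ∈ Metric.closedBall p (min δ δ') :=
    Metric.mem_closedBall_self (lt_min hδ hδ').le
  have hq' : q ∈ Metric.closedBall p (min δ δ') := by rwa [mem_closedBall_iff_norm]
  refine (convex_closedBall p _).norm_image_sub_le_of_norm_hasFDerivWithin_le' (𝕜 := ℝ)
    (f' := fderiv ℝ v)
    (fun x hx => ((hv.differentiableOn one_ne_zero).differentiableAt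
      (hO.mem_nhds (hsub (hball hx)))).hasFDerivAt.hasFDerivWithinAt)
    (fun x hx => ?_) hpm hq'
  rw [← dist_eq_norm]
  exact hu x (hball hx) p (hball hpm) ((Metric.mem_closedBall.1 hx).trans (min_le_right _ _))

/-- Continuous dependence on the initial value: solutions that start near a given solution on
`[-T, T]` stay near it. -/
theorem exists_norm_sub_le_of_solutions {v : E → E} {O : Set E} (hO : IsOpen O)
    (hv : ContDiffOn ℝ 1 v O) {T : ℝ} {γ : ℝ → E}
    (hγ : ∀ t ∈ Icc (-T) T, γ t ∈ O ∧ HasDerivAt γ (v (γ t)) t) :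
    ∃ δ > 0, ∃ M ≥ 0, ∀ β : ℝ → E, (∀ t ∈ Icc (-T) T, HasDerivAt β (v (β t)) t) →
      ‖β 0 - γ 0‖ < δ → ∀ t ∈ Icc (-T) T, ‖β t - γ t‖ ≤ M * ‖β 0 - γ 0‖ := by
  have hcont : ContinuousOn γ (Icc (-T) T) :=
    fun t ht => (hγ t ht).2.continuousAt.continuousWithinAt
  have hC : IsCompact (γ '' Icc (-T) T) := isCompact_Icc.image_of_continuousOn hcont
  have hCO : γ '' Icc (-T) T ⊆ O := by
    rintro _ ⟨t, ht, rfl⟩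
    exact (hγ t ht).1
  obtain ⟨δ, hδ, K, hK, h⟩ := exists_lipschitz_near_compact hO hv hC hCO
  refine ⟨δ / Real.exp (K * T), by positivity, Real.exp (K * T), by positivity,
    fun β hβ h0 t ht => ?_⟩
  rw [mul_comm]
  refine norm_le_mul_exp_of_trapped (f := fun s => β s - γ s)
    (f' := fun s => v (β s) - v (γ s)) hK
    (fun s hs => (hβ s hs).sub (hγ s hs).2)
    (fun s hs hs' => (h (γ s) (mem_image_of_mem γ hs) (β s) hs').2) ?_ t ht
  rwa [lt_div_iff₀ (by positivity)] at h0

theorem eqOn_of_solutions {v : E → E} {O : Set E} (hO : IsOpen O)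
    (hv : ContDiffOn ℝ 1 v O) {T : ℝ} {γ β : ℝ → E}
    (hγ : ∀ t ∈ Icc (-T) T, γ t ∈ O ∧ HasDerivAt γ (v (γ t)) t)
    (hβ : ∀ t ∈ Icc (-T) T, HasDerivAt β (v (β t)) t) (h0 : β 0 = γ 0) :
    ∀ t ∈ Icc (-T) T, β t = γ t := by
  obtain ⟨δ, hδ, M, -, h⟩ := exists_norm_sub_le_of_solutions hO hv hγ
  intro t ht
  have := h β hβ (by simpa [h0] using hδ) t ht
  rw [h0, sub_self, norm_zero, mul_zero] at this
  exact sub_eq_zero.1 (norm_le_zero_iff.1 this)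

/-- A solution that has a limit in the open set at the right end of its interval of definition can
be extended beyond it. -/
theorem exists_solution_extension {v : E → E} {O : Set E} (hO : IsOpen O)
    (hv : ContDiffOn ℝ 1 v O) {a b : ℝ} (hab : a < b) {γ : ℝ → E}
    (hγ : ∀ t ∈ Ioo a b, γ t ∈ O ∧ HasDerivAt γ (v (γ t)) t) {p : E} (hp : p ∈ O)
    (hlim : Tendsto γ (𝓝[<] b) (𝓝 p)) :
    ∃ δ > 0, ∃ β : ℝ → E, (∀ t < b, β t = γ t) ∧
      ∀ t ∈ Ioo a (b + δ), β t ∈ O ∧ HasDerivAt β (v (β t)) t := by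
  obtain ⟨α, hα0, ε, hε, hα⟩ :=
    ((hv.contDiffAt (hO.mem_nhds hp)).exists_forall_mem_closedBall_exists_eq_forall_mem_Ioo_hasDerivAt₀ b)
  have hαc : ContinuousAt α b := (hα b ⟨by linarith, by linarith⟩).continuousAt
  have hαO : ∀ᶠ t in 𝓝 b, α t ∈ O := hαc.eventually (by rw [hα0]; exact hO.mem_nhds hp)
  obtain ⟨ε', hε', hαO⟩ := Metric.eventually_nhds_iff.1 hαO
  set δ := min ε ε'
  have hδ : 0 < δ := lt_min hε hε'
  set β : ℝ → E := fun t => if t < b then γ t else α t with hβ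
  have hβl : ∀ t < b, β t = γ t := fun t ht => by simp [hβ, ht]
  have hβr : ∀ t, b ≤ t → β t = α t := fun t ht => by simp [hβ, not_lt.2 ht]
  have hβb : β b = p := by rw [hβr b le_rfl, hα0]
  refine ⟨δ, hδ, β, hβl, fun t ht => ?_⟩
  rcases lt_trichotomy t b with htb | rfl | htb
  · have hev : β =ᶠ[𝓝 t] γ := by
      filter_upwards [Iio_mem_nhds htb] with s hs using hβl s hs
    have := hγ t ⟨ht.1, htb⟩
    rw [hβl t htb]
    exact ⟨this.1, this.2.congr_of_eventuallyEq hev⟩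
  · refine ⟨by rwa [hβb], ?_⟩
    have hright : HasDerivWithinAt β (v (β t)) (Ici t) t := by
      rw [hβb, ← hα0]
      exact (hα t ⟨by linarith, by linarith⟩).hasDerivWithinAt.congr
        (fun s hs => hβr s hs) (hβr t le_rfl)
    have hlim' : Tendsto β (𝓝[<] t) (𝓝 p) := by
      refine hlim.congr' ?_
      filter_upwards [self_mem_nhdsWithin] with s hs using (hβl s hs).symm
    have hmem : Ioo a t ∈ 𝓝[<] t := Ioo_mem_nhdsLT hab
    have hder : ∀ s ∈ Ioo a t, HasDerivAt β (v (γ s)) s := by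
      intro s hs
      refine (hγ s hs).2.congr_of_eventuallyEq ?_
      filter_upwards [Iio_mem_nhds hs.2] with r hr using hβl r hr
    have hleft : HasDerivWithinAt β (v (β t)) (Iic t) t := by
      refine hasDerivWithinAt_Iic_of_tendsto_deriv (s := Ioo a t)
        (fun s hs => (hder s hs).differentiableAt.differentiableWithinAt) ?_ hmem ?_
      · have : ContinuousWithinAt β (Iio t) t := by
          rw [ContinuousWithinAt, hβb]; exact hlim'
        exact this.mono (fun s hs => hs.2)
      · rw [hβb]
        have hvp : ContinuousAt v p := (hv.contDiffAt (hO.mem_nhds hp)).continuousAt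
        refine (hvp.tendsto.comp hlim).congr' ?_
        filter_upwards [hmem] with s hs using (hder s hs).deriv.symm
    have := hleft.union hright
    rwa [Iic_union_Ici, hasDerivWithinAt_univ] at this
  · have hev : β =ᶠ[𝓝 t] α := by
      filter_upwards [Ioi_mem_nhds htb] with s hs using hβr s (le_of_lt hs)
    rw [hβr t htb.le]
    have h1 : t < b + ε := ht.2.trans_le (by gcongr; exact min_le_left _ _)
    have h2 : t < b + ε' := ht.2.trans_le (by gcongr; exact min_le_right _ _)
    refine ⟨hαO ?_, (hα t ⟨by linarith, h1⟩).congr_of_eventuallyEq hev⟩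
    rw [Real.dist_eq, abs_of_pos (by linarith)]
    linarith

/-- If every solution through `x` on a bounded interval has limits in the open set at both ends,
then the solution through `x` exists for all times. -/
theorem exists_global_solution {v : E → E} {O : Set E} (hO : IsOpen O)
    (hv : ContDiffOn ℝ 1 v O) {x : E} (hx : x ∈ O)
    (hlim : ∀ T > 0, ∀ γ : ℝ → E, γ 0 = x →
      (∀ t ∈ Ioo (-T) T, γ t ∈ O ∧ HasDerivAt γ (v (γ t)) t) →
      (∃ p ∈ O, Tendsto γ (𝓝[<] T) (𝓝 p)) ∧ ∃ p ∈ O, Tendsto γ (𝓝[>] (-T)) (𝓝 p)) :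
    ∃ γ : ℝ → E, γ 0 = x ∧ ∀ t, γ t ∈ O ∧ HasDerivAt γ (v (γ t)) t := by
  set S : Set ℝ := {T | ∃ γ : ℝ → E, γ 0 = x ∧
    ∀ t ∈ Ioo (-T) T, γ t ∈ O ∧ HasDerivAt γ (v (γ t)) t} with hS
  -- by uniqueness, the solutions on the various intervals fit together
  have glue : ∃ γ : ℝ → E, γ 0 = x ∧ ∀ T ∈ S, ∀ t ∈ Ioo (-T) T,
      γ t ∈ O ∧ HasDerivAt γ (v (γ t)) t := by
    classical
    choose! g hg0 hg using fun T (hT : T ∈ S) => hT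
    have huniq : ∀ T ∈ S, ∀ T' ∈ S, ∀ t, |t| < T → |t| < T' → g T t = g T' t := by
      intro T hT T' hT' t h h'
      refine eqOn_of_solutions (T := |t|) (γ := g T') (β := g T) hO hv (fun s hs => ?_)
        (fun s hs => ?_) ?_ t (abs_le.1 le_rfl)
      · exact hg T' hT' s (abs_lt.1 ((abs_le.2 hs).trans_lt h'))
      · exact (hg T hT s (abs_lt.1 ((abs_le.2 hs).trans_lt h))).2
      · rw [hg0 T hT, hg0 T' hT']
    set γ : ℝ → E := fun t => if h : ∃ T ∈ S, |t| < T then g h.choose t else x with hγ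
    have hγT : ∀ T ∈ S, ∀ t, |t| < T → γ t = g T t := by
      intro T hT t ht
      have h : ∃ T ∈ S, |t| < T := ⟨T, hT, ht⟩
      simp only [hγ, dif_pos h]
      exact huniq _ h.choose_spec.1 _ hT t h.choose_spec.2 ht
    refine ⟨γ, ?_, fun T hT t ht => ?_⟩
    · by_cases h : ∃ T ∈ S, |(0 : ℝ)| < T
      · simp only [hγ, dif_pos h]
        exact hg0 _ h.choose_spec.1
      · simp only [hγ, dif_neg h]
    · have hev : γ =ᶠ[𝓝 t] g T := by
        filter_upwards [Ioo_mem_nhds ht.1 ht.2] with s hs using hγT T hT s (abs_lt.2 hs)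
      rw [hγT T hT t (abs_lt.2 ht)]
      exact ⟨(hg T hT t ht).1, (hg T hT t ht).2.congr_of_eventuallyEq hev⟩
  obtain ⟨γ, hγ0, hγ⟩ := glue
  by_cases hbd : BddAbove S
  · exfalso
    obtain ⟨α, hα0, ε, hε, hα⟩ :=
      ((hv.contDiffAt (hO.mem_nhds hx)).exists_forall_mem_closedBall_exists_eq_forall_mem_Ioo_hasDerivAt₀ 0)
    have hSpos : ∃ T ∈ S, 0 < T := by
      have hαc : ContinuousAt α 0 := (hα 0 ⟨by linarith, by linarith⟩).continuousAt
      have hαO : ∀ᶠ t in 𝓝 (0 : ℝ), α t ∈ O :=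
        hαc.eventually (by rw [hα0]; exact hO.mem_nhds hx)
      obtain ⟨ε', hε', hαO⟩ := Metric.eventually_nhds_iff.1 hαO
      refine ⟨min ε ε', ⟨α, hα0, fun t ht => ?_⟩, lt_min hε hε'⟩
      have hta := abs_lt.2 ht
      refine ⟨hαO (by simpa using hta.trans_le (min_le_right _ _)), hα t ?_⟩
      have := abs_lt.1 (hta.trans_le (min_le_left _ _))
      simpa using this
    obtain ⟨T₀, hT₀, hT₀pos⟩ := hSpos
    set T := sSup S
    have hTpos : 0 < T := hT₀pos.trans_le (le_csSup hbd hT₀)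
    have hsol : ∀ t ∈ Ioo (-T) T, γ t ∈ O ∧ HasDerivAt γ (v (γ t)) t := by
      intro t ht
      obtain ⟨T', hT', h⟩ := exists_lt_of_lt_csSup ⟨T₀, hT₀⟩ (abs_lt.2 ht)
      exact hγ T' hT' t (abs_lt.1 h)
    obtain ⟨⟨p, hp, hpl⟩, q, hq, hql⟩ := hlim T hTpos γ hγ0 hsol
    obtain ⟨δ, hδ, β, hβ, hβsol⟩ :=
      exists_solution_extension hO hv (by linarith : -T < T) hsol hp hpl
    -- the extension to the left is the extension to the right for the reversed field
    have hsol' : ∀ t ∈ Ioo (-(T + δ)) T,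
        β (-t) ∈ O ∧ HasDerivAt (fun s => β (-s)) ((-v) (β (-t))) t := by
      intro t ht
      have := hβsol (-t) ⟨by linarith [ht.2], by linarith [ht.1]⟩
      exact ⟨this.1, hasDerivAt_comp_neg_of_solution this.2⟩
    have hlim' : Tendsto (fun s => β (-s)) (𝓝[<] T) (𝓝 q) := by
      have h1 : Tendsto (fun s : ℝ => -s) (𝓝[<] T) (𝓝[>] (-T)) := tendsto_neg_nhdsLT
      refine (hql.comp h1).congr' ?_
      filter_upwards [Ioo_mem_nhdsLT (show -T < T by linarith)] with s hs
      exact (hβ (-s) (by linarith [hs.1])).symm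
    obtain ⟨δ', hδ', β', hβ', hβ'sol⟩ := exists_solution_extension (v := -v) hO hv.neg
      (by linarith : -(T + δ) < T) hsol' hq hlim'
    have hmem : T + min δ δ' ∈ S := by
      refine ⟨fun s => β' (-s), ?_, fun t ht => ?_⟩
      · change β' (-0) = x
        rw [neg_zero, hβ' 0 hTpos, neg_zero, hβ 0 hTpos, hγ0]
      · have h1 := min_le_left δ δ'
        have h2 := min_le_right δ δ'
        have := hβ'sol (-t) ⟨by linarith [ht.2], by linarith [ht.1]⟩
        refine ⟨this.1, ?_⟩
        simpa using hasDerivAt_comp_neg_of_solution (v := -v) this.2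
    have := le_csSup hbd hmem
    have : 0 < min δ δ' := lt_min hδ hδ'
    linarith
  · refine ⟨γ, hγ0, fun t => ?_⟩
    rw [not_bddAbove_iff] at hbd
    obtain ⟨T, hT, h⟩ := hbd |t|
    exact hγ T hT t (abs_lt.1 h)

end ODE

/-! ### Complete flows -/

section ODE

variable {E : Type*} [NormedAddCommGroup E] [NormedSpace ℝ E]

/-- `φ` is a flow of the vector field `v` on `O`, complete in both directions of time. -/
structure IsCompleteFlow (v : E → E) (O : Set E) (φ : ℝ → E → E) : Prop where
  zero : ∀ x ∈ O, φ 0 x = x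
  mem : ∀ x ∈ O, ∀ t, φ t x ∈ O
  hasDerivAt : ∀ x ∈ O, ∀ t, HasDerivAt (fun s => φ s x) (v (φ t x)) t

/-- The divergence of a vector field: the trace of its derivative. -/
noncomputable def divergence (v : E → E) (x : E) : ℝ := LinearMap.trace ℝ E (fderiv ℝ v x)

variable [FiniteDimensional ℝ E]

/-- A curve of bounded speed on a bounded open interval has limits at both end points. -/
theorem exists_tendsto_of_norm_deriv_le {f f' : ℝ → E} {a b M : ℝ}
    (hf : ∀ t ∈ Ioo a b, HasDerivAt f (f' t) t) (hM : ∀ t ∈ Ioo a b, ‖f' t‖ ≤ M) (hab : a < b) :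
    (∃ p, Tendsto f (𝓝[<] b) (𝓝 p)) ∧ ∃ p, Tendsto f (𝓝[>] a) (𝓝 p) := by
  have hlip : LipschitzOnWith M.toNNReal f (Ioo a b) :=
    (convex_Ioo a b).lipschitzOnWith_of_nnnorm_hasDerivWithin_le
      (fun t ht => (hf t ht).hasDerivWithinAt)
      (fun t ht => by
        rw [← NNReal.coe_le_coe, coe_nnnorm]
        exact (hM t ht).trans (Real.le_coe_toNNReal M))
  obtain ⟨g, hg, hfg⟩ := hlip.extend_finite_dimension
  refine ⟨⟨g b, ?_⟩, ⟨g a, ?_⟩⟩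
  · refine ((hg.continuous.tendsto b).mono_left nhdsWithin_le_nhds).congr' ?_
    filter_upwards [Ioo_mem_nhdsLT hab] with t ht using (hfg ht).symm
  · refine ((hg.continuous.tendsto a).mono_left nhdsWithin_le_nhds).congr' ?_
    filter_upwards [Ioo_mem_nhdsGT hab] with t ht using (hfg ht).symm

namespace IsCompleteFlow

variable {v : E → E} {O : Set E} {φ : ℝ → E → E}

theorem eq_of_hasDerivAt (h : IsCompleteFlow v O φ) (hO : IsOpen O) (hv : ContDiffOn ℝ 1 v O)
    {x : E} (hx : x ∈ O) {T : ℝ} {β : ℝ → E} (h0 : β 0 = x)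
    (hβ : ∀ t ∈ Icc (-T) T, HasDerivAt β (v (β t)) t) : ∀ t ∈ Icc (-T) T, β t = φ t x :=
  eqOn_of_solutions hO hv (γ := fun t => φ t x)
    (fun t _ => ⟨h.mem x hx t, h.hasDerivAt x hx t⟩) hβ (by rw [h0, h.zero x hx])

theorem add (h : IsCompleteFlow v O φ) (hO : IsOpen O) (hv : ContDiffOn ℝ 1 v O)
    {x : E} (hx : x ∈ O) (s t : ℝ) : φ (s + t) x = φ s (φ t x) := by
  refine h.eq_of_hasDerivAt hO hv (h.mem x hx t) (T := |s|) (β := fun r => φ (r + t) x)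
    (by simp) (fun r _ => ?_) s (abs_le.1 le_rfl)
  exact (h.hasDerivAt x hx (r + t)).comp_add_const r t

theorem neg_apply (h : IsCompleteFlow v O φ) (hO : IsOpen O) (hv : ContDiffOn ℝ 1 v O)
    {x : E} (hx : x ∈ O) (t : ℝ) : φ (-t) (φ t x) = x := by
  rw [← h.add hO hv hx, neg_add_cancel, h.zero x hx]

theorem apply_neg (h : IsCompleteFlow v O φ) (hO : IsOpen O) (hv : ContDiffOn ℝ 1 v O)
    {x : E} (hx : x ∈ O) (t : ℝ) : φ t (φ (-t) x) = x := by
  rw [← h.add hO hv hx, add_neg_cancel, h.zero x hx]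

omit [FiniteDimensional ℝ E] in
theorem continuous_time (h : IsCompleteFlow v O φ) {x : E} (hx : x ∈ O) :
    Continuous fun t => φ t x :=
  continuous_iff_continuousAt.2 fun t => (h.hasDerivAt x hx t).continuousAt

theorem exists_norm_sub_le (h : IsCompleteFlow v O φ) (hO : IsOpen O) (hv : ContDiffOn ℝ 1 v O)
    {x : E} (hx : x ∈ O) (T : ℝ) : ∃ δ > 0, ∃ M ≥ 0, ∀ y, ‖y - x‖ < δ → y ∈ O ∧
      ∀ t ∈ Icc (-T) T, ‖φ t y - φ t x‖ ≤ M * ‖y - x‖ := by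
  obtain ⟨δ, hδ, M, hM, hd⟩ := exists_norm_sub_le_of_solutions hO hv (T := T)
    (γ := fun t => φ t x) (fun t _ => ⟨h.mem x hx t, h.hasDerivAt x hx t⟩)
  obtain ⟨δ', hδ', hO'⟩ := Metric.isOpen_iff.1 hO x hx
  refine ⟨min δ δ', lt_min hδ hδ', M, hM, fun y hy => ?_⟩
  have hyO : y ∈ O := hO' (mem_ball_iff_norm.2 (hy.trans_le (min_le_right _ _)))
  refine ⟨hyO, ?_⟩
  have := hd (fun t => φ t y) (fun t _ => h.hasDerivAt y hyO t)
    (by simpa only [h.zero y hyO, h.zero x hx] using hy.trans_le (min_le_left _ _))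
  simpa only [h.zero y hyO, h.zero x hx] using this

theorem continuousOn (h : IsCompleteFlow v O φ) (hO : IsOpen O) (hv : ContDiffOn ℝ 1 v O) :
    ContinuousOn (fun p : ℝ × E => φ p.1 p.2) (univ ×ˢ O) := by
  rintro ⟨t, x⟩ ⟨-, hx⟩
  refine ContinuousAt.continuousWithinAt ?_
  obtain ⟨δ, hδ, M, hM, hd⟩ := h.exists_norm_sub_le hO hv hx (|t| + 1)
  have hx' : Tendsto (fun p : ℝ × E => ‖p.2 - x‖) (𝓝 (t, x)) (𝓝 0) := by
    have : Continuous fun p : ℝ × E => ‖p.2 - x‖ := by fun_prop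
    simpa using this.tendsto (t, x)
  have ht' : Tendsto (fun p : ℝ × E => φ p.1 x) (𝓝 (t, x)) (𝓝 (φ t x)) :=
    ((h.continuous_time hx).tendsto t).comp continuous_fst.continuousAt
  have hdiff : Tendsto (fun p : ℝ × E => φ p.1 p.2 - φ p.1 x) (𝓝 (t, x)) (𝓝 0) := by
    refine squeeze_zero_norm' ?_ (by simpa using hx'.const_mul M)
    have h1 : ∀ᶠ p : ℝ × E in 𝓝 (t, x), ‖p.2 - x‖ < δ := hx'.eventually_lt_const hδ
    have h2 : ∀ᶠ p : ℝ × E in 𝓝 (t, x), |p.1 - t| < 1 := by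
      have : Continuous fun p : ℝ × E => |p.1 - t| := by fun_prop
      have := this.tendsto (t, x)
      simp only [sub_self, abs_zero] at this
      exact this.eventually_lt_const one_pos
    filter_upwards [h1, h2] with p hp1 hp2
    refine (hd p.2 hp1).2 p.1 ?_
    have := abs_lt.1 hp2
    have h3 := abs_le.1 (le_refl |t|)
    constructor <;> linarith
  have := hdiff.add ht'
  simpa [ContinuousAt] using this

/-- The solution of the variational equation along a trajectory. -/
theorem exists_variational_solution (h : IsCompleteFlow v O φ) (hO : IsOpen O)
    (hv : ContDiffOn ℝ 2 v O) {x : E} (hx : x ∈ O) :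
    ∃ L : ℝ → E →L[ℝ] E, L 0 = ContinuousLinearMap.id ℝ E ∧
      ∀ t, HasDerivAt L ((fderiv ℝ v (φ t x)).comp (L t)) t := by
  have hv1 : ContDiffOn ℝ 1 v O := hv.of_le one_le_two
  have hdv : ContDiffOn ℝ 1 (fderiv ℝ v) O := hv.fderiv_of_isOpen hO (by norm_num)
  set V : E × (E →L[ℝ] E) → E × (E →L[ℝ] E) := fun p => (v p.1, (fderiv ℝ v p.1).comp p.2) with hV
  have hVC : ContDiffOn ℝ 1 V (O ×ˢ univ) := by
    refine ContDiffOn.prodMk (hv1.comp contDiffOn_fst fun p hp => hp.1) ?_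
    exact ContDiffOn.clm_comp (hdv.comp contDiffOn_fst fun p hp => hp.1) contDiffOn_snd
  obtain ⟨γ, hγ0, hγ⟩ := exists_global_solution (v := V) (O := O ×ˢ univ)
    (x := (x, ContinuousLinearMap.id ℝ E)) (hO.prod isOpen_univ) hVC ⟨hx, trivial⟩ (by
    intro T hT γ hγ0 hγ
    have h1 : ∀ t ∈ Ioo (-T) T, HasDerivAt (fun s => (γ s).1) (v (γ t).1) t :=
      fun t ht => (hγ t ht).2.fst
    have h2 : ∀ t ∈ Ioo (-T) T,
        HasDerivAt (fun s => (γ s).2) ((fderiv ℝ v (γ t).1).comp (γ t).2) t :=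
      fun t ht => (hγ t ht).2.snd
    have hfst : ∀ t ∈ Ioo (-T) T, (γ t).1 = φ t x := by
      intro t ht
      refine h.eq_of_hasDerivAt hO hv1 hx (T := |t|) (β := fun s => (γ s).1) (by rw [hγ0])
        (fun s hs => h1 s ?_) t (abs_le.1 le_rfl)
      exact abs_lt.1 ((abs_le.2 hs).trans_lt (abs_lt.2 ht))
    have hAc : Continuous fun t => fderiv ℝ v (φ t x) :=
      hdv.continuousOn.comp_continuous (h.continuous_time hx) (h.mem x hx)
    obtain ⟨C, hC⟩ := (isCompact_Icc (a := -T) (b := T)).exists_bound_of_continuousOn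
      hAc.continuousOn
    have hC0 : 0 ≤ C := (norm_nonneg _).trans (hC 0 ⟨by linarith, by linarith⟩)
    have hderiv : ∀ t ∈ Ioo (-T) T, ‖(fderiv ℝ v (γ t).1).comp (γ t).2‖ ≤ C * ‖(γ t).2‖ := by
      intro t ht
      refine (ContinuousLinearMap.opNorm_comp_le _ _).trans ?_
      gcongr
      rw [hfst t ht]
      exact hC t ⟨ht.1.le, ht.2.le⟩
    have hbound : ∀ t ∈ Ioo (-T) T, ‖(γ t).2‖ ≤ ‖(γ 0).2‖ * Real.exp (C * T) := by
      intro t ht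
      have hlt := abs_lt.2 ht
      have := norm_le_gronwallBound_of_abs_le (T := |t|) hC0 le_rfl
        (fun s hs => h2 s (abs_lt.1 ((abs_le.2 hs).trans_lt hlt)))
        (fun s hs => by
          simpa using hderiv s (abs_lt.1 ((abs_le.2 hs).trans_lt hlt))) t (abs_le.1 le_rfl)
      rw [gronwallBound_ε0] at this
      refine this.trans ?_
      gcongr
    obtain ⟨⟨p, hp⟩, q, hq⟩ := exists_tendsto_of_norm_deriv_le (M := C * (‖(γ 0).2‖ * Real.exp (C * T)))
      h2 (fun t ht => (hderiv t ht).trans (by gcongr; exact hbound t ht)) (by linarith)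
    have hφ := h.continuous_time hx
    refine ⟨⟨(φ T x, p), ⟨h.mem x hx T, trivial⟩, ?_⟩, ⟨(φ (-T) x, q), ⟨h.mem x hx _, trivial⟩, ?_⟩⟩
    · refine Tendsto.prodMk_nhds (f := 𝓝[<] T) ?_ hp
      refine ((hφ.tendsto T).mono_left nhdsWithin_le_nhds).congr' ?_
      filter_upwards [Ioo_mem_nhdsLT (show -T < T by linarith)] with t ht using (hfst t ht).symm
    · refine Tendsto.prodMk_nhds (f := 𝓝[>] (-T)) ?_ hq
      refine ((hφ.tendsto (-T)).mono_left nhdsWithin_le_nhds).congr' ?_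
      filter_upwards [Ioo_mem_nhdsGT (show -T < T by linarith)] with t ht using (hfst t ht).symm)
  have h1 : ∀ t, (γ t).1 = φ t x := by
    intro t
    exact h.eq_of_hasDerivAt hO hv1 hx (T := |t|) (β := fun s => (γ s).1) (by rw [hγ0])
      (fun s _ => (hγ s).2.fst) t (abs_le.1 le_rfl)
  refine ⟨fun t => (γ t).2, by simp [hγ0], fun t => ?_⟩
  have := (hγ t).2.snd
  rwa [← h1 t]

/-- The flow is differentiable in the initial value, and its derivative solves the variational
equation. -/
theorem hasFDerivAt_of_variational (h : IsCompleteFlow v O φ) (hO : IsOpen O)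
    (hv : ContDiffOn ℝ 2 v O) {x : E} (hx : x ∈ O) {L : ℝ → E →L[ℝ] E}
    (hL0 : L 0 = ContinuousLinearMap.id ℝ E)
    (hL : ∀ t, HasDerivAt L ((fderiv ℝ v (φ t x)).comp (L t)) t) (t : ℝ) :
    HasFDerivAt (φ t) (L t) x := by
  have hv1 : ContDiffOn ℝ 1 v O := hv.of_le one_le_two
  have hdv : ContDiffOn ℝ 1 (fderiv ℝ v) O := hv.fderiv_of_isOpen hO (by norm_num)
  have hφ := h.continuous_time hx
  set T := |t|
  have hAc : Continuous fun t => fderiv ℝ v (φ t x) :=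
    hdv.continuousOn.comp_continuous hφ (h.mem x hx)
  obtain ⟨C, hC⟩ := (isCompact_Icc (a := -T) (b := T)).exists_bound_of_continuousOn
    hAc.continuousOn
  set A := max C 1
  have hA : 0 < A := lt_max_of_lt_right one_pos
  obtain ⟨δ₁, hδ₁, M, hM, hd⟩ := h.exists_norm_sub_le hO hv1 hx T
  have hcpt : IsCompact ((fun s => φ s x) '' Icc (-T) T) := isCompact_Icc.image hφ
  have hsub : (fun s => φ s x) '' Icc (-T) T ⊆ O := by
    rintro _ ⟨s, -, rfl⟩
    exact h.mem x hx s
  rw [hasFDerivAt_iff_isLittleO_nhds_zero, Asymptotics.isLittleO_iff]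
  intro η hη
  set B := M / A * (Real.exp (A * T) - 1)
  have hB : 0 ≤ B := by
    have : 1 ≤ Real.exp (A * T) := Real.one_le_exp (by positivity)
    have : 0 ≤ M / A := by positivity
    exact mul_nonneg this (by linarith)
  obtain ⟨δ₂, hδ₂, happrox⟩ := exists_fderiv_approx_near_compact hO hv1 hcpt hsub
    (show 0 < η / (B + 1) by positivity)
  have hnear : ∀ᶠ k : E in 𝓝 0, ‖k‖ < min δ₁ (δ₂ / (M + 1)) := by
    have : Tendsto (fun k : E => ‖k‖) (𝓝 0) (𝓝 0) := by simpa using (continuous_norm (E := E)).tendsto 0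
    exact this.eventually_lt_const (lt_min hδ₁ (by positivity))
  filter_upwards [hnear] with k hk
  set y := x + k
  have hyx : y - x = k := by simp [y]
  obtain ⟨hyO, hyd⟩ := hd y (by rw [hyx]; exact hk.trans_le (min_le_left _ _))
  rw [hyx] at hyd
  have hclose : ∀ s ∈ Icc (-T) T, ‖φ s y - φ s x‖ ≤ δ₂ := by
    intro s hs
    have h3 : ‖k‖ < δ₂ / (M + 1) := hk.trans_le (min_le_right _ _)
    rw [lt_div_iff₀ (by positivity)] at h3
    have := hyd s hs
    nlinarith [norm_nonneg k]
  have hgron := norm_le_gronwallBound_of_abs_le (T := T) (K := A)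
    (η := η / (B + 1) * (M * ‖k‖))
    (f := fun s => φ s y - φ s x - L s k)
    (f' := fun s => v (φ s y) - v (φ s x) - fderiv ℝ v (φ s x) (L s k)) hA.le (by positivity)
    (fun s _ => ((h.hasDerivAt y hyO s).sub (h.hasDerivAt x hx s)).sub
      (by simpa using (hL s).clm_apply (hasDerivAt_const s k)))
    (fun s hs => by
      have e : v (φ s y) - v (φ s x) - fderiv ℝ v (φ s x) (L s k) =
          fderiv ℝ v (φ s x) (φ s y - φ s x - L s k) +
          (v (φ s y) - v (φ s x) - fderiv ℝ v (φ s x) (φ s y - φ s x)) := by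
        rw [map_sub (fderiv ℝ v (φ s x)) (φ s y - φ s x)]; abel
      simp only [e]
      refine (norm_add_le _ _).trans (add_le_add ?_ ?_)
      · refine (ContinuousLinearMap.le_opNorm _ _).trans ?_
        gcongr
        exact (hC s hs).trans (le_max_left _ _)
      · refine (happrox (φ s x) ⟨s, hs, rfl⟩ (φ s y) (hclose s hs)).trans ?_
        gcongr
        exact hyd s hs) t (abs_le.1 le_rfl)
  have h0 : ‖φ 0 y - φ 0 x - L 0 k‖ = 0 := by
    rw [h.zero y hyO, h.zero x hx, hL0, hyx]; simp
  simp only [h0] at hgron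
  rw [gronwallBound_of_K_ne_0 hA.ne'] at hgron
  simp only [zero_mul, zero_add] at hgron
  refine hgron.trans ?_
  have e : η / (B + 1) * (M * ‖k‖) / A * (Real.exp (A * T) - 1) = η * ‖k‖ * (B / (B + 1)) := by
    simp only [B]; ring
  rw [e]
  have : B / (B + 1) ≤ 1 := (div_le_one (by positivity)).2 (by linarith)
  exact mul_le_of_le_one_right (by positivity) this

end IsCompleteFlow

/-! ### Liouville's formula -/

theorem differentiable_det : Differentiable ℝ fun A : E →L[ℝ] E => A.det := by
  classical
  set b := Module.finBasis ℝ E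
  have : (fun A : E →L[ℝ] E => A.det) = fun A : E →L[ℝ] E =>
      (LinearMap.toMatrix b b (A : E →ₗ[ℝ] E)).det := by
    ext A
    rw [LinearMap.det_toMatrix]
  rw [this]
  simp only [Matrix.det_apply]
  have hentry : ∀ i j, ContDiff ℝ 1 fun A : E →L[ℝ] E =>
      LinearMap.toMatrix b b (A : E →ₗ[ℝ] E) i j := by
    intro i j
    have : (fun A : E →L[ℝ] E => LinearMap.toMatrix b b (A : E →ₗ[ℝ] E) i j) =
        fun A : E →L[ℝ] E => (b.coord i).toContinuousLinearMap (A (b j)) := by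
      ext A
      simp [LinearMap.toMatrix_apply]
    rw [this]
    fun_prop
  refine ContDiff.differentiable (n := 1) ?_ one_ne_zero
  exact ContDiff.sum fun σ _ => (contDiff_prod fun i _ => hentry _ _).const_smul _

/-- Jacobi's formula at the identity. -/
theorem hasDerivAt_det_one_add_smul (A : E →L[ℝ] E) :
    HasDerivAt (fun r : ℝ => (ContinuousLinearMap.id ℝ E + r • A).det)
      (LinearMap.trace ℝ E A) 0 := by
  classical
  set b := Module.finBasis ℝ E
  set M := LinearMap.toMatrix b b (A : E →ₗ[ℝ] E) with hM
  have e : (fun r : ℝ => (ContinuousLinearMap.id ℝ E + r • A).det) = fun r : ℝ =>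
      (1 + r • M).det := by
    ext r
    have : (ContinuousLinearMap.id ℝ E + r • A).det =
        (LinearMap.toMatrix b b (LinearMap.id + r • (A : E →ₗ[ℝ] E))).det := by
      rw [LinearMap.det_toMatrix]; rfl
    rw [this, map_add, map_smul, LinearMap.toMatrix_id]
  rw [e, LinearMap.trace_eq_matrix_trace ℝ b]
  set P := (Matrix.det (1 + (Polynomial.X : Polynomial ℝ) • M.map Polynomial.C)).divX.divX
  have e2 : (fun r : ℝ => (1 + r • M).det) = fun r : ℝ => 1 + M.trace * r + P.eval r * r ^ 2 := by
    ext r; exact Matrix.det_one_add_smul r M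
  rw [e2]
  have := (((hasDerivAt_id (0 : ℝ)).const_mul M.trace).const_add 1).add
    ((P.hasDerivAt 0).mul ((hasDerivAt_id (0 : ℝ)).pow 2))
  exact this.congr_deriv (by simp [hM])

/-- Jacobi's formula along a solution of a linear differential equation. -/
theorem HasDerivAt.det_of_linear {L : ℝ → E →L[ℝ] E} {A : E →L[ℝ] E} {t : ℝ}
    (hL : HasDerivAt L (A.comp (L t)) t) :
    HasDerivAt (fun s => (L s).det) (LinearMap.trace ℝ E A * (L t).det) t := by
  have hdet := (differentiable_det (L t)).hasFDerivAt
  have h1 : HasDerivAt (fun s => (L s).det)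
      (fderiv ℝ (fun B : E →L[ℝ] E => B.det) (L t) (A.comp (L t))) t :=
    hdet.comp_hasDerivAt t hL
  have h2 : HasDerivAt (fun r : ℝ => (L t + r • A.comp (L t)).det)
      (fderiv ℝ (fun B : E →L[ℝ] E => B.det) (L t) (A.comp (L t))) 0 := by
    have h3 : HasDerivAt (fun r : ℝ => L t + r • A.comp (L t)) (A.comp (L t)) 0 := by
      simpa using ((hasDerivAt_id (0 : ℝ)).smul_const (A.comp (L t))).const_add (L t)
    have hdet' : HasFDerivAt (fun B : E →L[ℝ] E => B.det)
      (fderiv ℝ (fun B : E →L[ℝ] E => B.det) (L t)) (L t + (0 : ℝ) • A.comp (L t)) := by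
      simpa using hdet
    exact hdet'.comp_hasDerivAt 0 h3
  have h4 : HasDerivAt (fun r : ℝ => (L t + r • A.comp (L t)).det)
      (LinearMap.trace ℝ E A * (L t).det) 0 := by
    have := (hasDerivAt_det_one_add_smul A).mul_const (L t).det
    refine this.congr_of_eventuallyEq (Eventually.of_forall fun r => ?_)
    have e : L t + r • A.comp (L t) = (ContinuousLinearMap.id ℝ E + r • A).comp (L t) := by
      ext y; simp
    simp only [e]
    exact LinearMap.det_comp _ _
  rwa [h2.unique h4] at h1

namespace IsCompleteFlow

variable {v : E → E} {O : Set E} {φ : ℝ → E → E}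

theorem continuousOn_divergence (hO : IsOpen O)
    (hv : ContDiffOn ℝ 1 v O) : ContinuousOn (divergence v) O := by
  have h1 : ContinuousOn (fderiv ℝ v) O := hv.continuousOn_fderiv_of_isOpen hO le_rfl
  have h2 : Continuous fun A : E →L[ℝ] E => LinearMap.trace ℝ E (A : E →ₗ[ℝ] E) :=
    LinearMap.continuous_of_finiteDimensional
      ((LinearMap.trace ℝ E).comp (ContinuousLinearMap.coeLM ℝ))
  exact h2.comp_continuousOn h1

theorem differentiableAt (h : IsCompleteFlow v O φ) (hO : IsOpen O)
    (hv : ContDiffOn ℝ 2 v O) {x : E} (hx : x ∈ O) (t : ℝ) : DifferentiableAt ℝ (φ t) x := by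
  obtain ⟨L, hL0, hL⟩ := h.exists_variational_solution hO hv hx
  exact (h.hasFDerivAt_of_variational hO hv hx hL0 hL t).differentiableAt

/-- Liouville's formula. -/
theorem det_fderiv (h : IsCompleteFlow v O φ) (hO : IsOpen O)
    (hv : ContDiffOn ℝ 2 v O) {x : E} (hx : x ∈ O) (t : ℝ) :
    (fderiv ℝ (φ t) x).det = Real.exp (∫ s in (0 : ℝ)..t, divergence v (φ s x)) := by
  obtain ⟨L, hL0, hL⟩ := h.exists_variational_solution hO hv hx
  have hfd : ∀ t, fderiv ℝ (φ t) x = L t :=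
    fun t => (h.hasFDerivAt_of_variational hO hv hx hL0 hL t).fderiv
  rw [hfd]
  have hc : Continuous fun s => divergence v (φ s x) :=
    (continuousOn_divergence hO (hv.of_le one_le_two)).comp_continuous
      (h.continuous_time hx) (h.mem x hx)
  have hint : ∀ t, HasDerivAt (fun t => ∫ s in (0 : ℝ)..t, divergence v (φ s x))
      (divergence v (φ t x)) t := fun t =>
    intervalIntegral.integral_hasDerivAt_right (hc.intervalIntegrable _ _)
      hc.aestronglyMeasurable.stronglyMeasurableAtFilter hc.continuousAt
  have hconst : ∀ t, HasDerivAt (fun t => (L t).det *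
      Real.exp (-∫ s in (0 : ℝ)..t, divergence v (φ s x))) 0 t := by
    intro t
    have := (hL t).det_of_linear.mul (hint t).neg.exp
    refine this.congr_deriv ?_
    change divergence v (φ t x) * (L t).det * _ + _ = _
    ring
  have := is_const_of_deriv_eq_zero (fun t => (hconst t).differentiableAt)
    (fun t => (hconst t).deriv) t 0
  simp only [hL0, intervalIntegral.integral_same, neg_zero, Real.exp_zero, mul_one] at this
  have hid : (ContinuousLinearMap.id ℝ E).det = 1 := LinearMap.det_id
  rw [hid, Real.exp_neg] at this
  have hne := (Real.exp_pos (∫ s in (0 : ℝ)..t, divergence v (φ s x))).ne'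
  field_simp at this
  exact this

end IsCompleteFlow

end ODE

/-! ### Completeness of velocity fields tangent to the boundary -/

theorem exists_bound_fderiv_fderiv {E : Type*} [NormedAddCommGroup E] [NormedSpace ℝ E]
    {ρ : E → ℝ} (hρ : ContDiff ℝ 1 (fderiv ℝ ρ)) {C : Set E} (hC : IsCompact C) :
    ∃ M ≥ 0, ∀ x ∈ C, ∀ m w, ‖fderiv ℝ (fderiv ℝ ρ) x m w‖ ≤ M * ‖m‖ * ‖w‖ := by
  obtain ⟨M, hM⟩ := hC.exists_bound_of_continuousOn
    (hρ.continuous_fderiv one_ne_zero).continuousOn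
  refine ⟨max M 0, le_max_right _ _, fun x hx m w => ?_⟩
  refine ((fderiv ℝ (fderiv ℝ ρ) x).le_opNorm₂ m w).trans ?_
  gcongr
  exact (hM x hx).trans (le_max_left _ _)

namespace FlowDomain

variable {d : ℕ} {D : FlowDomain d} {b c : EuclideanSpace ℝ (Fin d) → EuclideanSpace ℝ (Fin d)}

theorem isOpen_cover (D : FlowDomain d) : IsOpen D.cover := by
  cases D with
  | euclidean Ω h _ _ => exact h
  | torus v => exact isOpen_univ

theorem exists_isDefiningFunctionAt (D : FlowDomain d) {p : EuclideanSpace ℝ (Fin d)}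
    (hp : p ∈ frontier D.cover) : ∃ ρ, IsDefiningFunctionAt D.cover p ρ := by
  cases D with
  | euclidean Ω _ _ h => exact h p hp
  | torus v => simp [cover] at hp

theorem add_mem_cover {l : EuclideanSpace ℝ (Fin d)} (hl : l ∈ D.periods)
    {x : EuclideanSpace ℝ (Fin d)} (hx : x ∈ D.cover) : x + l ∈ D.cover := by
  cases D with
  | euclidean Ω _ _ h =>
    have : l = 0 := by simpa [periods] using hl
    simpa [this] using hx
  | torus v => trivial

theorem add_mem_cover_iff {l : EuclideanSpace ℝ (Fin d)} (hl : l ∈ D.periods)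
    {x : EuclideanSpace ℝ (Fin d)} : x + l ∈ D.cover ↔ x ∈ D.cover :=
  ⟨fun h => by simpa using add_mem_cover (neg_mem hl) h, add_mem_cover hl⟩

namespace IsVelocityField

theorem contDiffOn (h : D.IsVelocityField b) (n : ℕ) : ContDiffOn ℝ n b D.cover :=
  (h.smooth.mono subset_closure).of_le (by exact_mod_cast le_top)

theorem contDiffOn_one (h : D.IsVelocityField b) : ContDiffOn ℝ 1 b D.cover := by
  exact_mod_cast h.contDiffOn 1

theorem contDiffOn_two (h : D.IsVelocityField b) : ContDiffOn ℝ 2 b D.cover := by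
  exact_mod_cast h.contDiffOn 2

theorem differentiableAt (h : D.IsVelocityField b) {x : EuclideanSpace ℝ (Fin d)}
    (hx : x ∈ D.cover) : DifferentiableAt ℝ b x :=
  (h.contDiffOn_one.differentiableOn one_ne_zero).differentiableAt (D.isOpen_cover.mem_nhds hx)

theorem neg (h : D.IsVelocityField b) : D.IsVelocityField (-b) where
  smooth := h.smooth.neg
  periodic := fun l hl x => by simp [h.periodic l hl x]
  tangent := fun p hp ρ hρ => by simp [h.tangent p hp ρ hρ]
  bounded_gradient := by
    obtain ⟨C, hC⟩ := h.bounded_gradient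
    exact ⟨C, fun x hx => by rw [fderiv_neg, norm_neg]; exact hC x hx⟩

/-- Near a boundary point the normal component of a velocity field, measured by a defining function
`ρ`, is at most a multiple of `ρ`: it vanishes on the boundary and has a bounded derivative along
the segments transversal to the boundary. -/
theorem exists_abs_normal_le (h : D.IsVelocityField b) {p : EuclideanSpace ℝ (Fin d)}
    (hp : p ∈ frontier D.cover) {ρ : EuclideanSpace ℝ (Fin d) → ℝ}
    (hρ : IsDefiningFunctionAt D.cover p ρ) :
    ρ p = 0 ∧ ∃ r > 0, ∃ K : ℝ, ∀ x ∈ D.cover ∩ Metric.ball p r,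
      ρ x < 0 ∧ |fderiv ℝ ρ x (b x)| ≤ K * -ρ x := by
  have hO := D.isOpen_cover
  have hpO : p ∉ D.cover := by
    rw [hO.frontier_eq] at hp; exact hp.2
  have hρc : Continuous ρ := hρ.contDiff.continuous
  have hρd : Differentiable ℝ ρ := hρ.contDiff.differentiable (by simp)
  have hρ' : ContDiff ℝ 1 (fderiv ℝ ρ) := (contDiff_infty.1 hρ.contDiff 2).fderiv_right (by norm_num)
  have hρ'c : Continuous (fderiv ℝ ρ) := hρ'.continuous
  have hρ'd : Differentiable ℝ (fderiv ℝ ρ) := hρ'.differentiable (by simp)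
  -- a direction `n` transversal to the boundary, in which `ρ` grows at least at the rate `1 / 2`
  obtain ⟨n, hn⟩ : ∃ n, fderiv ℝ ρ p n = 1 := by
    have : ∃ m, fderiv ℝ ρ p m ≠ 0 := by
      by_contra hcon
      push Not at hcon
      exact hρ.fderiv_ne_zero (ContinuousLinearMap.ext fun m => by simpa using hcon m)
    obtain ⟨m, hm⟩ := this
    exact ⟨(fderiv ℝ ρ p m)⁻¹ • m, by simp [hm]⟩
  have hev : ∀ᶠ x in 𝓝 p, (x ∈ D.cover ↔ ρ x < 0) ∧ 1 / 2 < fderiv ℝ ρ x n := by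
    refine hρ.mem_iff.and ?_
    have : Continuous fun x => fderiv ℝ ρ x n := by fun_prop
    exact this.continuousAt.eventually_const_lt (by simp only [hn]; norm_num)
  obtain ⟨R, hR, hball⟩ := Metric.eventually_nhds_iff_ball.1 hev
  have hρp0 : 0 ≤ ρ p := by
    by_contra hlt
    exact hpO ((hball p (Metric.mem_ball_self hR)).1.2 (not_le.1 hlt))
  have hρp1 : ρ p ≤ 0 := by
    have hcl : p ∈ closure (D.cover ∩ Metric.ball p R) :=
      mem_closure_iff_nhds.2 fun t ht => by
        obtain ⟨y, ⟨hy1, hy2⟩, hy3⟩ := mem_closure_iff_nhds.1 hp.1 (t ∩ Metric.ball p R)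
          (inter_mem ht (Metric.ball_mem_nhds p hR))
        exact ⟨y, hy1, hy3, hy2⟩
    have hsub : D.cover ∩ Metric.ball p R ⊆ {x | ρ x ≤ 0} :=
      fun x hx => ((hball x hx.2).1.1 hx.1).le
    exact closure_minimal hsub (isClosed_le hρc continuous_const) hcl
  have hρp : ρ p = 0 := le_antisymm hρp1 hρp0
  -- the zeros of `ρ` near `p` are boundary points, and `ρ` is a defining function there
  have hzero : ∀ q ∈ Metric.ball p R, ρ q = 0 → q ∈ closure D.cover ∧ fderiv ℝ ρ q (b q) = 0 := by
    intro q hq hq0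
    have hqO : q ∉ D.cover := fun hcon => by
      have := (hball q hq).1.1 hcon
      linarith
    have hline : HasDerivAt (fun s : ℝ => ρ (q - s • n)) (-(fderiv ℝ ρ q n)) 0 := by
      have h1 : HasDerivAt (fun s : ℝ => q - s • n) (-n) 0 := by
        simpa using ((hasDerivAt_id (0 : ℝ)).smul_const n).const_sub q
      have h2 : HasFDerivAt ρ (fderiv ℝ ρ q) (q - (0 : ℝ) • n) := by
        simpa using (hρd q).hasFDerivAt
      exact (h2.comp_hasDerivAt 0 h1).congr_deriv (by simp)
    have hneg : -(fderiv ℝ ρ q n) < 0 := by have := (hball q hq).2; linarith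
    have hqcl : q ∈ closure D.cover := by
      have h1 : ∀ᶠ s in 𝓝[>] (0 : ℝ), ρ (q - s • n) < 0 := by
        have := (hasDerivAt_iff_tendsto_slope.1 hline).mono_left
          (nhdsWithin_mono (0 : ℝ) (fun s (hs : 0 < s) => ne_of_gt hs))
        filter_upwards [this.eventually_lt_const hneg, self_mem_nhdsWithin] with s hs hs0
        have hs0' : (0 : ℝ) < s := hs0
        rw [slope_def_field] at hs
        simp only [zero_smul, sub_zero, hq0] at hs
        by_contra hcon
        exact absurd hs (not_lt.2 (div_nonneg (not_lt.1 hcon) hs0'.le))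
      have hcont : Tendsto (fun s : ℝ => q - s • n) (𝓝[>] 0) (𝓝 q) := by
        have : Continuous fun s : ℝ => q - s • n := by fun_prop
        simpa using (this.tendsto 0).mono_left nhdsWithin_le_nhds
      refine mem_closure_of_tendsto hcont ?_
      filter_upwards [h1, hcont.eventually (Metric.isOpen_ball.mem_nhds hq)] with s hs1 hs2
      exact (hball _ hs2).1.2 hs1
    have hqf : q ∈ frontier D.cover := by
      rw [hO.frontier_eq]; exact ⟨hqcl, hqO⟩
    refine ⟨hqcl, h.tangent q hqf ρ ⟨hρ.contDiff, ?_, ?_⟩⟩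
    · intro hcon
      have := (hball q hq).2
      rw [hcon] at this
      norm_num at this
    · filter_upwards [Metric.isOpen_ball.mem_nhds hq] with x hx using (hball x hx).1
  -- bounds on a compact neighbourhood
  have hcptb : IsCompact (closure D.cover ∩ Metric.closedBall p R) :=
    (isCompact_closedBall p R).inter_left isClosed_closure
  obtain ⟨M₁, hM₁⟩ := hcptb.exists_bound_of_continuousOn
    (h.smooth.continuousOn.mono inter_subset_left)
  obtain ⟨M₀, hM₀⟩ := (isCompact_closedBall p R).exists_bound_of_continuousOn hρ'c.continuousOn
  obtain ⟨M₂, hM2, hM₂⟩ := exists_bound_fderiv_fderiv hρ' (isCompact_closedBall p R)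
  obtain ⟨C, hC⟩ := h.bounded_gradient
  set K₀ := M₂ * ‖n‖ * M₁ + M₀ * (C * ‖n‖) with hK₀
  have hsmall : ∀ᶠ x in 𝓝 p, 2 * |ρ x| * ‖n‖ < R / 2 := by
    have : Continuous fun x => 2 * |ρ x| * ‖n‖ := by fun_prop
    refine this.continuousAt.eventually_lt_const ?_
    simp only [hρp]; simp; positivity
  obtain ⟨r₁, hr₁, hsmall⟩ := Metric.eventually_nhds_iff_ball.1 hsmall
  refine ⟨hρp, min r₁ (R / 2), lt_min hr₁ (by positivity), K₀ * 2, fun x hx => ?_⟩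
  have hxR : x ∈ Metric.ball p (R / 2) := Metric.ball_subset_ball (min_le_right _ _) hx.2
  have hxs := hsmall x (Metric.ball_subset_ball (min_le_left _ _) hx.2)
  have hxR' : x ∈ Metric.ball p R := Metric.ball_subset_ball (by linarith) hxR
  have hρx : ρ x < 0 := (hball x hxR').1.1 hx.1
  refine ⟨hρx, ?_⟩
  rw [abs_of_neg hρx] at hxs
  -- moving from `x` in the direction `n`, one meets the boundary within the time `2 |ρ x|`
  set S := 2 * -ρ x with hS
  have hSpos : 0 < S := by linarith
  have hseg : ∀ s ∈ Icc 0 S, x + s • n ∈ Metric.ball p R := by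
    intro s hs
    rw [mem_ball_iff_norm]
    have h1 : ‖x - p‖ < R / 2 := mem_ball_iff_norm.1 hxR
    have h2 : ‖s • n‖ ≤ S * ‖n‖ := by
      rw [norm_smul, Real.norm_of_nonneg hs.1]
      gcongr
      exact hs.2
    calc ‖x + s • n - p‖ = ‖(x - p) + s • n‖ := by congr 1; abel
      _ ≤ ‖x - p‖ + ‖s • n‖ := norm_add_le _ _
      _ < R := by linarith
  have hσ : ∀ s : ℝ, HasDerivAt (fun s : ℝ => x + s • n) n s := by
    intro s
    simpa using ((hasDerivAt_id s).smul_const n).const_add x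
  have hu : ∀ s : ℝ, HasDerivAt (fun s : ℝ => ρ (x + s • n)) (fderiv ℝ ρ (x + s • n) n) s :=
    fun s => (hρd _).hasFDerivAt.comp_hasDerivAt s (hσ s)
  have hucont : Continuous fun s : ℝ => ρ (x + s • n) := by fun_prop
  have hustrict : StrictMonoOn (fun s : ℝ => ρ (x + s • n)) (Icc 0 S) := by
    refine strictMonoOn_of_deriv_pos (convex_Icc 0 S) hucont.continuousOn fun s hs => ?_
    rw [interior_Icc] at hs
    rw [(hu s).deriv]
    have := (hball _ (hseg s (Ioo_subset_Icc_self hs))).2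
    linarith
  have hend : 0 ≤ ρ (x + S • n) := by
    have h1 : ∀ s ∈ Icc 0 S, HasDerivWithinAt (fun s : ℝ => ρ (x + s • n) - s / 2)
        (fderiv ℝ ρ (x + s • n) n - 1 / 2) (Icc 0 S) s := fun s _ =>
      ((hu s).sub ((hasDerivAt_id s).div_const 2)).hasDerivWithinAt
    have hmono : MonotoneOn (fun s : ℝ => ρ (x + s • n) - s / 2) (Icc 0 S) := by
      refine monotoneOn_of_deriv_nonneg (convex_Icc 0 S) (by fun_prop) (by fun_prop) fun s hs => ?_
      rw [interior_Icc] at hs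
      have hd : HasDerivAt (fun s : ℝ => ρ (x + s • n) - s / 2)
          (fderiv ℝ ρ (x + s • n) n - 1 / 2) s := (hu s).sub ((hasDerivAt_id s).div_const 2)
      rw [hd.deriv]
      have := (hball _ (hseg s (Ioo_subset_Icc_self hs))).2
      linarith
    have := hmono ⟨le_rfl, hSpos.le⟩ ⟨hSpos.le, le_rfl⟩ hSpos.le
    simp only [zero_smul, add_zero, zero_div, sub_zero] at this
    linarith
  obtain ⟨τ, hτ, hτ0⟩ : ∃ τ ∈ Icc 0 S, ρ (x + τ • n) = 0 := by
    have := intermediate_value_Icc hSpos.le hucont.continuousOn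
    have hm := this (show (0 : ℝ) ∈ Icc (ρ (x + (0 : ℝ) • n)) (ρ (x + S • n)) from
      ⟨by simpa using hρx.le, hend⟩)
    exact hm
  have hin : ∀ s ∈ Ico 0 τ, x + s • n ∈ D.cover := by
    intro s hs
    have hs' : s ∈ Icc 0 S := ⟨hs.1, hs.2.le.trans hτ.2⟩
    have := hustrict hs' hτ hs.2
    simp only [hτ0] at this
    exact (hball _ (hseg s hs')).1.2 this
  have hcl : ∀ s ∈ Icc 0 τ, x + s • n ∈ closure D.cover := by
    intro s hs
    rcases hs.2.lt_or_eq with hlt | rfl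
    · exact subset_closure (hin s ⟨hs.1, hlt⟩)
    · exact (hzero _ (hseg s hτ) hτ0).1
  -- on this segment `∇ρ · b` has a derivative bounded by `K₀`, and it vanishes at the end
  have hbound := norm_image_sub_le_of_norm_deriv_right_le_segment (a := 0) (b := τ) (C := K₀)
    (f := fun s : ℝ => fderiv ℝ ρ (x + s • n) (b (x + s • n)))
    (f' := fun s : ℝ => fderiv ℝ (fderiv ℝ ρ) (x + s • n) n (b (x + s • n)) +
      fderiv ℝ ρ (x + s • n) (fderiv ℝ b (x + s • n) n))
    (by
      have h1 : ContinuousOn (fun s : ℝ => b (x + s • n)) (Icc 0 τ) :=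
        h.smooth.continuousOn.comp (by fun_prop) hcl
      have h2 : ContinuousOn (fun s : ℝ => fderiv ℝ ρ (x + s • n)) (Icc 0 τ) := by fun_prop
      exact h2.clm_apply h1)
    (fun s hs => by
      have h1 : HasDerivAt (fun s : ℝ => b (x + s • n)) (fderiv ℝ b (x + s • n) n) s :=
        (h.differentiableAt (hin s hs)).hasFDerivAt.comp_hasDerivAt s (hσ s)
      have h2 : HasDerivAt (fun s : ℝ => fderiv ℝ ρ (x + s • n))
          (fderiv ℝ (fderiv ℝ ρ) (x + s • n) n) s :=
        (hρ'd _).hasFDerivAt.comp_hasDerivAt s (hσ s)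
      exact (h2.clm_apply h1).hasDerivWithinAt)
    (fun s hs => by
      have hm := Metric.ball_subset_closedBall (hseg s ⟨hs.1, hs.2.le.trans hτ.2⟩)
      have b0 := hM₀ _ hm
      have b1 := hM₁ _ ⟨hcl s ⟨hs.1, hs.2.le⟩, hm⟩
      have bC := hC _ (hin s hs)
      have hM0 : 0 ≤ M₀ := (norm_nonneg _).trans b0
      refine (norm_add_le _ _).trans (add_le_add ?_ ?_)
      · exact (hM₂ _ hm _ _).trans (by gcongr)
      · refine ((fderiv ℝ ρ (x + s • n)).le_opNorm _).trans ?_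
        gcongr
        exact ((fderiv ℝ b (x + s • n)).le_opNorm _).trans (by gcongr)) τ ⟨hτ.1, le_rfl⟩
  rw [(hzero _ (hseg τ hτ) hτ0).2] at hbound
  simp only [zero_smul, add_zero, zero_sub, norm_neg, sub_zero] at hbound
  have hτpos : 0 < τ := by
    rcases hτ.1.lt_or_eq with hlt | heq
    · exact hlt
    · rw [← heq] at hτ0; simp at hτ0; linarith
  have hK₀nn : 0 ≤ K₀ := by
    by_contra hneg
    have : K₀ * τ < 0 := mul_neg_of_neg_of_pos (not_le.1 hneg) hτpos
    linarith [norm_nonneg (fderiv ℝ ρ x (b x))]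
  calc |fderiv ℝ ρ x (b x)| ≤ K₀ * τ := hbound
    _ ≤ K₀ * S := by gcongr; exact hτ.2
    _ = K₀ * 2 * -ρ x := by rw [hS]; ring

/-- A trajectory does not reach the boundary in finite time. -/
theorem limit_notMem_frontier (h : D.IsVelocityField b) {a T : ℝ} (haT : a < T)
    {γ : ℝ → EuclideanSpace ℝ (Fin d)}
    (hγ : ∀ t ∈ Ioo a T, γ t ∈ D.cover ∧ HasDerivAt γ (b (γ t)) t)
    {p : EuclideanSpace ℝ (Fin d)} (hlim : Tendsto γ (𝓝[<] T) (𝓝 p)) :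
    p ∉ frontier D.cover := by
  intro hp
  obtain ⟨ρ, hρ⟩ := D.exists_isDefiningFunctionAt hp
  obtain ⟨hρp, r, hr, K, hK⟩ := h.exists_abs_normal_le hp hρ
  have hρd : Differentiable ℝ ρ := hρ.contDiff.differentiable (by simp)
  have hev : ∀ᶠ t in 𝓝[<] T, γ t ∈ Metric.ball p r := hlim.eventually (Metric.ball_mem_nhds p hr)
  obtain ⟨a', ha', hsub⟩ := (mem_nhdsLT_iff_exists_Ioo_subset' haT).1
    (inter_mem hev (Ioo_mem_nhdsLT haT))
  have hmem : ∀ t ∈ Ioo a' T, γ t ∈ D.cover ∩ Metric.ball p r :=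
    fun t ht => ⟨(hγ t (hsub ht).2).1, (hsub ht).1⟩
  -- `ρ(γ t) exp(K t)` is negative and nonincreasing, so it cannot tend to `0`
  have hder : ∀ t ∈ Ioo a' T, HasDerivAt (fun t => ρ (γ t) * Real.exp (K * t))
      (fderiv ℝ ρ (γ t) (b (γ t)) * Real.exp (K * t) + ρ (γ t) * (Real.exp (K * t) * K)) t := by
    intro t ht
    have h1 : HasDerivAt (fun t => ρ (γ t)) (fderiv ℝ ρ (γ t) (b (γ t))) t :=
      (hρd _).hasFDerivAt.comp_hasDerivAt t (hγ t (hsub ht).2).2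
    have h2 : HasDerivAt (fun t : ℝ => K * t) K t := by
      simpa using (hasDerivAt_id t).const_mul K
    exact h1.mul h2.exp
  have hanti : AntitoneOn (fun t => ρ (γ t) * Real.exp (K * t)) (Ioo a' T) := by
    refine antitoneOn_of_deriv_nonpos (convex_Ioo _ _)
      (fun t ht => (hder t ht).continuousAt.continuousWithinAt)
      (fun t ht => ?_) (fun t ht => ?_)
    · rw [interior_Ioo] at ht
      exact (hder t ht).differentiableAt.differentiableWithinAt
    · rw [interior_Ioo] at ht
      rw [(hder t ht).deriv]
      have h1 := (hK _ (hmem t ht)).2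
      have h2 := (abs_le.1 h1).2
      have h3 := Real.exp_pos (K * t)
      nlinarith
  have ha'T : a' < T := ha'
  set t₀ := (a' + T) / 2
  have ht₀ : t₀ ∈ Ioo a' T := ⟨by simp only [t₀]; linarith, by simp only [t₀]; linarith⟩
  have hlim' : Tendsto (fun t => ρ (γ t) * Real.exp (K * t)) (𝓝[<] T) (𝓝 0) := by
    have h1 : Tendsto (fun t => ρ (γ t)) (𝓝[<] T) (𝓝 0) := by
      rw [← hρp]; exact (hρ.contDiff.continuous.tendsto p).comp hlim
    have h2 : Tendsto (fun t : ℝ => Real.exp (K * t)) (𝓝[<] T) (𝓝 (Real.exp (K * T))) := by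
      have : Continuous fun t : ℝ => Real.exp (K * t) := by fun_prop
      exact (this.tendsto T).mono_left nhdsWithin_le_nhds
    simpa using h1.mul h2
  have hle : (0 : ℝ) ≤ ρ (γ t₀) * Real.exp (K * t₀) := by
    refine le_of_tendsto hlim' ?_
    filter_upwards [Ioo_mem_nhdsLT ht₀.2] with t ht
    exact hanti ht₀ ⟨ht₀.1.trans ht.1, ht.2⟩ ht.1.le
  have h1 := (hK _ (hmem t₀ ht₀)).1
  have h3 := Real.exp_pos (K * t₀)
  nlinarith

/-- A trajectory on a bounded open interval of times converges within the domain at its final time: its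
speed is bounded because the gradient of the field is, and the limit is not on the boundary. -/
theorem exists_limit (h : D.IsVelocityField b) {T : ℝ} (hT : 0 < T)
    {γ : ℝ → EuclideanSpace ℝ (Fin d)}
    (hγ : ∀ t ∈ Ioo (-T) T, γ t ∈ D.cover ∧ HasDerivAt γ (b (γ t)) t) :
    ∃ p ∈ D.cover, Tendsto γ (𝓝[<] T) (𝓝 p) := by
  obtain ⟨C, hC⟩ := h.bounded_gradient
  have hb : ∀ t ∈ Ioo (-T) T, HasDerivAt (fun s => b (γ s)) (fderiv ℝ b (γ t) (b (γ t))) t :=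
    fun t ht => (h.differentiableAt (hγ t ht).1).hasFDerivAt.comp_hasDerivAt t (hγ t ht).2
  have hC0 : 0 ≤ C := (norm_nonneg _).trans (hC (γ 0) (hγ 0 ⟨by linarith, hT⟩).1)
  -- the speed grows at most exponentially
  have hspeed : ∀ t ∈ Ioo (-T) T, ‖b (γ t)‖ ≤ ‖b (γ 0)‖ * Real.exp (C * T) := by
    intro t ht
    have hlt := abs_lt.2 ht
    have := norm_le_gronwallBound_of_abs_le (T := |t|) hC0 le_rfl
      (fun s hs => hb s (abs_lt.1 ((abs_le.2 hs).trans_lt hlt)))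
      (fun s hs => by
        simp only [add_zero]
        refine (ContinuousLinearMap.le_opNorm _ _).trans ?_
        gcongr
        exact hC _ (hγ s (abs_lt.1 ((abs_le.2 hs).trans_lt hlt))).1) t (abs_le.1 le_rfl)
    rw [gronwallBound_ε0] at this
    refine this.trans ?_
    gcongr
  obtain ⟨⟨p, hp⟩, -⟩ := exists_tendsto_of_norm_deriv_le (fun t ht => (hγ t ht).2) hspeed
    (by linarith)
  refine ⟨p, ?_, hp⟩
  have hcl : p ∈ closure D.cover := by
    refine mem_closure_of_tendsto hp ?_
    filter_upwards [Ioo_mem_nhdsLT (show -T < T by linarith)] with t ht using (hγ t ht).1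
  by_contra hcon
  refine h.limit_notMem_frontier (by linarith : -T < T) hγ hp ?_
  rw [D.isOpen_cover.frontier_eq]
  exact ⟨hcl, hcon⟩

theorem exists_isTrajectory (h : D.IsVelocityField b) {x : EuclideanSpace ℝ (Fin d)}
    (hx : x ∈ D.cover) : ∃ γ, D.IsTrajectory b x γ := by
  refine exists_global_solution D.isOpen_cover h.contDiffOn_one hx fun T hT γ _ hγ => ?_
  refine ⟨h.exists_limit hT hγ, ?_⟩
  obtain ⟨p, hp, hlim⟩ := h.neg.exists_limit hT (γ := fun s => γ (-s)) fun t ht => by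
    have := hγ (-t) ⟨by linarith [ht.2], by linarith [ht.1]⟩
    exact ⟨this.1, hasDerivAt_comp_neg_of_solution this.2⟩
  refine ⟨p, hp, ?_⟩
  have := hlim.comp (tendsto_neg_nhdsGT_neg (a := T))
  simpa [Function.comp_def] using this

theorem isCompleteFlow (h : D.IsVelocityField b) : IsCompleteFlow b D.cover (D.flow b) := by
  have key : ∀ x ∈ D.cover, D.IsTrajectory b x (fun t => D.flow b t x) := by
    intro x hx
    have hex := h.exists_isTrajectory hx
    have e : (fun t => D.flow b t x) = hex.choose := by
      funext t
      rw [flow, dif_pos hex]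
    rw [e]
    exact hex.choose_spec
  exact ⟨fun x hx => (key x hx).1, fun x hx t => ((key x hx).2 t).1,
    fun x hx t => ((key x hx).2 t).2⟩

end IsVelocityField

end FlowDomain

namespace FlowDomain

variable {d : ℕ} {D : FlowDomain d} {U : Fin 2 → EuclideanSpace ℝ (Fin d) → ℝ}
  {b b' c : EuclideanSpace ℝ (Fin d) → EuclideanSpace ℝ (Fin d)} {x l : EuclideanSpace ℝ (Fin d)}

/-! ### The flow and the Jacobian of a velocity field -/

namespace IsVelocityField

theorem flow_zero (h : D.IsVelocityField b) (hx : x ∈ D.cover) : D.flow b 0 x = x :=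
  h.isCompleteFlow.zero x hx

theorem flow_mem (h : D.IsVelocityField b) (hx : x ∈ D.cover) (t : ℝ) : D.flow b t x ∈ D.cover :=
  h.isCompleteFlow.mem x hx t

theorem hasDerivAt_flow (h : D.IsVelocityField b) (hx : x ∈ D.cover) (t : ℝ) :
    HasDerivAt (fun s => D.flow b s x) (b (D.flow b t x)) t :=
  h.isCompleteFlow.hasDerivAt x hx t

theorem continuous_flow (h : D.IsVelocityField b) (hx : x ∈ D.cover) :
    Continuous fun t => D.flow b t x :=
  h.isCompleteFlow.continuous_time hx

theorem flow_add (h : D.IsVelocityField b) (hx : x ∈ D.cover) (s t : ℝ) :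
    D.flow b (s + t) x = D.flow b s (D.flow b t x) :=
  h.isCompleteFlow.add D.isOpen_cover h.contDiffOn_one hx s t

theorem flow_neg_flow (h : D.IsVelocityField b) (hx : x ∈ D.cover) (t : ℝ) :
    D.flow b (-t) (D.flow b t x) = x :=
  h.isCompleteFlow.neg_apply D.isOpen_cover h.contDiffOn_one hx t

theorem flow_flow_neg (h : D.IsVelocityField b) (hx : x ∈ D.cover) (t : ℝ) :
    D.flow b t (D.flow b (-t) x) = x :=
  h.isCompleteFlow.apply_neg D.isOpen_cover h.contDiffOn_one hx t

theorem flow_eq_of_hasDerivAt (h : D.IsVelocityField b) (hx : x ∈ D.cover) {T : ℝ}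
    {β : ℝ → EuclideanSpace ℝ (Fin d)} (h0 : β 0 = x)
    (hβ : ∀ t ∈ Icc (-T) T, HasDerivAt β (b (β t)) t) :
    ∀ t ∈ Icc (-T) T, β t = D.flow b t x :=
  h.isCompleteFlow.eq_of_hasDerivAt D.isOpen_cover h.contDiffOn_one hx h0 hβ

theorem flow_add_period (h : D.IsVelocityField b) (hl : l ∈ D.periods) (hx : x ∈ D.cover)
    (t : ℝ) : D.flow b t (x + l) = D.flow b t x + l := by
  refine (h.flow_eq_of_hasDerivAt (add_mem_cover hl hx) (T := |t|)
    (β := fun s => D.flow b s x + l) (by rw [h.flow_zero hx]) (fun s _ => ?_) t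
    (abs_le.1 le_rfl)).symm
  rw [h.periodic l hl]
  exact (h.hasDerivAt_flow hx s).add_const l

theorem divergence_add_period (h : D.IsVelocityField b) (hl : l ∈ D.periods)
    (x : EuclideanSpace ℝ (Fin d)) : divergence b (x + l) = divergence b x := by
  have e : (fun y => b (y + l)) = b := funext fun y => h.periodic l hl y
  rw [divergence, divergence, ← fderiv_comp_add_right, e]

theorem continuousOn_divergence (h : D.IsVelocityField b) :
    ContinuousOn (divergence b) D.cover :=
  IsCompleteFlow.continuousOn_divergence D.isOpen_cover h.contDiffOn_one

theorem continuous_divergence_flow (h : D.IsVelocityField b) (hx : x ∈ D.cover) :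
    Continuous fun t => divergence b (D.flow b t x) :=
  h.continuousOn_divergence.comp_continuous (h.continuous_flow hx) (h.flow_mem hx)

theorem differentiableAt_flow (h : D.IsVelocityField b) (hx : x ∈ D.cover) (t : ℝ) :
    DifferentiableAt ℝ (D.flow b t) x :=
  h.isCompleteFlow.differentiableAt D.isOpen_cover h.contDiffOn_two hx t

/-- The Jacobian of the flow by Liouville's formula. -/
theorem jacobian_eq_exp (h : D.IsVelocityField b) (hx : x ∈ D.cover) (t : ℝ) :
    D.jacobian b t x = Real.exp (∫ s in (0 : ℝ)..t, divergence b (D.flow b s x)) := by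
  rw [jacobian, h.isCompleteFlow.det_fderiv D.isOpen_cover h.contDiffOn_two hx,
    abs_of_pos (Real.exp_pos _)]

theorem jacobian_pos (h : D.IsVelocityField b) (hx : x ∈ D.cover) (t : ℝ) :
    0 < D.jacobian b t x := by
  rw [h.jacobian_eq_exp hx]; exact Real.exp_pos _

theorem jacobian_zero (h : D.IsVelocityField b) (hx : x ∈ D.cover) : D.jacobian b 0 x = 1 := by
  rw [h.jacobian_eq_exp hx]; simp

/-- The cocycle identity of the Jacobian. -/
theorem jacobian_add (h : D.IsVelocityField b) (hx : x ∈ D.cover) (s t : ℝ) :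
    D.jacobian b (s + t) x = D.jacobian b s (D.flow b t x) * D.jacobian b t x := by
  rw [h.jacobian_eq_exp hx, h.jacobian_eq_exp hx, h.jacobian_eq_exp (h.flow_mem hx t),
    ← Real.exp_add]
  congr 1
  have hc := h.continuous_divergence_flow hx
  have e : ∫ r in (0 : ℝ)..s, divergence b (D.flow b r (D.flow b t x)) =
      ∫ r in t..(s + t), divergence b (D.flow b r x) := by
    have := intervalIntegral.integral_comp_add_right (a := 0) (b := s)
      (fun r => divergence b (D.flow b r x)) t
    rw [zero_add] at this
    rw [← this]
    refine intervalIntegral.integral_congr fun r _ => ?_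
    simp only [h.flow_add hx]
  rw [e, add_comm (∫ r in t..(s + t), _), intervalIntegral.integral_add_adjacent_intervals
    (hc.intervalIntegrable _ _) (hc.intervalIntegrable _ _)]

theorem hasDerivAt_jacobian (h : D.IsVelocityField b) (hx : x ∈ D.cover) (t : ℝ) :
    HasDerivAt (fun s => D.jacobian b s x)
      (D.jacobian b t x * divergence b (D.flow b t x)) t := by
  have hc := h.continuous_divergence_flow hx
  have := (intervalIntegral.integral_hasDerivAt_right (a := 0) (b := t)
    (hc.intervalIntegrable _ _) hc.aestronglyMeasurable.stronglyMeasurableAtFilter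
    hc.continuousAt).exp
  rw [h.jacobian_eq_exp hx]
  exact this.congr_of_eventuallyEq (Eventually.of_forall fun s => h.jacobian_eq_exp hx s)

theorem continuous_jacobian (h : D.IsVelocityField b) (hx : x ∈ D.cover) :
    Continuous fun t => D.jacobian b t x :=
  continuous_iff_continuousAt.2 fun t => (h.hasDerivAt_jacobian hx t).continuousAt

theorem jacobian_add_period (h : D.IsVelocityField b) (hl : l ∈ D.periods) (hx : x ∈ D.cover)
    (t : ℝ) : D.jacobian b t (x + l) = D.jacobian b t x := by
  rw [h.jacobian_eq_exp hx, h.jacobian_eq_exp (add_mem_cover hl hx)]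
  congr 1
  refine intervalIntegral.integral_congr fun r _ => ?_
  simp only [h.flow_add_period hl hx, h.divergence_add_period hl]

theorem jacobian_neg_flow (h : D.IsVelocityField b) (hx : x ∈ D.cover) (t : ℝ) :
    D.jacobian b (-t) (D.flow b t x) * D.jacobian b t x = 1 := by
  rw [← h.jacobian_add hx, neg_add_cancel, h.jacobian_zero hx]

/-- Two velocity fields that agree off a closed set `Z` have the same flow and the same Jacobian
along a piece of a trajectory that does not meet `Z`. -/
theorem flow_eq_of_avoids (h : D.IsVelocityField b) (h' : D.IsVelocityField b')
    {Z : Set (EuclideanSpace ℝ (Fin d))} (hZ : IsClosed Z) (hbb' : ∀ y ∉ Z, b' y = b y)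
    (hx : x ∈ D.cover) {t : ℝ} (ht : ∀ s ∈ uIcc 0 t, D.flow b s x ∉ Z) :
    D.flow b' t x = D.flow b t x ∧ D.jacobian b' t x = D.jacobian b t x := by
  -- both statements hold for all intermediate times
  have key : ∀ s ∈ uIcc 0 t, D.flow b' s x = D.flow b s x := by
    have hmid : D.flow b (t / 2) x ∈ D.cover := h.flow_mem hx _
    have hmem : ∀ r ∈ Icc (-|t / 2|) |t / 2|, r + t / 2 ∈ uIcc 0 t := by
      intro r hr
      rw [mem_uIcc]
      rcases le_total 0 t with h0 | h0
      · rw [abs_of_nonneg (by linarith)] at hr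
        left; constructor <;> linarith [hr.1, hr.2]
      · rw [abs_of_nonpos (by linarith)] at hr
        right; constructor <;> linarith [hr.1, hr.2]
    have h1 := h'.flow_eq_of_hasDerivAt hmid (T := |t / 2|)
      (β := fun r => D.flow b (r + t / 2) x) (by simp) (fun r hr => by
        rw [hbb' _ (ht _ (hmem r hr))]
        exact (h.hasDerivAt_flow hx (r + t / 2)).comp_add_const r (t / 2))
    have h2 : D.flow b (t / 2) x = D.flow b' (t / 2) x := by
      have := h1 (-(t / 2)) ⟨neg_le_neg (le_abs_self _), neg_le_abs _⟩
      simp only [neg_add_cancel, h.flow_zero hx] at this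
      have h3 := h'.flow_flow_neg hmid (t / 2)
      rw [← this] at h3
      exact h3.symm
    intro s hs
    have hs' : s - t / 2 ∈ Icc (-|t / 2|) |t / 2| := by
      rw [mem_uIcc] at hs
      rcases le_total 0 t with h0 | h0
      · rw [abs_of_nonneg (by linarith)]
        rcases hs with hs | hs <;> constructor <;> linarith [hs.1, hs.2]
      · rw [abs_of_nonpos (by linarith)]
        rcases hs with hs | hs <;> constructor <;> linarith [hs.1, hs.2]
    have := h1 _ hs'
    simp only [sub_add_cancel] at this
    rw [this, h2, ← h'.flow_add hx, sub_add_cancel]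
  refine ⟨key t right_mem_uIcc, ?_⟩
  rw [h.jacobian_eq_exp hx, h'.jacobian_eq_exp hx]
  congr 1
  refine intervalIntegral.integral_congr fun s hs => ?_
  simp only [key s hs]
  have hev : b' =ᶠ[𝓝 (D.flow b s x)] b := by
    filter_upwards [hZ.isOpen_compl.mem_nhds (ht s hs)] with y hy using hbb' y hy
  rw [divergence, divergence, hev.fderiv_eq]

theorem weightedDensity_pos (h : D.IsVelocityField b) (hx : x ∈ D.cover) (k : Fin 2) (t : ℝ) :
    0 < D.weightedDensity U b k t x :=
  mul_pos (Real.exp_pos _) (h.jacobian_pos hx t)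

theorem weightedDensity_zero (h : D.IsVelocityField b) (hx : x ∈ D.cover) (k : Fin 2) :
    D.weightedDensity U b k 0 x = Real.exp (-U k x) := by
  rw [weightedDensity, h.flow_zero hx, h.jacobian_zero hx, mul_one]

theorem weightedDensity_flow (h : D.IsVelocityField b) (hx : x ∈ D.cover) (k : Fin 2) (s t : ℝ) :
    D.weightedDensity U b k (s + t) x =
      D.weightedDensity U b k s (D.flow b t x) * D.jacobian b t x := by
  rw [weightedDensity, weightedDensity, h.flow_add hx, h.jacobian_add hx, mul_assoc]

theorem weightedDensity_add_period (h : D.IsVelocityField b) {k : Fin 2}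
    (hU : D.IsPeriodic (U k)) (hl : l ∈ D.periods) (hx : x ∈ D.cover) (t : ℝ) :
    D.weightedDensity U b k t (x + l) = D.weightedDensity U b k t x := by
  rw [weightedDensity, weightedDensity, h.flow_add_period hl hx, h.jacobian_add_period hl hx,
    hU l hl]

theorem continuous_weightedDensity (h : D.IsVelocityField b) {k : Fin 2}
    (hU : ContinuousOn (U k) D.cover) (hx : x ∈ D.cover) :
    Continuous fun t => D.weightedDensity U b k t x := by
  have h1 : Continuous fun t => U k (D.flow b t x) :=
    hU.comp_continuous (h.continuous_flow hx) (h.flow_mem hx)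
  exact (Real.continuous_exp.comp h1.neg).mul (h.continuous_jacobian hx)

end IsVelocityField

/-! ### Continuous dependence on a perturbation -/

namespace IsTestField

variable {V : Set (EuclideanSpace ℝ (Fin d))}

theorem zero (D : FlowDomain d) (V : Set (EuclideanSpace ℝ (Fin d))) : D.IsTestField V 0 where
  smooth := contDiff_const
  periodic := fun _ _ _ => rfl
  support_subset := by simp [tsupport]
  compact_support := ⟨∅, isCompact_empty, by simp [tsupport]⟩

/-- The support of a test field is covered by the translates of a compact subset of itself. -/
theorem exists_isCompact (hc : D.IsTestField V c) : ∃ K, IsCompact K ∧ K ⊆ tsupport c ∧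
    ∀ x ∈ tsupport c, ∃ l ∈ D.periods, x + l ∈ K := by
  obtain ⟨K, hK, h⟩ := hc.compact_support
  refine ⟨K ∩ tsupport c, hK.inter_right (isClosed_tsupport c), inter_subset_right,
    fun x hx => ?_⟩
  obtain ⟨l, hl, hxl⟩ := h x hx
  refine ⟨l, hl, hxl, ?_⟩
  have : tsupport c = (Homeomorph.addRight l) ⁻¹' tsupport c := by
    have e : c ∘ Homeomorph.addRight l = c := funext fun y => hc.periodic l hl y
    conv_lhs => rw [← e]
    exact tsupport_comp_eq_preimage c (Homeomorph.addRight l)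
  rw [this] at hx
  exact hx

theorem tsupport_add (hc : D.IsTestField V c) (hl : l ∈ D.periods) :
    x + l ∈ tsupport c ↔ x ∈ tsupport c := by
  have : tsupport c = (Homeomorph.addRight l) ⁻¹' tsupport c := by
    have e : c ∘ Homeomorph.addRight l = c := funext fun y => hc.periodic l hl y
    conv_lhs => rw [← e]
    exact tsupport_comp_eq_preimage c (Homeomorph.addRight l)
  conv_rhs => rw [this]
  rfl

theorem fderiv_add_period (hc : D.IsTestField V c) (hl : l ∈ D.periods)
    (x : EuclideanSpace ℝ (Fin d)) : fderiv ℝ c (x + l) = fderiv ℝ c x := by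
  rw [← fderiv_comp_add_right]
  congr 1
  funext y
  rw [hc.periodic l hl]

theorem exists_norm_fderiv_le (hc : D.IsTestField V c) : ∃ C, ∀ x, ‖fderiv ℝ c x‖ ≤ C := by
  obtain ⟨K, hK, -, h⟩ := hc.exists_isCompact
  obtain ⟨C, hC⟩ := hK.exists_bound_of_continuousOn
    (hc.smooth.continuous_fderiv (by simp)).continuousOn
  refine ⟨max C 0, fun x => ?_⟩
  by_cases hx : x ∈ tsupport c
  · obtain ⟨l, hl, hxl⟩ := h x hx
    rw [← hc.fderiv_add_period hl]
    exact (hC _ hxl).trans (le_max_left _ _)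
  · have : fderiv ℝ c x = 0 := by
      by_contra hne
      exact hx (support_fderiv_subset ℝ (f := c) hne)
    rw [this, norm_zero]
    exact le_max_right _ _

theorem isVelocityField (hc : D.IsTestField V c) (hV : D.IsOpenSubset V)
    (h : D.IsVelocityField b) (ε : ℝ) : D.IsVelocityField (b + ε • c) where
  smooth := h.smooth.add (hc.smooth.contDiffOn.const_smul ε)
  periodic := fun l hl x => by simp [h.periodic l hl x, hc.periodic l hl x]
  tangent := fun p hp ρ hρ => by
    have hpc : c p = 0 := by
      by_contra hne
      have h1 : p ∈ D.cover := hV.subset (hc.support_subset (subset_tsupport c hne))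
      rw [D.isOpen_cover.frontier_eq] at hp
      exact hp.2 h1
    simp [hpc, h.tangent p hp ρ hρ]
  bounded_gradient := by
    obtain ⟨C, hC⟩ := h.bounded_gradient
    obtain ⟨C', hC'⟩ := hc.exists_norm_fderiv_le
    refine ⟨C + |ε| * C', fun x hx => ?_⟩
    have hcd : DifferentiableAt ℝ c x := (hc.smooth.differentiable (by simp)) x
    rw [fderiv_add (h.differentiableAt hx) (hcd.const_smul ε), fderiv_const_smul hcd]
    refine (norm_add_le _ _).trans (add_le_add (hC x hx) ?_)
    rw [norm_smul, Real.norm_eq_abs]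
    gcongr
    exact hC' x

theorem divergence_add_smul (hc : D.IsTestField V c) (h : D.IsVelocityField b) (ε : ℝ)
    (hx : x ∈ D.cover) : divergence (b + ε • c) x = divergence b x + ε * divergence c x := by
  have hcd : DifferentiableAt ℝ c x := (hc.smooth.differentiable (by simp)) x
  rw [divergence, divergence, divergence,
    fderiv_add (h.differentiableAt hx) (hcd.const_smul ε), fderiv_const_smul hcd]
  simp

theorem continuous_divergence (hc : D.IsTestField V c) : Continuous (divergence c) := by
  rw [← continuousOn_univ]
  exact IsCompleteFlow.continuousOn_divergence isOpen_univ
    (hc.smooth.of_le (by exact_mod_cast le_top)).contDiffOn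

/-- The flow depends continuously on the strength of the perturbation, on the time and on the
initial value: the perturbation parameter is a coordinate on which the flow is stationary. -/
theorem continuousOn_flow (hc : D.IsTestField V c) (hV : D.IsOpenSubset V)
    (h : D.IsVelocityField b) :
    ContinuousOn (fun p : ℝ × ℝ × EuclideanSpace ℝ (Fin d) =>
      D.flow (b + p.1 • c) p.2.1 p.2.2) (univ ×ˢ univ ×ˢ D.cover) := by
  set w : ℝ × EuclideanSpace ℝ (Fin d) → ℝ × EuclideanSpace ℝ (Fin d) :=
    fun q => (0, b q.2 + q.1 • c q.2)
  have hw : ContDiffOn ℝ 1 w (univ ×ˢ D.cover) := by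
    refine contDiffOn_const.prodMk (ContDiffOn.add ?_ (ContDiffOn.smul contDiffOn_fst ?_))
    · exact h.contDiffOn_one.comp contDiffOn_snd fun q hq => hq.2
    · exact ((hc.smooth.of_le (by exact_mod_cast le_top)).comp contDiff_snd).contDiffOn
  have hflow : IsCompleteFlow w (univ ×ˢ D.cover)
      (fun t q => (q.1, D.flow (b + q.1 • c) t q.2)) := by
    refine ⟨fun q hq => ?_, fun q hq t => ⟨trivial, ?_⟩, fun q hq t => ?_⟩
    · rw [(hc.isVelocityField hV h q.1).flow_zero hq.2]
    · exact (hc.isVelocityField hV h q.1).flow_mem hq.2 t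
    · exact (hasDerivAt_const t q.1).prodMk
        ((hc.isVelocityField hV h q.1).hasDerivAt_flow hq.2 t)
  have hcont := hflow.continuousOn (isOpen_univ.prod D.isOpen_cover) hw
  have h2 : ContinuousOn (fun p : ℝ × ℝ × EuclideanSpace ℝ (Fin d) => (p.2.1, (p.1, p.2.2)))
      (univ ×ˢ univ ×ˢ D.cover) := by fun_prop
  exact (hcont.comp h2 fun p hp => ⟨trivial, trivial, hp.2.2⟩).snd

theorem continuousOn_jacobian (hc : D.IsTestField V c) (hV : D.IsOpenSubset V)
    (h : D.IsVelocityField b) :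
    ContinuousOn (fun p : ℝ × ℝ × EuclideanSpace ℝ (Fin d) =>
      D.jacobian (b + p.1 • c) p.2.1 p.2.2) (univ ×ˢ univ ×ˢ D.cover) := by
  have hflow := hc.continuousOn_flow hV h
  set G : ℝ × ℝ × D.cover → ℝ → ℝ := fun p s =>
    divergence b (D.flow (b + p.1 • c) s p.2.2) +
      p.1 * divergence c (D.flow (b + p.1 • c) s p.2.2)
  have hf : Continuous fun q : (ℝ × ℝ × D.cover) × ℝ =>
      D.flow (b + q.1.1 • c) q.2 (q.1.2.2 : EuclideanSpace ℝ (Fin d)) := by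
    have h1 : Continuous fun q : (ℝ × ℝ × D.cover) × ℝ =>
      ((q.1.1, q.2, (q.1.2.2 : EuclideanSpace ℝ (Fin d))) :
        ℝ × ℝ × EuclideanSpace ℝ (Fin d)) := by fun_prop
    exact hflow.comp_continuous h1 fun q => ⟨trivial, trivial, q.1.2.2.2⟩
  have hG : Continuous (Function.uncurry G) := by
    have h1 : Continuous fun q : (ℝ × ℝ × D.cover) × ℝ => divergence b
        (D.flow (b + q.1.1 • c) q.2 (q.1.2.2 : EuclideanSpace ℝ (Fin d))) :=
      h.continuousOn_divergence.comp_continuous hf fun q =>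
        (hc.isVelocityField hV h q.1.1).flow_mem q.1.2.2.2 _
    have h2 := hc.continuous_divergence.comp hf
    exact h1.add ((continuous_fst.comp continuous_fst).mul h2)
  have hint := intervalIntegral.continuous_parametric_intervalIntegral_of_continuous
    (μ := volume) (a₀ := 0) hG (s := fun p : ℝ × ℝ × D.cover => p.2.1) (by fun_prop)
  rw [continuousOn_iff_continuous_domRestrict]
  have hmap : Continuous fun p : (univ ×ˢ univ ×ˢ D.cover : Set (ℝ × ℝ × EuclideanSpace ℝ (Fin d)))
      => ((p.1.1, p.1.2.1, ⟨p.1.2.2, p.2.2.2⟩) : ℝ × ℝ × D.cover) := by fun_prop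
  refine ((Real.continuous_exp.comp hint).comp hmap).congr fun p => ?_
  have hx : p.1.2.2 ∈ D.cover := p.2.2.2
  simp only [Function.comp_def, Set.domRestrict_apply, G]
  rw [(hc.isVelocityField hV h p.1.1).jacobian_eq_exp hx]
  congr 1
  refine intervalIntegral.integral_congr fun s _ => ?_
  exact (hc.divergence_add_smul h _ ((hc.isVelocityField hV h p.1.1).flow_mem hx s)).symm

theorem continuousOn_weightedDensity (hc : D.IsTestField V c) (hV : D.IsOpenSubset V)
    (h : D.IsVelocityField b) {k : Fin 2} (hU : ContinuousOn (U k) D.cover) :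
    ContinuousOn (fun p : ℝ × ℝ × EuclideanSpace ℝ (Fin d) =>
      D.weightedDensity U (b + p.1 • c) k p.2.1 p.2.2) (univ ×ˢ univ ×ˢ D.cover) := by
  have h1 : ContinuousOn (fun p : ℝ × ℝ × EuclideanSpace ℝ (Fin d) =>
      U k (D.flow (b + p.1 • c) p.2.1 p.2.2)) (univ ×ˢ univ ×ˢ D.cover) :=
    hU.comp (hc.continuousOn_flow hV h) fun p hp =>
      (hc.isVelocityField hV h p.1).flow_mem hp.2.2 _
  exact (Real.continuous_exp.comp_continuousOn h1.neg).mul (hc.continuousOn_jacobian hV h)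

end IsTestField

theorem isOpenSubset_cover (D : FlowDomain d) : D.IsOpenSubset D.cover :=
  ⟨D.isOpen_cover, subset_rfl, fun _ hl _ hx => add_mem_cover hl hx⟩

namespace IsVelocityField

theorem continuousOn_flow (h : D.IsVelocityField b) :
    ContinuousOn (fun p : ℝ × EuclideanSpace ℝ (Fin d) => D.flow b p.1 p.2)
      (univ ×ˢ D.cover) := by
  have h1 := (IsTestField.zero D D.cover).continuousOn_flow D.isOpenSubset_cover h
  have h2 : ContinuousOn (fun p : ℝ × EuclideanSpace ℝ (Fin d) =>
    ((0, p.1, p.2) : ℝ × ℝ × EuclideanSpace ℝ (Fin d))) (univ ×ˢ D.cover) := by fun_prop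
  simpa [Function.comp_def] using h1.comp h2 fun p hp => ⟨trivial, trivial, hp.2⟩

theorem continuousOn_jacobian (h : D.IsVelocityField b) :
    ContinuousOn (fun p : ℝ × EuclideanSpace ℝ (Fin d) => D.jacobian b p.1 p.2)
      (univ ×ˢ D.cover) := by
  have h1 := (IsTestField.zero D D.cover).continuousOn_jacobian D.isOpenSubset_cover h
  have h2 : ContinuousOn (fun p : ℝ × EuclideanSpace ℝ (Fin d) =>
    ((0, p.1, p.2) : ℝ × ℝ × EuclideanSpace ℝ (Fin d))) (univ ×ˢ D.cover) := by fun_prop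
  simpa [Function.comp_def] using h1.comp h2 fun p hp => ⟨trivial, trivial, hp.2⟩

theorem continuousOn_weightedDensity (h : D.IsVelocityField b) {k : Fin 2}
    (hU : ContinuousOn (U k) D.cover) :
    ContinuousOn (fun p : ℝ × EuclideanSpace ℝ (Fin d) => D.weightedDensity U b k p.1 p.2)
      (univ ×ˢ D.cover) := by
  have h1 := (IsTestField.zero D D.cover).continuousOn_weightedDensity D.isOpenSubset_cover h hU
  have h2 : ContinuousOn (fun p : ℝ × EuclideanSpace ℝ (Fin d) =>
    ((0, p.1, p.2) : ℝ × ℝ × EuclideanSpace ℝ (Fin d))) (univ ×ˢ D.cover) := by fun_prop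
  simpa [Function.comp_def] using h1.comp h2 fun p hp => ⟨trivial, trivial, hp.2⟩

end IsVelocityField

end FlowDomain

namespace FlowDomain

variable {d : ℕ} {D : FlowDomain d} {U : Fin 2 → EuclideanSpace ℝ (Fin d) → ℝ}
  {b b' c : EuclideanSpace ℝ (Fin d) → EuclideanSpace ℝ (Fin d)} {x l : EuclideanSpace ℝ (Fin d)}

/-! ### Half-line integrals and the regular set -/

theorem PotentialAssumptions.continuousOn (hU : D.PotentialAssumptions U) (k : Fin 2) :
    ContinuousOn (U k) D.cover :=
  (hU.smooth k).continuousOn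

/-- The four half-line integrals at `x` converge. -/
def IsIntegrableAt (D : FlowDomain d) (U : Fin 2 → EuclideanSpace ℝ (Fin d) → ℝ)
    (b : EuclideanSpace ℝ (Fin d) → EuclideanSpace ℝ (Fin d)) (x : EuclideanSpace ℝ (Fin d)) :
    Prop :=
  ∀ k, Integrable (fun t => D.weightedDensity U b k t x)

theorem integrable_of_Ioi_of_Iio {f : ℝ → ℝ} (h1 : IntegrableOn f (Ioi 0))
    (h2 : IntegrableOn f (Iio 0)) : Integrable f := by
  rw [← integrableOn_univ, ← Iic_union_Ioi (a := (0 : ℝ)), integrableOn_union,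
    integrableOn_Iic_iff_integrableOn_Iio]
  exact ⟨h2, h1⟩

theorem integral_Iio_add_Ioi {f : ℝ → ℝ} (h : Integrable f) (a : ℝ) :
    (∫ t in Iio a, f t) + ∫ t in Ioi a, f t = ∫ t, f t := by
  rw [← integral_Iic_eq_integral_Iio]
  exact intervalIntegral.integral_Iic_add_Ioi h.integrableOn h.integrableOn

theorem IsIntegrableAt.totalIntegral_eq (h : D.IsIntegrableAt U b x) (k : Fin 2) :
    D.totalIntegral U b k x = D.forwardIntegral U b k x + D.backwardIntegral U b k x := by
  rw [totalIntegral, forwardIntegral, backwardIntegral, add_comm, integral_Iio_add_Ioi (h k)]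

theorem mem_regularSet_of_isOpen {W : Set (EuclideanSpace ℝ (Fin d))} (hW : IsOpen W)
    (hWD : W ⊆ D.cover) (hint : ∀ z ∈ W, D.IsIntegrableAt U b z)
    (hf : ∀ k, ContinuousOn (D.forwardIntegral U b k) W)
    (hg : ∀ k, ContinuousOn (D.backwardIntegral U b k) W) : W ⊆ D.regularSet U b :=
  fun _ hx => ⟨W, hW.mem_nhds hx, hWD, fun k => ⟨fun z hz =>
    ⟨(hint z hz k).integrableOn, (hint z hz k).integrableOn⟩, hf k, hg k⟩⟩

theorem isOpen_regularSet : IsOpen (D.regularSet U b) := by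
  rw [isOpen_iff_mem_nhds]
  rintro x ⟨W, hW, hWD, h⟩
  filter_upwards [eventually_mem_nhds_iff.2 hW] with y hy using ⟨W, hy, hWD, h⟩

theorem regularSet_subset : D.regularSet U b ⊆ D.cover := by
  rintro x ⟨W, hW, hWD, -⟩
  exact hWD (mem_of_mem_nhds hW)

theorem isIntegrableAt_of_mem_regularSet (hx : x ∈ D.regularSet U b) :
    D.IsIntegrableAt U b x := by
  obtain ⟨W, hW, -, h⟩ := hx
  intro k
  have := (h k).1 x (mem_of_mem_nhds hW)
  exact integrable_of_Ioi_of_Iio this.1 this.2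

theorem continuousOn_forwardIntegral (k : Fin 2) :
    ContinuousOn (D.forwardIntegral U b k) (D.regularSet U b) := by
  rintro x ⟨W, hW, -, h⟩
  exact ((h k).2.1.continuousAt hW).continuousWithinAt

theorem continuousOn_backwardIntegral (k : Fin 2) :
    ContinuousOn (D.backwardIntegral U b k) (D.regularSet U b) := by
  rintro x ⟨W, hW, -, h⟩
  exact ((h k).2.2.continuousAt hW).continuousWithinAt

theorem continuousOn_totalIntegral (k : Fin 2) :
    ContinuousOn (D.totalIntegral U b k) (D.regularSet U b) :=
  ((continuousOn_forwardIntegral k).add (continuousOn_backwardIntegral k)).congr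
    fun _ hx => (isIntegrableAt_of_mem_regularSet hx).totalIntegral_eq k

namespace IsVelocityField

theorem integral_flow (h : D.IsVelocityField b) (hx : x ∈ D.cover) (k : Fin 2) (s : ℝ) :
    D.totalIntegral U b k (D.flow b s x) * D.jacobian b s x = D.totalIntegral U b k x := by
  rw [totalIntegral, ← integral_mul_const]
  simp only [← h.weightedDensity_flow hx]
  exact integral_add_right_eq_self (fun t => D.weightedDensity U b k t x) s

/-- The estimator is constant along trajectories. -/
theorem estimator_flow (h : D.IsVelocityField b) (hx : x ∈ D.cover) (s : ℝ) :
    D.estimator U b (D.flow b s x) = D.estimator U b x := by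
  have hJ := (h.jacobian_pos hx s).ne'
  rw [estimator, estimator, ← h.integral_flow hx 1 s, ← h.integral_flow hx 0 s,
    mul_div_mul_right _ _ hJ]

theorem isIntegrableAt_flow (h : D.IsVelocityField b) (hx : x ∈ D.cover)
    (hint : D.IsIntegrableAt U b x) (s : ℝ) : D.IsIntegrableAt U b (D.flow b s x) := by
  intro k
  have hJ := (h.jacobian_pos hx s).ne'
  have h1 : Integrable fun t => D.weightedDensity U b k (t + s) x :=
    (hint k).comp_add_right s
  refine (h1.mul_const (D.jacobian b s x)⁻¹).congr (Eventually.of_forall fun t => ?_)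
  simp only [h.weightedDensity_flow hx]
  field_simp

/-- The forward integral at `X_s(x)`, times `J_s(x)`, is the integral of `F_t(x)` over the times after `s`. -/
theorem forwardIntegral_flow_mul (h : D.IsVelocityField b) (hx : x ∈ D.cover) (k : Fin 2)
    (s : ℝ) : D.forwardIntegral U b k (D.flow b s x) * D.jacobian b s x =
      ∫ t in Ioi s, D.weightedDensity U b k t x := by
  rw [forwardIntegral, ← integral_mul_const]
  simp only [← h.weightedDensity_flow hx]
  have hm : MeasurePreserving (fun t : ℝ => t + s) volume volume :=
    measurePreserving_add_right volume s
  have := hm.setIntegral_preimage_emb (measurableEmbedding_addRight s)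
    (fun t => D.weightedDensity U b k t x) (Ioi s)
  rw [← this]
  congr 2
  ext t
  simp

theorem backwardIntegral_flow_mul (h : D.IsVelocityField b) (hx : x ∈ D.cover) (k : Fin 2)
    (s : ℝ) : D.backwardIntegral U b k (D.flow b s x) * D.jacobian b s x =
      ∫ t in Iio s, D.weightedDensity U b k t x := by
  rw [backwardIntegral, ← integral_mul_const]
  simp only [← h.weightedDensity_flow hx]
  have hm : MeasurePreserving (fun t : ℝ => t + s) volume volume :=
    measurePreserving_add_right volume s
  have := hm.setIntegral_preimage_emb (measurableEmbedding_addRight s)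
    (fun t => D.weightedDensity U b k t x) (Iio s)
  rw [← this]
  congr 2
  ext t
  simp

theorem forwardIntegral_flow_mul' (h : D.IsVelocityField b) (hx : x ∈ D.cover) {k : Fin 2}
    (hint : Integrable fun t => D.weightedDensity U b k t x) (s : ℝ) :
    D.forwardIntegral U b k (D.flow b s x) * D.jacobian b s x =
      D.forwardIntegral U b k x - ∫ t in (0 : ℝ)..s, D.weightedDensity U b k t x := by
  rw [h.forwardIntegral_flow_mul hx, forwardIntegral,
    ← intervalIntegral.integral_Ioi_sub_Ioi' hint.integrableOn hint.integrableOn]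
  ring

theorem backwardIntegral_flow_mul' (h : D.IsVelocityField b) (hx : x ∈ D.cover) {k : Fin 2}
    (hint : Integrable fun t => D.weightedDensity U b k t x) (s : ℝ) :
    D.backwardIntegral U b k (D.flow b s x) * D.jacobian b s x =
      D.backwardIntegral U b k x + ∫ t in (0 : ℝ)..s, D.weightedDensity U b k t x := by
  rw [h.backwardIntegral_flow_mul hx, backwardIntegral, ← integral_Iic_eq_integral_Iio,
    ← integral_Iic_eq_integral_Iio,
    ← intervalIntegral.integral_Iic_sub_Iic hint.integrableOn hint.integrableOn]
  ring

theorem forwardIntegral_pos (h : D.IsVelocityField b) (hx : x ∈ D.cover)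
    (hint : D.IsIntegrableAt U b x) (k : Fin 2) : 0 < D.forwardIntegral U b k x := by
  rw [forwardIntegral, setIntegral_pos_iff_support_of_nonneg_ae
    (Eventually.of_forall fun t => (h.weightedDensity_pos hx k t).le) (hint k).integrableOn]
  have : Function.support (fun t => D.weightedDensity U b k t x) = univ :=
    Set.eq_univ_of_forall fun t => (h.weightedDensity_pos hx k t).ne'
  simp [this]

theorem backwardIntegral_pos (h : D.IsVelocityField b) (hx : x ∈ D.cover)
    (hint : D.IsIntegrableAt U b x) (k : Fin 2) : 0 < D.backwardIntegral U b k x := by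
  rw [backwardIntegral, setIntegral_pos_iff_support_of_nonneg_ae
    (Eventually.of_forall fun t => (h.weightedDensity_pos hx k t).le) (hint k).integrableOn]
  have : Function.support (fun t => D.weightedDensity U b k t x) = univ :=
    Set.eq_univ_of_forall fun t => (h.weightedDensity_pos hx k t).ne'
  simp [this]

theorem totalIntegral_pos (h : D.IsVelocityField b) (hx : x ∈ D.cover)
    (hint : D.IsIntegrableAt U b x) (k : Fin 2) : 0 < D.totalIntegral U b k x := by
  rw [hint.totalIntegral_eq]
  exact add_pos (h.forwardIntegral_pos hx hint k) (h.backwardIntegral_pos hx hint k)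

theorem totalIntegral_nonneg (h : D.IsVelocityField b) (hx : x ∈ D.cover) (k : Fin 2) :
    0 ≤ D.totalIntegral U b k x :=
  integral_nonneg fun t => (h.weightedDensity_pos hx k t).le

theorem estimator_nonneg (h : D.IsVelocityField b) (hx : x ∈ D.cover) :
    0 ≤ D.estimator U b x :=
  div_nonneg (h.totalIntegral_nonneg hx 1) (h.totalIntegral_nonneg hx 0)

theorem continuousOn_estimator (h : D.IsVelocityField b) :
    ContinuousOn (D.estimator U b) (D.regularSet U b) :=
  (continuousOn_totalIntegral 1).div (continuousOn_totalIntegral 0) fun _ hx =>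
    (h.totalIntegral_pos (regularSet_subset hx) (isIntegrableAt_of_mem_regularSet hx) 0).ne'

variable (hUp : ∀ k, D.IsPeriodic (U k))
include hUp

theorem forwardIntegral_add_period (h : D.IsVelocityField b) (hl : l ∈ D.periods)
    (hx : x ∈ D.cover) (k : Fin 2) :
    D.forwardIntegral U b k (x + l) = D.forwardIntegral U b k x := by
  simp only [forwardIntegral, h.weightedDensity_add_period (hUp k) hl hx]

theorem backwardIntegral_add_period (h : D.IsVelocityField b) (hl : l ∈ D.periods)
    (hx : x ∈ D.cover) (k : Fin 2) :
    D.backwardIntegral U b k (x + l) = D.backwardIntegral U b k x := by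
  simp only [backwardIntegral, h.weightedDensity_add_period (hUp k) hl hx]

theorem totalIntegral_add_period (h : D.IsVelocityField b) (hl : l ∈ D.periods)
    (hx : x ∈ D.cover) (k : Fin 2) :
    D.totalIntegral U b k (x + l) = D.totalIntegral U b k x := by
  simp only [totalIntegral, h.weightedDensity_add_period (hUp k) hl hx]

theorem estimator_add_period (h : D.IsVelocityField b) (hl : l ∈ D.periods)
    (hx : x ∈ D.cover) : D.estimator U b (x + l) = D.estimator U b x := by
  simp only [estimator, h.totalIntegral_add_period hUp hl hx]

end IsVelocityField

theorem IsVelocityField.continuousOn_intervalIntegral (h : D.IsVelocityField b) {k : Fin 2}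
    (hU : ContinuousOn (U k) D.cover) (s : ℝ) :
    ContinuousOn (fun x => ∫ t in (0 : ℝ)..s, D.weightedDensity U b k t x) D.cover := by
  rw [continuousOn_iff_continuous_domRestrict]
  have hcont : Continuous (Function.uncurry fun (x : D.cover) (t : ℝ) =>
      D.weightedDensity U b k t x) :=
    (h.continuousOn_weightedDensity hU).comp_continuous
      (f := fun p : D.cover × ℝ => (p.2, (p.1 : EuclideanSpace ℝ (Fin d)))) (by fun_prop)
      fun p => ⟨trivial, p.1.2⟩
  exact intervalIntegral.continuous_parametric_intervalIntegral_of_continuous' hcont 0 s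

theorem IsVelocityField.continuousOn_flow_time (h : D.IsVelocityField b) (s : ℝ) :
    ContinuousOn (D.flow b s) D.cover :=
  h.continuousOn_flow.comp (f := fun x => (s, x)) (by fun_prop) fun _ hx => ⟨trivial, hx⟩

theorem IsVelocityField.continuousOn_jacobian_time (h : D.IsVelocityField b) (s : ℝ) :
    ContinuousOn (D.jacobian b s) D.cover :=
  h.continuousOn_jacobian.comp (f := fun x => (s, x)) (by fun_prop) fun _ hx => ⟨trivial, hx⟩

/-- The regular set is invariant under the flow. -/
theorem IsVelocityField.flow_mem_regularSet (h : D.IsVelocityField b)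
    (hU : ∀ k, ContinuousOn (U k) D.cover) (hx : x ∈ D.regularSet U b) (s : ℝ) :
    D.flow b s x ∈ D.regularSet U b := by
  have hxD := regularSet_subset hx
  set W := D.cover ∩ D.flow b (-s) ⁻¹' D.regularSet U b
  have hW : IsOpen W := (h.continuousOn_flow_time (-s)).isOpen_inter_preimage D.isOpen_cover
    isOpen_regularSet
  have hback : ∀ z ∈ W, D.flow b s (D.flow b (-s) z) = z := fun z hz => h.flow_flow_neg hz.1 s
  have hmaps : MapsTo (D.flow b (-s)) W (D.regularSet U b) := fun z hz => hz.2
  have hcont : ContinuousOn (D.flow b (-s)) W :=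
    (h.continuousOn_flow_time (-s)).mono inter_subset_left
  have hJ : ∀ z ∈ W, D.jacobian b s (D.flow b (-s) z) ≠ 0 := fun z hz =>
    (h.jacobian_pos (h.flow_mem hz.1 _) s).ne'
  have hJc : ContinuousOn (fun z => D.jacobian b s (D.flow b (-s) z)) W :=
    (h.continuousOn_jacobian_time s).comp hcont fun z hz => h.flow_mem hz.1 _
  have hIc : ∀ k, ContinuousOn (fun z => ∫ t in (0 : ℝ)..s,
      D.weightedDensity U b k t (D.flow b (-s) z)) W := fun k =>
    (h.continuousOn_intervalIntegral (hU k) s).comp hcont fun z hz => h.flow_mem hz.1 _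
  refine mem_regularSet_of_isOpen hW inter_subset_left (fun z hz => ?_) (fun k => ?_) (fun k => ?_)
    (show D.flow b s x ∈ W from ⟨h.flow_mem hxD s, ?_⟩)
  · rw [← hback z hz]
    exact h.isIntegrableAt_flow (h.flow_mem hz.1 _) (isIntegrableAt_of_mem_regularSet hz.2) s
  · refine ((((continuousOn_forwardIntegral k).comp hcont hmaps).sub (hIc k)).div hJc hJ).congr
      fun z hz => ?_
    simp only [Pi.div_apply, Pi.sub_apply, Function.comp_apply]
    rw [eq_div_iff (hJ z hz)]
    have := h.forwardIntegral_flow_mul' (h.flow_mem hz.1 (-s))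
      (isIntegrableAt_of_mem_regularSet hz.2 k) s
    rwa [hback z hz] at this
  · refine ((((continuousOn_backwardIntegral k).comp hcont hmaps).add (hIc k)).div hJc hJ).congr
      fun z hz => ?_
    simp only [Pi.div_apply, Pi.add_apply, Function.comp_apply]
    rw [eq_div_iff (hJ z hz)]
    have := h.backwardIntegral_flow_mul' (h.flow_mem hz.1 (-s))
      (isIntegrableAt_of_mem_regularSet hz.2 k) s
    rwa [hback z hz] at this
  · change D.flow b (-s) (D.flow b s x) ∈ D.regularSet U b
    rwa [h.flow_neg_flow hxD]

end FlowDomain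

namespace FlowDomain

variable {d : ℕ} {D : FlowDomain d} {U : Fin 2 → EuclideanSpace ℝ (Fin d) → ℝ}
  {b b' c : EuclideanSpace ℝ (Fin d) → EuclideanSpace ℝ (Fin d)} {x l : EuclideanSpace ℝ (Fin d)}

/-! ### Cells and mass transport along the flow -/

theorem isPeriodic_of_forall_cover {α : Type*} {f : EuclideanSpace ℝ (Fin d) → α}
    (h : ∀ l ∈ D.periods, ∀ x ∈ D.cover, f (x + l) = f x) : D.IsPeriodic f := by
  cases D with
  | euclidean Ω _ _ _ =>
    intro l hl x
    have : l = 0 := by simpa [periods] using hl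
    simp [this]
  | torus v => exact fun l hl x => h l hl x trivial

/-- A measurable set of representatives of the domain modulo the periods. -/
structure IsCell (D : FlowDomain d) (S : Set (EuclideanSpace ℝ (Fin d))) : Prop where
  measurableSet : MeasurableSet S
  subset : S ⊆ D.cover
  exists_mem : ∀ x ∈ D.cover, ∃ l ∈ D.periods, x + l ∈ S
  unique : ∀ x, ∀ l ∈ D.periods, x ∈ S → x + l ∈ S → l = 0

theorem isCell_cell (D : FlowDomain d) : D.IsCell D.cell := by
  cases D with
  | euclidean Ω hΩ _ _ =>
    exact ⟨hΩ.measurableSet, subset_rfl, fun x hx => ⟨0, zero_mem _, by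
      rw [add_zero]; exact hx⟩,
      fun x l hl _ _ => by simpa [periods] using hl⟩
  | torus v =>
    refine ⟨ZSpan.fundamentalDomain_measurableSet v, subset_univ _, fun x _ => ?_,
      fun x l hl hx hxl => ?_⟩
    · obtain ⟨l, hl, -⟩ := ZSpan.exist_unique_vadd_mem_fundamentalDomain v x
      exact ⟨l, l.2, by rw [add_comm]; exact hl⟩
    · have := (ZSpan.exist_unique_vadd_mem_fundamentalDomain v x).unique
        (y₁ := ⟨l, hl⟩) (y₂ := 0) (by rw [add_comm] at hxl; exact hxl)
        (by rw [zero_vadd]; exact hx)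
      exact congrArg Subtype.val this

theorem cell_subset_cover (D : FlowDomain d) : D.cell ⊆ D.cover := D.isCell_cell.subset

theorem measurableSet_cell (D : FlowDomain d) : MeasurableSet D.cell := D.isCell_cell.measurableSet

/-- Integrals of periodic functions over two sets of representatives agree: the first two
conclusions are the cases of Lebesgue and of Bochner integrals. -/
theorem IsCell.integral_eq {S S' : Set (EuclideanSpace ℝ (Fin d))} (hS : D.IsCell S)
    (hS' : D.IsCell S') :
    (∀ f : EuclideanSpace ℝ (Fin d) → ℝ≥0∞, D.IsPeriodic f →
      ∫⁻ x in S, f x = ∫⁻ x in S', f x) ∧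
    (∀ f : EuclideanSpace ℝ (Fin d) → ℝ, D.IsPeriodic f → ∫ x in S, f x = ∫ x in S', f x) ∧
    ∀ f : EuclideanSpace ℝ (Fin d) → ℝ, D.IsPeriodic f →
      (IntegrableOn f S ↔ IntegrableOn f S') := by
  cases D with
  | euclidean Ω hΩ _ _ =>
    have key : ∀ T, (FlowDomain.euclidean Ω hΩ ‹_› ‹_›).IsCell T → T = Ω := by
      intro T hT
      refine subset_antisymm hT.subset fun x hx => ?_
      obtain ⟨l, hl, hxl⟩ := hT.exists_mem x hx
      have : l = 0 := by simpa [periods] using hl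
      simpa [this] using hxl
    rw [key S hS, key S' hS']
    exact ⟨fun _ _ => rfl, fun _ _ => rfl, fun _ _ => Iff.rfl⟩
  | torus v =>
    have : Countable (Submodule.span ℤ (range v)).toAddSubgroup :=
      inferInstanceAs (Countable (Submodule.span ℤ (range v)))
    have key : ∀ T, (FlowDomain.torus v).IsCell T →
        IsAddFundamentalDomain (Submodule.span ℤ (range v)).toAddSubgroup T := by
      intro T hT
      refine IsAddFundamentalDomain.mk' hT.measurableSet.nullMeasurableSet fun x => ?_
      obtain ⟨l, hl, hxl⟩ := hT.exists_mem x trivial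
      refine ⟨⟨l, hl⟩, by rw [add_comm] at hxl; exact hxl, fun m hm => ?_⟩
      have hm' : x + (m : EuclideanSpace ℝ (Fin d)) ∈ T := by rw [add_comm]; exact hm
      have := hT.unique (x + l) (m - l) (sub_mem m.2 hl) hxl (by
        rwa [add_assoc, add_sub_cancel])
      exact Subtype.ext (sub_eq_zero.1 this)
    have hper : ∀ {α : Type} {f : EuclideanSpace ℝ (Fin d) → α},
        (FlowDomain.torus v).IsPeriodic f →
        ∀ (g : (Submodule.span ℤ (range v)).toAddSubgroup) (x), f (g +ᵥ x) = f x := by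
      intro α f hf g x
      have := hf g g.2 x
      rw [add_comm] at this
      exact this
    exact ⟨fun f hf => (key S hS).setLIntegral_eq (key S' hS') f (hper hf),
      fun f hf => (key S hS).setIntegral_eq (key S' hS') (hper hf),
      fun f hf => (key S hS).integrableOn_iff (key S' hS') (hper hf)⟩

namespace IsVelocityField

theorem injOn_flow (h : D.IsVelocityField b) (t : ℝ) : InjOn (D.flow b t) D.cover := by
  intro x hx y hy hxy
  rw [← h.flow_neg_flow hx t, ← h.flow_neg_flow hy t, hxy]

theorem hasFDerivWithinAt_flow (h : D.IsVelocityField b) (t : ℝ)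
    {S : Set (EuclideanSpace ℝ (Fin d))} (hS : S ⊆ D.cover) :
    ∀ x ∈ S, HasFDerivWithinAt (D.flow b t) (fderiv ℝ (D.flow b t) x) S x :=
  fun _ hx => (h.differentiableAt_flow (hS hx) t).hasFDerivAt.hasFDerivWithinAt

/-- The flow maps sets of representatives to sets of representatives. -/
theorem isCell_image_flow (h : D.IsVelocityField b) (t : ℝ) :
    D.IsCell (D.flow b t '' D.cell) where
  measurableSet := measurable_image_of_fderivWithin D.measurableSet_cell
    (h.hasFDerivWithinAt_flow t D.cell_subset_cover) ((h.injOn_flow t).mono D.cell_subset_cover)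
  subset := by
    rintro _ ⟨x, hx, rfl⟩
    exact h.flow_mem (D.cell_subset_cover hx) t
  exists_mem := fun x hx => by
    obtain ⟨l, hl, hxl⟩ := D.isCell_cell.exists_mem _ (h.flow_mem hx (-t))
    refine ⟨l, hl, _, hxl, ?_⟩
    rw [h.flow_add_period hl (h.flow_mem hx _), h.flow_flow_neg hx]
  unique := by
    rintro _ l hl ⟨y, hy, rfl⟩ ⟨z, hz, hyz⟩
    have hyD := D.cell_subset_cover hy
    rw [← h.flow_add_period hl hyD] at hyz
    have : z = y + l := h.injOn_flow t (D.cell_subset_cover hz) (add_mem_cover hl hyD) hyz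
    exact D.isCell_cell.unique y l hl hy (this ▸ hz)

theorem lintegral_flow (h : D.IsVelocityField b) (t : ℝ)
    {g : EuclideanSpace ℝ (Fin d) → ℝ≥0∞} (hg : D.IsPeriodic g) :
    ∫⁻ x in D.cell, ENNReal.ofReal (D.jacobian b t x) * g (D.flow b t x) =
      ∫⁻ x in D.cell, g x := by
  rw [← ((h.isCell_image_flow t).integral_eq D.isCell_cell).1 g hg]
  exact (lintegral_image_eq_lintegral_abs_det_fderiv_mul volume D.measurableSet_cell
    (h.hasFDerivWithinAt_flow t D.cell_subset_cover)
    ((h.injOn_flow t).mono D.cell_subset_cover) g).symm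

/-- Change of variables: the flow map takes a cell to a cell, and integrals of periodic functions do not
depend on the cell. -/
theorem setIntegral_flow (h : D.IsVelocityField b) (t : ℝ)
    {g : EuclideanSpace ℝ (Fin d) → ℝ} (hg : D.IsPeriodic g) :
    ∫ x in D.cell, D.jacobian b t x * g (D.flow b t x) = ∫ x in D.cell, g x := by
  rw [← ((h.isCell_image_flow t).integral_eq D.isCell_cell).2.1 g hg]
  exact (integral_image_eq_integral_abs_det_fderiv_smul volume D.measurableSet_cell
    (h.hasFDerivWithinAt_flow t D.cell_subset_cover)
    ((h.injOn_flow t).mono D.cell_subset_cover) g).symm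

end IsVelocityField

/-- Measurability on the domain, for functions whose values elsewhere are irrelevant. -/
def MeasurableOnCover {α : Type*} [MeasurableSpace α] (D : FlowDomain d)
    (f : EuclideanSpace ℝ (Fin d) → α) : Prop :=
  Measurable fun x : D.cover => f x

theorem measurableOnCover_of_continuousOn {α : Type*} [MeasurableSpace α] [TopologicalSpace α]
    [BorelSpace α] {f : EuclideanSpace ℝ (Fin d) → α} (hf : ContinuousOn f D.cover) :
    D.MeasurableOnCover f := by
  rw [continuousOn_iff_continuous_domRestrict] at hf
  exact hf.measurable

theorem MeasurableOnCover.aemeasurable {α : Type*} [MeasurableSpace α]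
    {f : EuclideanSpace ℝ (Fin d) → α} (hf : D.MeasurableOnCover f) :
    AEMeasurable f (volume.restrict D.cell) :=
  (aemeasurable_restrict_of_measurable_subtype D.isOpen_cover.measurableSet hf).mono_measure
    (Measure.restrict_mono D.cell_subset_cover le_rfl)

theorem aemeasurable_prod_of_measurable_cover {α : Type*} [MeasurableSpace α]
    {f : EuclideanSpace ℝ (Fin d) × ℝ → α}
    (hf : Measurable fun p : D.cover × ℝ => f (p.1, p.2)) (I : Set ℝ) :
    AEMeasurable f ((volume.restrict D.cell).prod (volume.restrict I)) := by
  have hm : MeasurableSet (D.cover ×ˢ (univ : Set ℝ)) :=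
    D.isOpen_cover.measurableSet.prod MeasurableSet.univ
  have h1 : AEMeasurable f
      (((volume : Measure (EuclideanSpace ℝ (Fin d))).prod (volume.restrict I)).restrict
        (D.cover ×ˢ univ)) := by
    refine aemeasurable_restrict_of_measurable_subtype hm ?_
    have h2 : Measurable fun q : (D.cover ×ˢ (univ : Set ℝ) :
        Set (EuclideanSpace ℝ (Fin d) × ℝ)) => ((⟨q.1.1, q.2.1⟩, q.1.2) : D.cover × ℝ) :=
      (Measurable.subtype_mk (measurable_fst.comp measurable_subtype_coe)).prodMk
        (measurable_snd.comp measurable_subtype_coe)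
    exact hf.comp h2
  rw [← Measure.prod_restrict, Measure.restrict_univ] at h1
  exact h1.mono_measure (Measure.prod_mono (Measure.restrict_mono D.cell_subset_cover le_rfl) le_rfl)

namespace IsVelocityField

theorem measurable_comp_flow {α : Type*} [MeasurableSpace α] (h : D.IsVelocityField b)
    {q : EuclideanSpace ℝ (Fin d) → α} (hq : D.MeasurableOnCover q) :
    Measurable fun p : D.cover × ℝ => q (D.flow b p.2 p.1) := by
  have h1 : Continuous fun p : D.cover × ℝ => D.flow b p.2 p.1 :=
    h.continuousOn_flow.comp_continuous
      (f := fun p : D.cover × ℝ => (p.2, (p.1 : EuclideanSpace ℝ (Fin d)))) (by fun_prop)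
      fun p => ⟨trivial, p.1.2⟩
  have h2 : Measurable fun p : D.cover × ℝ =>
      (⟨D.flow b p.2 p.1, h.flow_mem p.1.2 p.2⟩ : D.cover) := h1.measurable.subtype_mk
  exact Measurable.comp (g := fun x : D.cover => q x) hq h2

theorem measurable_jacobian (h : D.IsVelocityField b) :
    Measurable fun p : D.cover × ℝ => D.jacobian b p.2 p.1 :=
  (h.continuousOn_jacobian.comp_continuous
      (f := fun p : D.cover × ℝ => (p.2, (p.1 : EuclideanSpace ℝ (Fin d)))) (by fun_prop)
      fun p => ⟨trivial, p.1.2⟩).measurable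

/-- Mass transport along the flow: what the points `x` send along their trajectories equals what
the points `y` receive. -/
theorem lintegral_transport (h : D.IsVelocityField b) {p q : EuclideanSpace ℝ (Fin d) → ℝ≥0∞}
    (hp : D.IsPeriodic p) (hq : D.IsPeriodic q) (hpm : D.MeasurableOnCover p)
    (hqm : D.MeasurableOnCover q) (I : Set ℝ) :
    ∫⁻ x in D.cell, p x * ∫⁻ s in I, q (D.flow b s x) =
      ∫⁻ y in D.cell, q y *
        ∫⁻ s in I, p (D.flow b (-s) y) * ENNReal.ofReal (D.jacobian b (-s) y) := by
  have m1 := h.measurable_comp_flow hqm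
  have m2 : Measurable fun r : D.cover × ℝ =>
      p (D.flow b (-r.2) r.1) * ENNReal.ofReal (D.jacobian b (-r.2) r.1) := by
    have hneg : Measurable fun r : D.cover × ℝ => (r.1, -r.2) := by fun_prop
    exact ((h.measurable_comp_flow hpm).comp hneg).mul
      (ENNReal.measurable_ofReal.comp (h.measurable_jacobian.comp hneg))
  have hp1 : Measurable fun r : D.cover × ℝ => p r.1 :=
    Measurable.comp (g := fun x : D.cover => p x) hpm measurable_fst
  have hq1 : Measurable fun r : D.cover × ℝ => q r.1 :=
    Measurable.comp (g := fun x : D.cover => q x) hqm measurable_fst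
  have e1 : ∫⁻ x in D.cell, p x * ∫⁻ s in I, q (D.flow b s x) =
      ∫⁻ x in D.cell, ∫⁻ s in I, p x * q (D.flow b s x) := by
    refine setLIntegral_congr_fun D.measurableSet_cell fun x hx => ?_
    have : Measurable fun s => q (D.flow b s x) :=
      m1.comp (measurable_const.prodMk measurable_id :
        Measurable fun s : ℝ => ((⟨x, D.cell_subset_cover hx⟩, s) : D.cover × ℝ))
    exact (lintegral_const_mul _ this).symm
  have e2 : ∫⁻ y in D.cell, q y *
        ∫⁻ s in I, p (D.flow b (-s) y) * ENNReal.ofReal (D.jacobian b (-s) y) =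
      ∫⁻ y in D.cell, ∫⁻ s in I, q y *
        (p (D.flow b (-s) y) * ENNReal.ofReal (D.jacobian b (-s) y)) := by
    refine setLIntegral_congr_fun D.measurableSet_cell fun x hx => ?_
    have := m2.comp (measurable_const.prodMk measurable_id :
        Measurable fun s : ℝ => ((⟨x, D.cell_subset_cover hx⟩, s) : D.cover × ℝ))
    exact (lintegral_const_mul _ this).symm
  rw [e1, e2, lintegral_lintegral_swap (f := fun x s => p x * q (D.flow b s x)),
    lintegral_lintegral_swap (f := fun y s => q y *
      (p (D.flow b (-s) y) * ENNReal.ofReal (D.jacobian b (-s) y)))]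
  · refine lintegral_congr fun s => ?_
    have hper : D.IsPeriodic fun x => p x * q (D.flow b s x) :=
      isPeriodic_of_forall_cover fun l hl x hx => by
        rw [hp l hl, h.flow_add_period hl hx, hq l hl]
    rw [← h.lintegral_flow (-s) hper]
    refine setLIntegral_congr_fun D.measurableSet_cell fun y hy => ?_
    simp only [h.flow_flow_neg (D.cell_subset_cover hy)]
    ring
  · exact aemeasurable_prod_of_measurable_cover (f := fun r => q r.1 *
      (p (D.flow b (-r.2) r.1) * ENNReal.ofReal (D.jacobian b (-r.2) r.1))) (hq1.mul m2) I
  · exact aemeasurable_prod_of_measurable_cover (f := fun r => p r.1 * q (D.flow b r.2 r.1))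
      (hp1.mul m1) I

/-- Mass transport along the flow for signed functions. -/
theorem integral_transport (h : D.IsVelocityField b) {p q : EuclideanSpace ℝ (Fin d) → ℝ}
    (hp : D.IsPeriodic p) (hq : D.IsPeriodic q) (hpm : D.MeasurableOnCover p)
    (hqm : D.MeasurableOnCover q)
    (hfin : ∫⁻ x in D.cell, ‖p x‖ₑ * ∫⁻ s in Iio (0 : ℝ), ‖q (D.flow b s x)‖ₑ ≠ ⊤) :
    ∫ x in D.cell, p x * ∫ s in Iio (0 : ℝ), q (D.flow b s x) =
      ∫ y in D.cell, q y * ∫ s in Ioi (0 : ℝ), p (D.flow b s y) * D.jacobian b s y := by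
  have hneg : Measurable fun r : D.cover × ℝ => (r.1, -r.2) := by fun_prop
  have m1 := h.measurable_comp_flow hqm
  have m2 : Measurable fun r : D.cover × ℝ =>
      p (D.flow b (-r.2) r.1) * D.jacobian b (-r.2) r.1 :=
    ((h.measurable_comp_flow hpm).comp hneg).mul (h.measurable_jacobian.comp hneg)
  have hp1 : Measurable fun r : D.cover × ℝ => p r.1 :=
    Measurable.comp (g := fun x : D.cover => p x) hpm measurable_fst
  have hq1 : Measurable fun r : D.cover × ℝ => q r.1 :=
    Measurable.comp (g := fun x : D.cover => q x) hqm measurable_fst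
  have a1 : AEMeasurable (fun r : EuclideanSpace ℝ (Fin d) × ℝ => p r.1 * q (D.flow b r.2 r.1))
      ((volume.restrict D.cell).prod (volume.restrict (Iio 0))) :=
    aemeasurable_prod_of_measurable_cover (hp1.mul m1) _
  have a2 : AEMeasurable (fun r : EuclideanSpace ℝ (Fin d) × ℝ =>
      q r.1 * (p (D.flow b (-r.2) r.1) * D.jacobian b (-r.2) r.1))
      ((volume.restrict D.cell).prod (volume.restrict (Iio 0))) :=
    aemeasurable_prod_of_measurable_cover (hq1.mul m2) _
  have i1 : Integrable (fun r : EuclideanSpace ℝ (Fin d) × ℝ => p r.1 * q (D.flow b r.2 r.1))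
      ((volume.restrict D.cell).prod (volume.restrict (Iio 0))) := by
    refine ⟨a1.aestronglyMeasurable, ?_⟩
    rw [hasFiniteIntegral_iff_enorm, lintegral_prod _ a1.enorm]
    refine lt_of_le_of_lt (le_of_eq ?_) (lt_top_iff_ne_top.2 hfin)
    refine setLIntegral_congr_fun D.measurableSet_cell fun x hx => ?_
    have : Measurable fun s => ‖q (D.flow b s x)‖ₑ :=
      (m1.comp (measurable_const.prodMk measurable_id :
        Measurable fun s : ℝ => ((⟨x, D.cell_subset_cover hx⟩, s) : D.cover × ℝ))).enorm
    simp only [enorm_mul]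
    exact lintegral_const_mul _ this
  have i2 : Integrable (fun r : EuclideanSpace ℝ (Fin d) × ℝ =>
      q r.1 * (p (D.flow b (-r.2) r.1) * D.jacobian b (-r.2) r.1))
      ((volume.restrict D.cell).prod (volume.restrict (Iio 0))) := by
    refine ⟨a2.aestronglyMeasurable, ?_⟩
    rw [hasFiniteIntegral_iff_enorm, lintegral_prod _ a2.enorm]
    have htr := h.lintegral_transport (p := fun x => ‖p x‖ₑ) (q := fun x => ‖q x‖ₑ)
      (fun l hl x => by simp only [hp l hl]) (fun l hl x => by simp only [hq l hl])
      (Measurable.enorm hpm) (Measurable.enorm hqm) (Iio 0)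
    rw [htr] at hfin
    refine lt_of_le_of_lt (le_of_eq ?_) (lt_top_iff_ne_top.2 hfin)
    refine setLIntegral_congr_fun D.measurableSet_cell fun x hx => ?_
    have : Measurable fun s => ‖p (D.flow b (-s) x) * D.jacobian b (-s) x‖ₑ :=
      (m2.comp (measurable_const.prodMk measurable_id :
        Measurable fun s : ℝ => ((⟨x, D.cell_subset_cover hx⟩, s) : D.cover × ℝ))).enorm
    simp only [enorm_mul] at this ⊢
    rw [lintegral_const_mul _ this]
    congr 1
    refine lintegral_congr fun s => ?_
    rw [Real.enorm_of_nonneg (h.jacobian_pos (D.cell_subset_cover hx) _).le]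
  have e2 : ∀ y ∈ D.cell, q y * ∫ s in Ioi (0 : ℝ), p (D.flow b s y) * D.jacobian b s y =
      ∫ s in Iio (0 : ℝ), q y * (p (D.flow b (-s) y) * D.jacobian b (-s) y) := by
    intro y _
    rw [integral_const_mul, ← integral_Iic_eq_integral_Iio]
    congr 1
    have := integral_comp_neg_Iic (0 : ℝ) fun s => p (D.flow b s y) * D.jacobian b s y
    rw [neg_zero] at this
    exact this.symm
  rw [setIntegral_congr_fun D.measurableSet_cell e2]
  simp only [← integral_const_mul]
  rw [integral_integral_swap (f := fun x s => p x * q (D.flow b s x)) i1,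
    integral_integral_swap (f := fun y s => q y *
      (p (D.flow b (-s) y) * D.jacobian b (-s) y)) i2]
  refine integral_congr_ae (Eventually.of_forall fun s => ?_)
  have hper : D.IsPeriodic fun x => p x * q (D.flow b s x) :=
    isPeriodic_of_forall_cover fun l hl x hx => by
      rw [hp l hl, h.flow_add_period hl hx, hq l hl]
  simp only
  rw [← h.setIntegral_flow (-s) hper]
  refine setIntegral_congr_fun D.measurableSet_cell fun y hy => ?_
  simp only [h.flow_flow_neg (D.cell_subset_cover hy)]
  ring

end IsVelocityField

end FlowDomain

namespace FlowDomain

variable {d : ℕ} {D : FlowDomain d} {U : Fin 2 → EuclideanSpace ℝ (Fin d) → ℝ}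
  {b b' c : EuclideanSpace ℝ (Fin d) → EuclideanSpace ℝ (Fin d)} {x l : EuclideanSpace ℝ (Fin d)}

/-! ### The estimator as a conditional expectation -/

theorem ae_mem_regularSet (hb : b ∈ D.infiniteTimeFields U) :
    ∀ᵐ x ∂(volume.restrict D.cell), x ∈ D.regularSet U b := by
  have h1 : ∀ᵐ x ∂(volume.restrict D.cover), x ∈ D.regularSet U b := by
    rw [ae_restrict_iff' D.isOpen_cover.measurableSet, ae_iff]
    refine measure_mono_null (fun x hx => ?_) hb.2
    simpa [Classical.not_imp] using hx
  exact ae_mono (Measure.restrict_mono D.cell_subset_cover le_rfl) h1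

theorem ae_mem_cell (D : FlowDomain d) : ∀ᵐ x ∂(volume.restrict D.cell), x ∈ D.cell :=
  ae_restrict_mem D.measurableSet_cell

theorem PotentialAssumptions.measurableOnCover (hU : D.PotentialAssumptions U) (k : Fin 2) :
    D.MeasurableOnCover (U k) :=
  measurableOnCover_of_continuousOn (hU.continuousOn k)

theorem PotentialAssumptions.measurableOnCover_exp (hU : D.PotentialAssumptions U) (k : Fin 2) :
    D.MeasurableOnCover fun x => Real.exp (-U k x) :=
  Real.measurable_exp.comp (Measurable.neg (hU.measurableOnCover k))

theorem IsVelocityField.measurableOnCover_totalIntegral (h : D.IsVelocityField b)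
    (hU : D.PotentialAssumptions U) (k : Fin 2) :
    D.MeasurableOnCover (D.totalIntegral U b k) := by
  have hcont : Continuous fun p : D.cover × ℝ => D.weightedDensity U b k p.2 p.1 :=
    (h.continuousOn_weightedDensity (hU.continuousOn k)).comp_continuous
      (f := fun p : D.cover × ℝ => (p.2, (p.1 : EuclideanSpace ℝ (Fin d)))) (by fun_prop)
      fun p => ⟨trivial, p.1.2⟩
  exact (hcont.stronglyMeasurable.integral_prod_right' (ν := volume)).measurable

theorem IsVelocityField.measurableOnCover_estimator (h : D.IsVelocityField b)
    (hU : D.PotentialAssumptions U) : D.MeasurableOnCover (D.estimator U b) :=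
  Measurable.div (h.measurableOnCover_totalIntegral hU 1) (h.measurableOnCover_totalIntegral hU 0)

theorem ofReal_totalIntegral (h : D.IsVelocityField b) (hx : x ∈ D.cover)
    (hint : D.IsIntegrableAt U b x) (k : Fin 2) :
    ∫⁻ t, ENNReal.ofReal (D.weightedDensity U b k t x) =
      ENNReal.ofReal (D.totalIntegral U b k x) :=
  (ofReal_integral_eq_lintegral_ofReal (hint k)
    (Eventually.of_forall fun t => (h.weightedDensity_pos hx k t).le)).symm

theorem lintegral_comp_neg (f : ℝ → ℝ≥0∞) : ∫⁻ s, f (-s) = ∫⁻ s, f s := by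
  have := (Measure.measurePreserving_neg (volume : Measure ℝ)).lintegral_comp_emb
    (Homeomorph.neg ℝ).measurableEmbedding f
  simpa using this

/-- The estimator is the conditional expectation of the likelihood ratio given the trajectory: against
functions that are constant along trajectories, `A ρ₀` and `ρ₁` have the same integrals. -/
theorem lintegral_mul_estimator (hU : D.PotentialAssumptions U) (hb : b ∈ D.infiniteTimeFields U)
    {f : EuclideanSpace ℝ (Fin d) → ℝ≥0∞} (hf : D.IsPeriodic f) (hfm : D.MeasurableOnCover f)
    (hinv : ∀ x ∈ D.cover, ∀ s, f (D.flow b s x) = f x) :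
    ∫⁻ x in D.cell, f x * ENNReal.ofReal (Real.exp (-U 1 x)) =
      ∫⁻ x in D.cell,
        f x * (ENNReal.ofReal (D.estimator U b x) * ENNReal.ofReal (Real.exp (-U 0 x))) := by
  have h := hb.1
  have htr := h.lintegral_transport (p := fun x => ENNReal.ofReal (Real.exp (-U 1 x)))
    (q := fun x => f x * ENNReal.ofReal (Real.exp (-U 0 x) / D.totalIntegral U b 0 x))
    (fun l hl x => by simp only [hU.periodic 1 l hl])
    (isPeriodic_of_forall_cover fun l hl x hx => by
      rw [hf l hl, hU.periodic 0 l hl, h.totalIntegral_add_period hU.periodic hl hx])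
    (ENNReal.measurable_ofReal.comp (hU.measurableOnCover_exp 1))
    (Measurable.mul hfm (ENNReal.measurable_ofReal.comp
      (Measurable.div (hU.measurableOnCover_exp 0) (h.measurableOnCover_totalIntegral hU 0)))) univ
  simp only [Measure.restrict_univ] at htr
  have e1 : ∫⁻ x in D.cell, f x * ENNReal.ofReal (Real.exp (-U 1 x)) =
      ∫⁻ x in D.cell, ENNReal.ofReal (Real.exp (-U 1 x)) * ∫⁻ s, f (D.flow b s x) *
        ENNReal.ofReal (Real.exp (-U 0 (D.flow b s x)) /
          D.totalIntegral U b 0 (D.flow b s x)) := by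
    refine lintegral_congr_ae ?_
    filter_upwards [ae_mem_regularSet hb, D.ae_mem_cell] with x hx hxc
    have hxD := regularSet_subset hx
    have hint := isIntegrableAt_of_mem_regularSet hx
    have hB := h.totalIntegral_pos hxD hint 0
    -- `exp(-U₀) / B` at `X_s(x)` is `F⁰_s(x) / B(x)`, whose integral over `s` is `1`
    have e : ∀ s, f (D.flow b s x) * ENNReal.ofReal (Real.exp (-U 0 (D.flow b s x)) /
          D.totalIntegral U b 0 (D.flow b s x)) =
        f x * (ENNReal.ofReal (D.weightedDensity U b 0 s x) *
          ENNReal.ofReal (D.totalIntegral U b 0 x)⁻¹) := by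
      intro s
      rw [hinv x hxD, ← ENNReal.ofReal_mul (h.weightedDensity_pos hxD 0 s).le]
      congr 2
      rw [← h.integral_flow hxD 0 s, weightedDensity]
      have hJ := (h.jacobian_pos hxD s).ne'
      have hB' := (h.totalIntegral_pos (h.flow_mem hxD s) (h.isIntegrableAt_flow hxD hint s) 0).ne'
      field_simp
    have hm : Measurable fun s => ENNReal.ofReal (D.weightedDensity U b 0 s x) :=
      ENNReal.measurable_ofReal.comp
        (h.continuous_weightedDensity (hU.continuousOn 0) hxD).measurable
    simp only [e]
    rw [lintegral_const_mul _ (hm.mul_const _), lintegral_mul_const _ hm,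
      ofReal_totalIntegral h hxD hint, ← ENNReal.ofReal_mul hB.le, mul_inv_cancel₀ hB.ne',
      ENNReal.ofReal_one, mul_one, mul_comm]
  rw [e1, htr]
  refine lintegral_congr_ae ?_
  filter_upwards [ae_mem_regularSet hb] with x hx
  have hxD := regularSet_subset hx
  have hint := isIntegrableAt_of_mem_regularSet hx
  have hB := h.totalIntegral_pos hxD hint 0
  have e : ∀ s, ENNReal.ofReal (Real.exp (-U 1 (D.flow b (-s) x))) *
      ENNReal.ofReal (D.jacobian b (-s) x) =
      ENNReal.ofReal (D.weightedDensity U b 1 (-s) x) := fun s =>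
    (ENNReal.ofReal_mul (Real.exp_pos _).le).symm
  simp only [e]
  rw [lintegral_comp_neg (fun s => ENNReal.ofReal (D.weightedDensity U b 1 s x)),
    ofReal_totalIntegral h hxD hint, mul_assoc,
    ← ENNReal.ofReal_mul (div_nonneg (Real.exp_pos _).le hB.le),
    ← ENNReal.ofReal_mul (h.estimator_nonneg hxD), estimator]
  congr 2
  ring

/-! ### The base distribution and the second moment -/

theorem PotentialAssumptions.aemeasurable_density (hU : D.PotentialAssumptions U) :
    AEMeasurable (fun x => ENNReal.ofReal (Real.exp (-U 0 x))) (volume.restrict D.cell) :=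
  ENNReal.measurable_ofReal.comp_aemeasurable (hU.measurableOnCover_exp 0).aemeasurable

theorem PotentialAssumptions.integrable_base (hU : D.PotentialAssumptions U) :
    IntegrableOn (fun x => Real.exp (-U 0 x)) D.cell := by
  by_contra hcon
  have := hU.normalized
  rw [integral_undef hcon] at this
  exact zero_ne_one this

theorem PotentialAssumptions.isProbabilityMeasure (hU : D.PotentialAssumptions U) :
    IsProbabilityMeasure (D.baseMeasure U) := by
  constructor
  rw [baseMeasure, withDensity_apply _ MeasurableSet.univ, Measure.restrict_univ,
    ← ofReal_integral_eq_lintegral_ofReal hU.integrable_base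
      (Eventually.of_forall fun x => (Real.exp_pos _).le), hU.normalized, ENNReal.ofReal_one]

theorem baseMeasure_absolutelyContinuous (D : FlowDomain d)
    (U : Fin 2 → EuclideanSpace ℝ (Fin d) → ℝ) :
    D.baseMeasure U ≪ volume.restrict D.cell :=
  withDensity_absolutelyContinuous _ _

theorem MeasurableOnCover.aemeasurable_base {α : Type*} [MeasurableSpace α]
    {f : EuclideanSpace ℝ (Fin d) → α} (hf : D.MeasurableOnCover f) :
    AEMeasurable f (D.baseMeasure U) :=
  hf.aemeasurable.mono_ac (D.baseMeasure_absolutelyContinuous U)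

theorem lintegral_baseMeasure (hU : D.PotentialAssumptions U)
    {f : EuclideanSpace ℝ (Fin d) → ℝ≥0∞} (hf : D.MeasurableOnCover f) :
    ∫⁻ x, f x ∂(D.baseMeasure U) =
      ∫⁻ x in D.cell, ENNReal.ofReal (Real.exp (-U 0 x)) * f x :=
  lintegral_withDensity_eq_lintegral_mul₀ hU.aemeasurable_density hf.aemeasurable

theorem integral_baseMeasure (hU : D.PotentialAssumptions U)
    (f : EuclideanSpace ℝ (Fin d) → ℝ) :
    ∫ x, f x ∂(D.baseMeasure U) = ∫ x in D.cell, Real.exp (-U 0 x) * f x := by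
  rw [baseMeasure, integral_withDensity_eq_integral_toReal_smul₀ hU.aemeasurable_density
    (Eventually.of_forall fun x => ENNReal.ofReal_lt_top)]
  simp only [ENNReal.toReal_ofReal (Real.exp_pos _).le, smul_eq_mul]

theorem ae_base_of_ae_cell {P : EuclideanSpace ℝ (Fin d) → Prop}
    (h : ∀ᵐ x ∂(volume.restrict D.cell), P x) : ∀ᵐ x ∂(D.baseMeasure U), P x :=
  (D.baseMeasure_absolutelyContinuous U).ae_le h

/-- The likelihood ratio `ρ₁ / ρ₀`. -/
noncomputable def likelihoodRatio (U : Fin 2 → EuclideanSpace ℝ (Fin d) → ℝ)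
    (x : EuclideanSpace ℝ (Fin d)) : ℝ :=
  Real.exp (-(U 1 x - U 0 x))

theorem exp_mul_likelihoodRatio (x : EuclideanSpace ℝ (Fin d)) :
    Real.exp (-U 0 x) * likelihoodRatio U x = Real.exp (-U 1 x) := by
  rw [likelihoodRatio, ← Real.exp_add]
  congr 1
  ring

theorem PotentialAssumptions.measurableOnCover_likelihoodRatio (hU : D.PotentialAssumptions U) :
    D.MeasurableOnCover (likelihoodRatio U) :=
  Real.measurable_exp.comp
    (Measurable.neg (Measurable.sub (hU.measurableOnCover 1) (hU.measurableOnCover 0)))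

theorem likelihoodRatio_sq (x : EuclideanSpace ℝ (Fin d)) :
    likelihoodRatio U x ^ 2 = Real.exp (-2 * (U 1 x - U 0 x)) := by
  rw [likelihoodRatio, ← Real.exp_nat_mul]
  congr 1
  push_cast
  ring

theorem PotentialAssumptions.memLp_likelihoodRatio (hU : D.PotentialAssumptions U) :
    MemLp (likelihoodRatio U) 2 (D.baseMeasure U) := by
  rw [memLp_two_iff_integrable_sq
    hU.measurableOnCover_likelihoodRatio.aemeasurable_base.aestronglyMeasurable]
  simp only [likelihoodRatio_sq]
  exact hU.vanilla_finite

/-- `lintegral_mul_estimator` with respect to the base distribution. -/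
theorem lintegral_mul_estimator_base (hU : D.PotentialAssumptions U)
    (hb : b ∈ D.infiniteTimeFields U)
    {f : EuclideanSpace ℝ (Fin d) → ℝ≥0∞} (hf : D.IsPeriodic f) (hfm : D.MeasurableOnCover f)
    (hinv : ∀ x ∈ D.cover, ∀ s, f (D.flow b s x) = f x) :
    ∫⁻ x, f x * ENNReal.ofReal (D.estimator U b x) ∂(D.baseMeasure U) =
      ∫⁻ x, f x * ENNReal.ofReal (likelihoodRatio U x) ∂(D.baseMeasure U) := by
  have m1 : D.MeasurableOnCover fun x => f x * ENNReal.ofReal (D.estimator U b x) :=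
    Measurable.mul hfm
      (ENNReal.measurable_ofReal.comp (hb.1.measurableOnCover_estimator hU))
  have m2 : D.MeasurableOnCover fun x => f x * ENNReal.ofReal (likelihoodRatio U x) :=
    Measurable.mul hfm
      (ENNReal.measurable_ofReal.comp hU.measurableOnCover_likelihoodRatio)
  rw [lintegral_baseMeasure hU m1, lintegral_baseMeasure hU m2]
  have := lintegral_mul_estimator hU hb hf hfm hinv
  calc ∫⁻ x in D.cell, ENNReal.ofReal (Real.exp (-U 0 x)) *
        (f x * ENNReal.ofReal (D.estimator U b x))
      = ∫⁻ x in D.cell, f x * (ENNReal.ofReal (D.estimator U b x) *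
          ENNReal.ofReal (Real.exp (-U 0 x))) := lintegral_congr fun x => by ring
    _ = ∫⁻ x in D.cell, f x * ENNReal.ofReal (Real.exp (-U 1 x)) := this.symm
    _ = ∫⁻ x in D.cell, ENNReal.ofReal (Real.exp (-U 0 x)) *
        (f x * ENNReal.ofReal (likelihoodRatio U x)) := lintegral_congr fun x => by
      rw [← exp_mul_likelihoodRatio, ENNReal.ofReal_mul (Real.exp_pos _).le]
      ring

theorem isPeriodic_estimator (hU : D.PotentialAssumptions U) (h : D.IsVelocityField b) :
    D.IsPeriodic (D.estimator U b) :=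
  isPeriodic_of_forall_cover fun _ hl _ hx => h.estimator_add_period hU.periodic hl hx

/-- The second moment of the truncated estimator is at most that of the likelihood ratio: it is
bounded by `E₀[min(A, n) A] = E₀[min(A, n) w]`, and `2 min(A, n) w ≤ min(A, n)² + w²`. -/
theorem lintegral_min_estimator_sq_le (hU : D.PotentialAssumptions U)
    (hb : b ∈ D.infiniteTimeFields U) (n : ℕ) :
    ∫⁻ x, ENNReal.ofReal (min (D.estimator U b x) n ^ 2) ∂(D.baseMeasure U) ≤
      ∫⁻ x, ENNReal.ofReal (likelihoodRatio U x ^ 2) ∂(D.baseMeasure U) := by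
  have := hU.isProbabilityMeasure
  have h := hb.1
  have hAm := h.measurableOnCover_estimator hU
  have hnn : ∀ᵐ x ∂(D.baseMeasure U), 0 ≤ D.estimator U b x := by
    refine ae_base_of_ae_cell ?_
    filter_upwards [D.ae_mem_cell] with x hx using h.estimator_nonneg (D.cell_subset_cover hx)
  set S := ∫⁻ x, ENNReal.ofReal (min (D.estimator U b x) n ^ 2) ∂(D.baseMeasure U) with hS
  set W := ∫⁻ x, ENNReal.ofReal (likelihoodRatio U x ^ 2) ∂(D.baseMeasure U) with hW
  have hSfin : S ≠ ⊤ := by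
    refine ne_top_of_le_ne_top (b := ENNReal.ofReal ((n : ℝ) ^ 2)) ENNReal.ofReal_ne_top ?_
    calc S ≤ ∫⁻ _, ENNReal.ofReal ((n : ℝ) ^ 2) ∂(D.baseMeasure U) := by
          refine lintegral_mono_ae ?_
          filter_upwards [hnn] with x hx
          gcongr
          exact min_le_right _ _
      _ = ENNReal.ofReal ((n : ℝ) ^ 2) := by simp
  have hmm : D.MeasurableOnCover fun x => ENNReal.ofReal (min (D.estimator U b x) n) :=
    ENNReal.measurable_ofReal.comp (Measurable.min hAm measurable_const)
  have h1 : S ≤ ∫⁻ x, ENNReal.ofReal (min (D.estimator U b x) n) *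
      ENNReal.ofReal (D.estimator U b x) ∂(D.baseMeasure U) := by
    refine lintegral_mono_ae ?_
    filter_upwards [hnn] with x hx
    have hm : 0 ≤ min (D.estimator U b x) n := le_min hx (Nat.cast_nonneg n)
    rw [← ENNReal.ofReal_mul hm, sq]
    gcongr
    exact min_le_left _ _
  rw [lintegral_mul_estimator_base hU hb
    (fun l hl x => by simp only [isPeriodic_estimator hU h l hl x]) hmm
    (fun x hx s => by simp only [h.estimator_flow hx])] at h1
  have hmm2 : D.MeasurableOnCover fun x => ENNReal.ofReal (min (D.estimator U b x) n ^ 2) :=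
    ENNReal.measurable_ofReal.comp (Measurable.pow_const (Measurable.min hAm measurable_const) 2)
  have hprod : D.MeasurableOnCover fun x => ENNReal.ofReal (min (D.estimator U b x) n) *
      ENNReal.ofReal (likelihoodRatio U x) :=
    Measurable.mul hmm (ENNReal.measurable_ofReal.comp hU.measurableOnCover_likelihoodRatio)
  have h2 : 2 * ∫⁻ x, ENNReal.ofReal (min (D.estimator U b x) n) *
      ENNReal.ofReal (likelihoodRatio U x) ∂(D.baseMeasure U) ≤ S + W := by
    rw [hS, hW, ← lintegral_add_left' hmm2.aemeasurable_base,
      ← lintegral_const_mul'' _ hprod.aemeasurable_base]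
    refine lintegral_mono_ae ?_
    filter_upwards [hnn] with x hx
    have hm : 0 ≤ min (D.estimator U b x) n := le_min hx (Nat.cast_nonneg n)
    rw [← ENNReal.ofReal_mul hm, ← ENNReal.ofReal_add (sq_nonneg _) (sq_nonneg _),
      show (2 : ℝ≥0∞) = ENNReal.ofReal 2 by simp, ← ENNReal.ofReal_mul zero_le_two]
    refine ENNReal.ofReal_le_ofReal ?_
    nlinarith [sq_nonneg (min (D.estimator U b x) n - likelihoodRatio U x)]
  have h3 : S + S ≤ S + W := by
    rw [← two_mul]
    exact (mul_le_mul_right h1 2).trans h2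
  exact (ENNReal.add_le_add_iff_left hSfin).1 h3

/-- The second moment of the estimator is finite. -/
theorem memLp_estimator (hU : D.PotentialAssumptions U) (hb : b ∈ D.infiniteTimeFields U) :
    MemLp (D.estimator U b) 2 (D.baseMeasure U) := by
  have h := hb.1
  have hAm := h.measurableOnCover_estimator hU
  rw [memLp_two_iff_integrable_sq hAm.aemeasurable_base.aestronglyMeasurable]
  refine ⟨(hAm.aemeasurable_base.pow_const 2).aestronglyMeasurable, ?_⟩
  rw [hasFiniteIntegral_iff_ofReal (Eventually.of_forall fun x => sq_nonneg _)]
  have hW : ∫⁻ x, ENNReal.ofReal (likelihoodRatio U x ^ 2) ∂(D.baseMeasure U) < ⊤ := by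
    have := hU.vanilla_finite.2
    simp only [← likelihoodRatio_sq] at this
    rwa [hasFiniteIntegral_iff_ofReal (Eventually.of_forall fun x => sq_nonneg _)] at this
  refine lt_of_le_of_lt ?_ hW
  have hlim : ∀ x, ENNReal.ofReal (D.estimator U b x ^ 2) =
      liminf (fun n : ℕ => ENNReal.ofReal (min (D.estimator U b x) n ^ 2)) atTop := by
    intro x
    refine (Tendsto.liminf_eq ?_).symm
    refine tendsto_const_nhds.congr' ?_
    obtain ⟨N, hN⟩ := exists_nat_ge (D.estimator U b x)
    filter_upwards [eventually_ge_atTop N] with n hn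
    rw [min_eq_left (hN.trans (by exact_mod_cast hn))]
  simp only [hlim]
  refine (lintegral_liminf_le' fun n => ?_).trans ?_
  · exact ENNReal.measurable_ofReal.comp_aemeasurable
      ((hAm.aemeasurable_base.min aemeasurable_const).pow_const 2)
  · refine (liminf_le_liminf (Eventually.of_forall fun n =>
      lintegral_min_estimator_sq_le hU hb n)).trans ?_
    simp

theorem integral_mul_estimator_of_nonneg (hU : D.PotentialAssumptions U)
    (hb : b ∈ D.infiniteTimeFields U)
    {f : EuclideanSpace ℝ (Fin d) → ℝ} (hf : D.IsPeriodic f) (hfm : D.MeasurableOnCover f)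
    (hinv : ∀ x ∈ D.cover, ∀ s, f (D.flow b s x) = f x) (hnn : ∀ x, 0 ≤ f x) :
    ∫ x, f x * D.estimator U b x ∂(D.baseMeasure U) =
      ∫ x, f x * likelihoodRatio U x ∂(D.baseMeasure U) := by
  have h := hb.1
  have hA : ∀ᵐ x ∂(D.baseMeasure U), 0 ≤ D.estimator U b x := by
    refine ae_base_of_ae_cell ?_
    filter_upwards [D.ae_mem_cell] with x hx using h.estimator_nonneg (D.cell_subset_cover hx)
  have hfA : 0 ≤ᵐ[D.baseMeasure U] fun x => f x * D.estimator U b x := by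
    filter_upwards [hA] with x hx
    exact mul_nonneg (hnn x) hx
  have hfw : 0 ≤ᵐ[D.baseMeasure U] fun x => f x * likelihoodRatio U x :=
    Eventually.of_forall fun x => mul_nonneg (hnn x) (Real.exp_pos _).le
  rw [integral_eq_lintegral_of_nonneg_ae hfA (hfm.aemeasurable_base.mul
        (h.measurableOnCover_estimator hU).aemeasurable_base).aestronglyMeasurable,
    integral_eq_lintegral_of_nonneg_ae hfw (hfm.aemeasurable_base.mul
        hU.measurableOnCover_likelihoodRatio.aemeasurable_base).aestronglyMeasurable]
  simp only [ENNReal.ofReal_mul (hnn _)]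
  have hfm' : D.MeasurableOnCover fun x => ENNReal.ofReal (f x) :=
    ENNReal.measurable_ofReal.comp hfm
  rw [lintegral_mul_estimator_base hU hb (fun l hl x => by simp only [hf l hl x]) hfm'
    (fun x hx s => by simp only [hinv x hx])]

/-- Against square-integrable functions that are constant along trajectories, the estimator and the
likelihood ratio have the same integrals. -/
theorem integral_mul_estimator (hU : D.PotentialAssumptions U)
    (hb : b ∈ D.infiniteTimeFields U)
    {f : EuclideanSpace ℝ (Fin d) → ℝ} (hf : D.IsPeriodic f) (hfm : D.MeasurableOnCover f)
    (hinv : ∀ x ∈ D.cover, ∀ s, f (D.flow b s x) = f x)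
    (hf2 : MemLp f 2 (D.baseMeasure U)) :
    ∫ x, f x * D.estimator U b x ∂(D.baseMeasure U) =
      ∫ x, f x * likelihoodRatio U x ∂(D.baseMeasure U) := by
  have e : ∀ x y, f x * y = max (f x) 0 * y - max (-f x) 0 * y := by
    intro x y
    rw [← sub_mul]
    congr 1
    rcases le_total 0 (f x) with h | h
    · rw [max_eq_left h, max_eq_right (by linarith), sub_zero]
    · rw [max_eq_right h, max_eq_left (by linarith)]; ring
  have hp : MemLp (fun x => max (f x) 0) 2 (D.baseMeasure U) := hf2.pos_part
  have hn : MemLp (fun x => max (-f x) 0) 2 (D.baseMeasure U) := hf2.neg_part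
  have hA := memLp_estimator hU hb
  have hw := hU.memLp_likelihoodRatio
  simp only [e]
  have i1 : Integrable (fun x => max (f x) 0 * D.estimator U b x) (D.baseMeasure U) :=
    hp.integrable_mul hA
  have i2 : Integrable (fun x => max (-f x) 0 * D.estimator U b x) (D.baseMeasure U) :=
    hn.integrable_mul hA
  have i3 : Integrable (fun x => max (f x) 0 * likelihoodRatio U x) (D.baseMeasure U) :=
    hp.integrable_mul hw
  have i4 : Integrable (fun x => max (-f x) 0 * likelihoodRatio U x) (D.baseMeasure U) :=
    hn.integrable_mul hw
  rw [integral_sub i1 i2, integral_sub i3 i4,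
    integral_mul_estimator_of_nonneg hU hb (f := fun x => max (f x) 0)
      (fun l hl x => by simp only [hf l hl x]) (Measurable.max hfm measurable_const)
      (fun x hx s => by simp only [hinv x hx]) (fun x => le_max_right _ _),
    integral_mul_estimator_of_nonneg hU hb (f := fun x => max (-f x) 0)
      (fun l hl x => by simp only [hf l hl x])
      (Measurable.max (Measurable.neg hfm) measurable_const)
      (fun x hx s => by simp only [hinv x hx]) (fun x => le_max_right _ _)]

/-- The variance differs from the second moment by a constant that does not depend on the velocity
field. -/
theorem estimatorVariance_eq (hU : D.PotentialAssumptions U) (hb : b ∈ D.infiniteTimeFields U) :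
    D.estimatorVariance U b = D.secondMoment U b -
      (∫ x, likelihoodRatio U x ∂(D.baseMeasure U)) ^ 2 := by
  have := hU.isProbabilityMeasure
  rw [estimatorVariance, ProbabilityTheory.variance_eq_sub (memLp_estimator hU hb), secondMoment]
  have h1 := integral_mul_estimator hU hb (f := fun _ => 1) (fun _ _ _ => rfl) measurable_const
    (fun _ _ _ => rfl) (memLp_const 1)
  simp only [one_mul] at h1
  rw [h1]
  rfl

end FlowDomain

namespace FlowDomain

variable {d : ℕ} {D : FlowDomain d} {U : Fin 2 → EuclideanSpace ℝ (Fin d) → ℝ}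
  {b b' c : EuclideanSpace ℝ (Fin d) → EuclideanSpace ℝ (Fin d)} {x l : EuclideanSpace ℝ (Fin d)}

/-! ### Time reversal -/

theorem integrableOn_Ioi_comp_neg {f : ℝ → ℝ} :
    IntegrableOn (fun t => f (-t)) (Ioi 0) ↔ IntegrableOn f (Iio 0) := by
  have := (Measure.measurePreserving_neg (volume : Measure ℝ)).integrableOn_comp_preimage
    (MeasurableEquiv.neg ℝ).measurableEmbedding (f := f) (s := Iio 0)
  rw [← this]
  have h2 : Neg.neg ⁻¹' Iio (0 : ℝ) = Ioi 0 := by ext; simp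
  rw [h2]
  rfl

namespace IsVelocityField

theorem flow_neg_field (h : D.IsVelocityField b) (hx : x ∈ D.cover) (t : ℝ) :
    D.flow (-b) t x = D.flow b (-t) x := by
  refine (h.neg.flow_eq_of_hasDerivAt hx (T := |t|) (β := fun s => D.flow b (-s) x)
    (by simp [h.flow_zero hx]) (fun s _ => ?_) t ⟨neg_abs_le t, le_abs_self t⟩).symm
  have := (h.hasDerivAt_flow hx (-s)).scomp s (hasDerivAt_neg s)
  rw [neg_one_smul] at this
  exact this

theorem jacobian_neg_field (h : D.IsVelocityField b) (hx : x ∈ D.cover) (t : ℝ) :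
    D.jacobian (-b) t x = D.jacobian b (-t) x := by
  have : D.flow (-b) t =ᶠ[𝓝 x] D.flow b (-t) := by
    filter_upwards [D.isOpen_cover.mem_nhds hx] with y hy using h.flow_neg_field hy t
  rw [jacobian, jacobian, this.fderiv_eq]

theorem weightedDensity_neg_field (h : D.IsVelocityField b) (hx : x ∈ D.cover) (k : Fin 2)
    (t : ℝ) : D.weightedDensity U (-b) k t x = D.weightedDensity U b k (-t) x := by
  rw [weightedDensity, weightedDensity, h.flow_neg_field hx, h.jacobian_neg_field hx]

theorem forwardIntegral_neg_field (h : D.IsVelocityField b) (hx : x ∈ D.cover) (k : Fin 2) :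
    D.forwardIntegral U (-b) k x = D.backwardIntegral U b k x := by
  simp only [forwardIntegral, backwardIntegral, h.weightedDensity_neg_field hx]
  rw [integral_comp_neg_Ioi (c := 0) (f := fun t => D.weightedDensity U b k t x), neg_zero,
    integral_Iic_eq_integral_Iio]

theorem backwardIntegral_neg_field (h : D.IsVelocityField b) (hx : x ∈ D.cover) (k : Fin 2) :
    D.backwardIntegral U (-b) k x = D.forwardIntegral U b k x := by
  have := h.neg.forwardIntegral_neg_field (U := U) hx k
  rw [neg_neg] at this
  exact this.symm

theorem isIntegrableAt_neg_field (h : D.IsVelocityField b) (hx : x ∈ D.cover)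
    (hint : D.IsIntegrableAt U b x) : D.IsIntegrableAt U (-b) x := by
  intro k
  simp only [h.weightedDensity_neg_field hx]
  exact (hint k).comp_neg

theorem regularSet_subset_regularSet_neg (h : D.IsVelocityField b) :
    D.regularSet U b ⊆ D.regularSet U (-b) :=
  mem_regularSet_of_isOpen isOpen_regularSet regularSet_subset
    (fun _ hz => h.isIntegrableAt_neg_field (regularSet_subset hz)
      (isIntegrableAt_of_mem_regularSet hz))
    (fun k => (continuousOn_backwardIntegral k).congr fun _ hz =>
      h.forwardIntegral_neg_field (regularSet_subset hz) k)
    (fun k => (continuousOn_forwardIntegral k).congr fun _ hz =>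
      h.backwardIntegral_neg_field (regularSet_subset hz) k)

theorem regularSet_neg (h : D.IsVelocityField b) : D.regularSet U (-b) = D.regularSet U b := by
  refine Subset.antisymm ?_ h.regularSet_subset_regularSet_neg
  have := h.neg.regularSet_subset_regularSet_neg (U := U)
  rwa [neg_neg] at this

end IsVelocityField

/-! ### Trajectories leave compact parts of the regular set -/

/-- The set of the translates of points of `K` by periods. -/
def translates (D : FlowDomain d) (K : Set (EuclideanSpace ℝ (Fin d))) :
    Set (EuclideanSpace ℝ (Fin d)) :=
  {x | ∃ l ∈ D.periods, x + l ∈ K}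

theorem subset_translates (K : Set (EuclideanSpace ℝ (Fin d))) : K ⊆ D.translates K :=
  fun x hx => ⟨0, zero_mem _, by simpa using hx⟩

theorem translates_mono {K K' : Set (EuclideanSpace ℝ (Fin d))} (h : K ⊆ K') :
    D.translates K ⊆ D.translates K' :=
  fun _ ⟨l, hl, hx⟩ => ⟨l, hl, h hx⟩

/-- A trajectory of `b` does not visit `K` at two times that differ by `T` or more. -/
def IsTransient (D : FlowDomain d) (b : EuclideanSpace ℝ (Fin d) → EuclideanSpace ℝ (Fin d))
    (K : Set (EuclideanSpace ℝ (Fin d))) (T : ℝ) : Prop :=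
  ∀ y ∈ K, ∀ t ≥ T, D.flow b t y ∉ K

theorem IsTransient.neg {K : Set (EuclideanSpace ℝ (Fin d))} {T : ℝ}
    (hT : D.IsTransient b K T) (h : D.IsVelocityField b) (hK : K ⊆ D.cover) :
    D.IsTransient (-b) K T := by
  intro y hy t ht hmem
  rw [h.flow_neg_field (hK hy)] at hmem
  have := hT _ hmem t ht
  rw [h.flow_flow_neg (hK hy)] at this
  exact this hy

/-- On compact parts of the regular set the forward integrals have uniformly small tails. -/
theorem IsVelocityField.exists_forall_tail_lt (h : D.IsVelocityField b)
    (hU : D.PotentialAssumptions U) {K : Set (EuclideanSpace ℝ (Fin d))} (hK : IsCompact K)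
    (hKr : K ⊆ D.regularSet U b) (k : Fin 2) {δ : ℝ} (hδ : 0 < δ) :
    ∃ T > 0, ∀ t ≥ T, ∀ y ∈ K, ∫ s in Ioi t, D.weightedDensity U b k s y < δ := by
  refine hK.induction_on (p := fun S => ∃ T > 0, ∀ t ≥ T, ∀ y ∈ S,
    ∫ s in Ioi t, D.weightedDensity U b k s y < δ) ⟨1, one_pos, by simp⟩ ?_ ?_ ?_
  · rintro S S' hS ⟨T, h0, hT⟩
    exact ⟨T, h0, fun t ht y hy => hT t ht y (hS hy)⟩
  · rintro S S' ⟨T, h0, hT⟩ ⟨T', -, hT'⟩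
    refine ⟨max T T', lt_max_of_lt_left h0, fun t ht y hy => ?_⟩
    rcases hy with hy | hy
    · exact hT t (le_of_max_le_left ht) y hy
    · exact hT' t (le_of_max_le_right ht) y hy
  · intro x hx
    have hxr := hKr hx
    have tail : ∀ y ∈ D.regularSet U b, ∀ t, ∫ s in Ioi t, D.weightedDensity U b k s y =
        D.forwardIntegral U b k y - ∫ s in (0 : ℝ)..t, D.weightedDensity U b k s y := by
      intro y hy t
      have hint := isIntegrableAt_of_mem_regularSet hy k
      rw [forwardIntegral, ← intervalIntegral.integral_Ioi_sub_Ioi' hint.integrableOn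
        hint.integrableOn]
      ring
    have hlim := intervalIntegral_tendsto_integral_Ioi 0
      (isIntegrableAt_of_mem_regularSet hxr k).integrableOn tendsto_id
    obtain ⟨T, hT1, hT2⟩ := ((hlim.const_sub (D.forwardIntegral U b k x)).eventually
      (gt_mem_nhds (show D.forwardIntegral U b k x - D.forwardIntegral U b k x < δ by
        rwa [sub_self])) |>.and (eventually_gt_atTop 0)).exists
    have hcont : ContinuousAt (fun y => D.forwardIntegral U b k y -
        ∫ s in (0 : ℝ)..T, D.weightedDensity U b k s y) x :=
      ((continuousOn_forwardIntegral k).sub ((h.continuousOn_intervalIntegral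
        (hU.continuousOn k) T).mono regularSet_subset)).continuousAt (isOpen_regularSet.mem_nhds hxr)
    have hev := (hcont.eventually (gt_mem_nhds hT1)).and (isOpen_regularSet.mem_nhds hxr)
    refine ⟨_, mem_nhdsWithin_of_mem_nhds hev, T, hT2, fun t ht y hy => ?_⟩
    have hint := isIntegrableAt_of_mem_regularSet hy.2 k
    refine lt_of_le_of_lt ?_ ((tail y hy.2 T).trans_lt hy.1)
    exact setIntegral_mono_set hint.integrableOn (Eventually.of_forall fun s =>
      (h.weightedDensity_pos (regularSet_subset hy.2) k s).le) (Ioi_subset_Ioi ht).eventuallyLE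

/-- Trajectories do not return to a compact part of the regular set after a long time. If `y` and
`X_t(y)` both lie in it, then `R₊(X_t(y)) J_t(y)` is a tail of the forward integral `R₊(y)`, hence small,
and `R₊` is bounded below, so that `J_t(y) < 1`; the backward integrals give `1 / J_t(y) < 1`. -/
theorem IsVelocityField.exists_isTransient (h : D.IsVelocityField b)
    (hU : D.PotentialAssumptions U) {K : Set (EuclideanSpace ℝ (Fin d))} (hK : IsCompact K)
    (hKr : K ⊆ D.regularSet U b) : ∃ T > 0, D.IsTransient b (D.translates K) T := by
  have hKD := hKr.trans regularSet_subset
  obtain ⟨m, hm, hmK⟩ := hK.exists_forall_le' ((continuousOn_forwardIntegral 0).mono hKr)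
    (a := 0) fun y hy => h.forwardIntegral_pos (hKD hy) (isIntegrableAt_of_mem_regularSet (hKr hy)) 0
  obtain ⟨m', hm', hmK'⟩ := hK.exists_forall_le' ((continuousOn_backwardIntegral 0).mono hKr)
    (a := 0) fun y hy => h.backwardIntegral_pos (hKD hy) (isIntegrableAt_of_mem_regularSet (hKr hy)) 0
  obtain ⟨T, hT0, hT⟩ := h.exists_forall_tail_lt hU hK hKr 0 hm
  obtain ⟨T', -, hT'⟩ := h.neg.exists_forall_tail_lt hU hK (by rwa [h.regularSet_neg]) 0 hm'
  refine ⟨max T T', lt_max_of_lt_left hT0, ?_⟩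
  rintro y ⟨l, hl, hyl⟩ t ht ⟨l', hl', hzl⟩
  have hy : y ∈ D.cover := (add_mem_cover_iff hl).1 (hKD hyl)
  set z := D.flow b t y with hz
  have hzD : z ∈ D.cover := h.flow_mem hy t
  have h1 : D.jacobian b t y < 1 := by
    have e := h.forwardIntegral_flow_mul (U := U) hy 0 t
    have e1 := hT t (le_of_max_le_left ht) _ hyl
    simp only [h.weightedDensity_add_period (hU.periodic 0) hl hy] at e1
    have e2 := hmK _ hzl
    rw [h.forwardIntegral_add_period hU.periodic hl' hzD] at e2
    rw [← e] at e1
    by_contra! hge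
    nlinarith
  have h2 : D.jacobian b (-t) z < 1 := by
    have e := h.neg.forwardIntegral_flow_mul (U := U) hzD 0 t
    have e1 := hT' t (le_of_max_le_right ht) _ hzl
    simp only [h.neg.weightedDensity_add_period (hU.periodic 0) hl' hzD] at e1
    rw [← e, h.flow_neg_field hzD, h.jacobian_neg_field hzD, hz, h.flow_neg_flow hy,
      h.forwardIntegral_neg_field hy] at e1
    have e2 := hmK' _ hyl
    rw [h.backwardIntegral_add_period hU.periodic hl hy] at e2
    by_contra! hge
    nlinarith
  have h3 := h.jacobian_neg_flow hy t
  have h4 := h.jacobian_pos hy t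
  have h5 := h.jacobian_pos hzD (-t)
  nlinarith

/-! ### Local perturbations of a velocity field -/

/-- A continuous curve that is in the closed set `Z` at some time `t ≥ 0` has a first time at which
it is in `Z`. -/
theorem exists_first_mem {γ : ℝ → EuclideanSpace ℝ (Fin d)} (hγ : Continuous γ)
    {Z : Set (EuclideanSpace ℝ (Fin d))} (hZ : IsClosed Z) {t : ℝ} (ht : 0 ≤ t) (htZ : γ t ∈ Z) :
    ∃ s ∈ Icc 0 t, γ s ∈ Z ∧ ∀ r ∈ Ico 0 s, γ r ∉ Z := by
  have hcpt : IsCompact (Icc 0 t ∩ γ ⁻¹' Z) := isCompact_Icc.inter_right (hZ.preimage hγ)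
  obtain ⟨s, hs, hmin⟩ := hcpt.exists_isLeast ⟨t, ⟨ht, le_rfl⟩, htZ⟩
  refine ⟨s, hs.1, hs.2, fun r hr hrZ => ?_⟩
  exact absurd (hmin ⟨⟨hr.1, hr.2.le.trans hs.1.2⟩, hrZ⟩) (not_le.2 hr.2)

namespace IsVelocityField

/-- Two velocity fields that agree off `Z` have the same trajectory up to and including the first time at
which it meets `Z`. -/
theorem flow_eq_of_avoids_Ico (h : D.IsVelocityField b) (h' : D.IsVelocityField b')
    {Z : Set (EuclideanSpace ℝ (Fin d))} (hZ : IsClosed Z) (hbb' : ∀ y ∉ Z, b' y = b y)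
    (hx : x ∈ D.cover) {t : ℝ} (ht0 : 0 ≤ t) (ht : ∀ s ∈ Ico 0 t, D.flow b s x ∉ Z) :
    D.flow b' t x = D.flow b t x := by
  rcases ht0.eq_or_lt with rfl | ht0
  · rw [h.flow_zero hx, h'.flow_zero hx]
  have hEq : EqOn (fun s => D.flow b' s x) (fun s => D.flow b s x) (Ico 0 t) := fun s hs =>
    (h.flow_eq_of_avoids h' hZ hbb' hx fun r hr => by
      rw [uIcc_of_le hs.1] at hr
      exact ht r ⟨hr.1, hr.2.trans_lt hs.2⟩).1
  have := hEq.closure (h'.continuous_flow hx) (h.continuous_flow hx)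
  rw [closure_Ico ht0.ne] at this
  exact this ⟨ht0.le, le_rfl⟩

/-- A trajectory of `b'` that is at some later time in the regular set of `b` starts there: up to its first
visit to `Z` it is a trajectory of `b`, and `Z` lies in the invariant regular set. -/
theorem mem_regularSet_of_flow_mem_of_nonneg (h : D.IsVelocityField b)
    (h' : D.IsVelocityField b') (hU : D.PotentialAssumptions U)
    {Z : Set (EuclideanSpace ℝ (Fin d))} (hZ : IsClosed Z) (hbb' : ∀ y ∉ Z, b' y = b y)
    (hZr : Z ⊆ D.regularSet U b) (hx : x ∈ D.cover) {t : ℝ} (ht : 0 ≤ t)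
    (hmem : D.flow b' t x ∈ D.regularSet U b) : x ∈ D.regularSet U b := by
  have key : ∀ s, 0 ≤ s → (∀ r ∈ Ico 0 s, D.flow b' r x ∉ Z) →
      D.flow b' s x ∈ D.regularSet U b → x ∈ D.regularSet U b := by
    intro s hs hav hreg
    rw [← h'.flow_eq_of_avoids_Ico h hZ (fun y hy => (hbb' y hy).symm) hx hs hav] at hreg
    have := h.flow_mem_regularSet hU.continuousOn hreg (-s)
    rwa [h.flow_neg_flow hx] at this
  by_cases hav : ∀ r ∈ Ico 0 t, D.flow b' r x ∉ Z
  · exact key t ht hav hmem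
  · push Not at hav
    obtain ⟨r, hr, hrZ⟩ := hav
    obtain ⟨s, hs, hsZ, hs'⟩ := exists_first_mem (h'.continuous_flow hx) hZ hr.1 hrZ
    exact key s hs.1 hs' (hZr hsZ)

/-- The regular set of `b` is invariant under the flow of a velocity field that differs from `b`
only in the regular set. -/
theorem flow_mem_regularSet_of_eqOn_compl (h : D.IsVelocityField b) (h' : D.IsVelocityField b')
    (hU : D.PotentialAssumptions U) {Z : Set (EuclideanSpace ℝ (Fin d))} (hZ : IsClosed Z)
    (hbb' : ∀ y ∉ Z, b' y = b y) (hZr : Z ⊆ D.regularSet U b) (hx : x ∈ D.regularSet U b)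
    (t : ℝ) : D.flow b' t x ∈ D.regularSet U b := by
  have hxD := regularSet_subset hx
  rcases le_total 0 t with ht | ht
  · have := h.neg.mem_regularSet_of_flow_mem_of_nonneg h'.neg hU hZ
      (fun y hy => by simp [hbb' y hy]) (by rwa [h.regularSet_neg]) (h'.flow_mem hxD t) ht
      (by rwa [h.regularSet_neg, h'.flow_neg_field (h'.flow_mem hxD t), h'.flow_neg_flow hxD])
    rwa [h.regularSet_neg] at this
  · refine h.mem_regularSet_of_flow_mem_of_nonneg h' hU hZ hbb' hZr (h'.flow_mem hxD t)
      (neg_nonneg.2 ht) ?_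
    rwa [h'.flow_neg_flow hxD]

/-- If the trajectory of a local perturbation `b'` of `b` avoids the perturbed region from time `T`
on, then its forward integrals are determined by those of `b`. -/
theorem forwardIntegral_of_avoids (h : D.IsVelocityField b) (h' : D.IsVelocityField b')
    (hU : D.PotentialAssumptions U) {Z : Set (EuclideanSpace ℝ (Fin d))} (hZ : IsClosed Z)
    (hbb' : ∀ y ∉ Z, b' y = b y) (hZr : Z ⊆ D.regularSet U b) (hx : x ∈ D.regularSet U b)
    {T : ℝ} (hT : 0 ≤ T) (hav : ∀ t ≥ T, D.flow b' t x ∉ Z) (k : Fin 2) :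
    IntegrableOn (fun t => D.weightedDensity U b' k t x) (Ioi 0) ∧
      D.forwardIntegral U b' k x = (∫ t in (0 : ℝ)..T, D.weightedDensity U b' k t x) +
        D.forwardIntegral U b k (D.flow b' T x) * D.jacobian b' T x := by
  have hxD := regularSet_subset hx
  set z := D.flow b' T x with hz
  have hzr : z ∈ D.regularSet U b := h.flow_mem_regularSet_of_eqOn_compl h' hU hZ hbb' hZr hx T
  have hzD := regularSet_subset hzr
  have hF : ∀ t ∈ Ioi (0 : ℝ), D.weightedDensity U b' k (t + T) x =
      D.weightedDensity U b k t z * D.jacobian b' T x := by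
    intro t ht
    rw [h'.weightedDensity_flow hxD, ← hz]
    have := h'.flow_eq_of_avoids h hZ (fun y hy => (hbb' y hy).symm) hzD (t := t) fun s hs => by
      rw [uIcc_of_le (le_of_lt ht)] at hs
      rw [hz, ← h'.flow_add hxD]
      exact hav _ (by linarith [hs.1])
    rw [weightedDensity, weightedDensity, this.1, this.2]
  have hm : MeasurePreserving (fun t : ℝ => t + T) volume volume :=
    measurePreserving_add_right volume T
  have hpre : (fun t : ℝ => t + T) ⁻¹' Ioi T = Ioi 0 := by ext; simp
  have hint : IntegrableOn (fun t => D.weightedDensity U b' k t x) (Ioi T) := by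
    have := hm.integrableOn_comp_preimage (measurableEmbedding_addRight T)
      (f := fun t => D.weightedDensity U b' k t x) (s := Ioi T)
    rw [← this, hpre]
    have hz' : IntegrableOn (fun t => D.weightedDensity U b k t z * D.jacobian b' T x) (Ioi 0) :=
      (isIntegrableAt_of_mem_regularSet hzr k).integrableOn.mul_const _
    exact hz'.congr_fun (fun t ht => (hF t ht).symm) measurableSet_Ioi
  have hint0 : IntegrableOn (fun t => D.weightedDensity U b' k t x) (Ioi 0) := by
    rw [← Ioc_union_Ioi_eq_Ioi hT]
    exact (((h'.continuous_weightedDensity (hU.continuousOn k) hxD).integrableOn_Icc).mono_set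
      Ioc_subset_Icc_self).union hint
  refine ⟨hint0, ?_⟩
  have e1 : ∫ t in Ioi T, D.weightedDensity U b' k t x =
      D.forwardIntegral U b k z * D.jacobian b' T x := by
    have := hm.setIntegral_preimage_emb (measurableEmbedding_addRight T)
      (fun t => D.weightedDensity U b' k t x) (Ioi T)
    rw [← this, hpre, setIntegral_congr_fun measurableSet_Ioi hF, integral_mul_const,
      forwardIntegral]
  rw [← e1, forwardIntegral, ← intervalIntegral.integral_Ioi_sub_Ioi' hint0 hint]
  ring

/-- If `b'` is a local perturbation of `b` whose trajectories visit the perturbed region during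
uniformly bounded times only, then trajectories starting near a regular point of `b` leave the
perturbed region for good after some time. -/
theorem exists_nhds_avoids (h : D.IsVelocityField b) (h' : D.IsVelocityField b')
    (hU : D.PotentialAssumptions U) {Z K : Set (EuclideanSpace ℝ (Fin d))} (hZ : IsClosed Z)
    (hbb' : ∀ y ∉ Z, b' y = b y) (hK : IsCompact K) (hKr : K ⊆ D.regularSet U b)
    (hZK : Z ⊆ D.translates K) {T : ℝ} (hT0 : 0 ≤ T) (hT : D.IsTransient b' Z T)
    (hx : x ∈ D.regularSet U b) :
    ∃ T' ≥ 0, ∃ N ∈ 𝓝 x, IsOpen N ∧ N ⊆ D.regularSet U b ∧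
      ∀ z ∈ N, ∀ t ≥ T', D.flow b' t z ∉ Z := by
  obtain ⟨r, hr, hball⟩ := Metric.isOpen_iff.1 isOpen_regularSet x hx
  have hN : Metric.closedBall x (r / 2) ⊆ D.regularSet U b :=
    (Metric.closedBall_subset_ball (by linarith)).trans hball
  have hK2 : IsCompact (K ∪ Metric.closedBall x (r / 2)) := hK.union (isCompact_closedBall _ _)
  -- the first visit to `Z` happens before `T2`, as until then the trajectory is one of `b`; all
  -- visits happen within the time `T` after it
  obtain ⟨T2, hT2, htr⟩ := h.exists_isTransient hU hK2 (union_subset hKr hN)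
  refine ⟨T2 + T, by positivity, Metric.ball x (r / 2), Metric.ball_mem_nhds x (by positivity),
    Metric.isOpen_ball, Metric.ball_subset_closedBall.trans hN, fun z hz t ht hmem => ?_⟩
  have hzN := Metric.ball_subset_closedBall hz
  have hzD := regularSet_subset (hN hzN)
  have hZ2 : Z ⊆ D.translates (K ∪ Metric.closedBall x (r / 2)) :=
    hZK.trans (translates_mono subset_union_left)
  obtain ⟨σ, hσ, hσZ, hav⟩ := exists_first_mem (h'.continuous_flow hzD) hZ (by linarith) hmem
  have hσ2 : σ < T2 := by
    by_contra! hge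
    refine htr z (subset_translates _ (Or.inr hzN)) σ hge (hZ2 ?_)
    rwa [h'.flow_eq_of_avoids_Ico h hZ (fun y hy => (hbb' y hy).symm) hzD hσ.1 hav]
  refine hT _ hσZ (t - σ) (by linarith) ?_
  rwa [← h'.flow_add hzD, sub_add_cancel]

/-- Near a regular point of `b` the forward integrals of `b'` are an integral over a bounded interval of
times plus a transported forward integral of `b`, hence finite and continuous. -/
theorem exists_nhds_forwardIntegral (h : D.IsVelocityField b) (h' : D.IsVelocityField b')
    (hU : D.PotentialAssumptions U) {Z K : Set (EuclideanSpace ℝ (Fin d))} (hZ : IsClosed Z)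
    (hbb' : ∀ y ∉ Z, b' y = b y) (hK : IsCompact K) (hKr : K ⊆ D.regularSet U b)
    (hZK : Z ⊆ D.translates K) (hZr : Z ⊆ D.regularSet U b) {T : ℝ} (hT0 : 0 ≤ T)
    (hT : D.IsTransient b' Z T) (hx : x ∈ D.regularSet U b) (k : Fin 2) :
    IntegrableOn (fun t => D.weightedDensity U b' k t x) (Ioi 0) ∧
      ContinuousAt (D.forwardIntegral U b' k) x := by
  obtain ⟨T', hT', N, hN, hNo, hNr, hav⟩ :=
    h.exists_nhds_avoids h' hU hZ hbb' hK hKr hZK hT0 hT hx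
  have key : ∀ z ∈ N, _ := fun z hz =>
    h.forwardIntegral_of_avoids h' hU hZ hbb' hZr (hNr hz) hT' (hav z hz) k
  refine ⟨(key x (mem_of_mem_nhds hN)).1, ?_⟩
  have hND := hNr.trans regularSet_subset
  have hc : ContinuousOn (fun z => (∫ t in (0 : ℝ)..T', D.weightedDensity U b' k t z) +
      D.forwardIntegral U b k (D.flow b' T' z) * D.jacobian b' T' z) N :=
    ((h'.continuousOn_intervalIntegral (hU.continuousOn k) T').mono hND).add
      (((continuousOn_forwardIntegral k).comp ((h'.continuousOn_flow_time T').mono hND)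
        fun z hz => h.flow_mem_regularSet_of_eqOn_compl h' hU hZ hbb' hZr (hNr hz) T').mul
        ((h'.continuousOn_jacobian_time T').mono hND))
  exact (hc.congr fun z hz => (key z hz).2).continuousAt hN

/-- The regular set of `b` is contained in that of a local perturbation `b'` whose trajectories
visit the perturbed region during uniformly bounded times only. -/
theorem regularSet_subset_of_isTransient (h : D.IsVelocityField b) (h' : D.IsVelocityField b')
    (hU : D.PotentialAssumptions U) {Z K : Set (EuclideanSpace ℝ (Fin d))} (hZ : IsClosed Z)
    (hbb' : ∀ y ∉ Z, b' y = b y) (hK : IsCompact K) (hKr : K ⊆ D.regularSet U b)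
    (hZK : Z ⊆ D.translates K) (hZr : Z ⊆ D.regularSet U b) {T : ℝ} (hT0 : 0 ≤ T)
    (hT : D.IsTransient b' Z T) : D.regularSet U b ⊆ D.regularSet U b' := by
  have f := fun x (hx : x ∈ D.regularSet U b) k =>
    h.exists_nhds_forwardIntegral h' hU hZ hbb' hK hKr hZK hZr hT0 hT hx k
  have g := fun x (hx : x ∈ D.regularSet U b) k =>
    h.neg.exists_nhds_forwardIntegral h'.neg hU hZ (fun y hy => by simp [hbb' y hy]) hK
      (by rwa [h.regularSet_neg]) hZK (by rwa [h.regularSet_neg]) hT0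
      (hT.neg h' (hZr.trans regularSet_subset)) (by rwa [h.regularSet_neg] : x ∈ _) k
  refine mem_regularSet_of_isOpen isOpen_regularSet regularSet_subset (fun x hx k => ?_)
    (fun k x hx => (f x hx k).2.continuousWithinAt) (fun k => ?_)
  · refine integrable_of_Ioi_of_Iio (f x hx k).1 ?_
    have := (g x hx k).1
    simp only [h'.weightedDensity_neg_field (regularSet_subset hx)] at this
    exact integrableOn_Ioi_comp_neg.1 this
  · refine ContinuousOn.congr (f := D.forwardIntegral U (-b') k)
      (fun x hx => (g x hx k).2.continuousWithinAt) fun x hx => ?_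
    exact (h'.forwardIntegral_neg_field (regularSet_subset hx) k).symm

end IsVelocityField

end FlowDomain

namespace FlowDomain

variable {d : ℕ} {D : FlowDomain d} {U : Fin 2 → EuclideanSpace ℝ (Fin d) → ℝ}
  {b b' c : EuclideanSpace ℝ (Fin d) → EuclideanSpace ℝ (Fin d)} {x l : EuclideanSpace ℝ (Fin d)}
  {V : Set (EuclideanSpace ℝ (Fin d))}

/-! ### Perturbations by small multiples of a test field -/

theorem add_smul_eq_of_notMem_tsupport (ε : ℝ) (hx : x ∉ tsupport c) :
    (b + ε • c) x = b x := by
  simp [image_eq_zero_of_notMem_tsupport hx]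

theorem neg_add_smul_field (ε : ℝ) : -(b + ε • c) = -b + (-ε) • c := by
  rw [neg_add, neg_smul]

namespace IsTestField

/-- For all sufficiently small `ε`, the trajectories of `b + ε c` visit the support of `c` during
uniformly bounded times only: after the time `T` at which the trajectories of `b` have left a
neighbourhood of the support, the trajectory of `b + ε c` is, up to its next visit to the support,
a trajectory of `b` that started in this neighbourhood at time `0`. -/
theorem exists_isTransient (hc : D.IsTestField V c) (hV : D.IsOpenSubset V)
    (h : D.IsVelocityField b) (hU : D.PotentialAssumptions U) (hVr : V ⊆ D.regularSet U b) :
    ∃ T > 0, ∀ᶠ ε : ℝ in 𝓝 0, D.IsTransient (b + ε • c) (tsupport c) T := by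
  obtain ⟨K, hK, hKc, hcK⟩ := hc.exists_isCompact
  have hKr : K ⊆ D.regularSet U b := hKc.trans (hc.support_subset.trans hVr)
  have hKD := hKr.trans regularSet_subset
  obtain ⟨δ, hδ, hsub, hcpt⟩ := hK.exists_cthickening_subset_isCompact isOpen_regularSet hKr
  obtain ⟨T, hT0, hT⟩ := h.exists_isTransient hU hcpt hsub
  refine ⟨T, hT0, ?_⟩
  have hev : ∀ᶠ ε : ℝ in 𝓝 0, ∀ y ∈ K,
      dist (D.flow b (-T) (D.flow (b + ε • c) T y)) y < δ := by
    refine hK.eventually_forall_of_forall_eventually fun y hy => ?_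
    have hyD := hKD hy
    have h1 : ContinuousAt (fun p : ℝ × EuclideanSpace ℝ (Fin d) =>
        D.flow (b + p.1 • c) T p.2) (0, y) := by
      have h2 : ContinuousOn (fun p : ℝ × EuclideanSpace ℝ (Fin d) =>
          D.flow (b + p.1 • c) T p.2) (univ ×ˢ D.cover) :=
        (hc.continuousOn_flow hV h).comp
          (f := fun p : ℝ × EuclideanSpace ℝ (Fin d) => (p.1, T, p.2)) (by fun_prop)
          fun p hp => ⟨trivial, trivial, hp.2⟩
      exact h2.continuousAt ((isOpen_univ.prod D.isOpen_cover).mem_nhds ⟨trivial, hyD⟩)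
    have h3 : ContinuousAt (D.flow b (-T)) (D.flow (b + (0 : ℝ) • c) T y) :=
      (h.continuousOn_flow_time (-T)).continuousAt
        (D.isOpen_cover.mem_nhds ((hc.isVelocityField hV h 0).flow_mem hyD T))
    have h4 : ContinuousAt (fun p : ℝ × EuclideanSpace ℝ (Fin d) =>
        D.flow b (-T) (D.flow (b + p.1 • c) T p.2)) (0, y) :=
      ContinuousAt.comp (f := fun p : ℝ × EuclideanSpace ℝ (Fin d) =>
        D.flow (b + p.1 • c) T p.2) (x := (0, y)) h3 h1
    refine (h4.dist continuousAt_snd).eventually (gt_mem_nhds ?_)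
    simpa [h.flow_neg_flow hyD] using hδ
  filter_upwards [hev] with ε hε
  have hb' := hc.isVelocityField hV h ε
  intro y hy t ht hmem
  obtain ⟨l, hl, hyK⟩ := hcK y hy
  have hyD : y ∈ D.cover := hV.subset (hc.support_subset hy)
  set z := D.flow (b + ε • c) T (y + l) with hz
  have hzD : z ∈ D.cover := hb'.flow_mem (hKD hyK) T
  have hmem' : D.flow (b + ε • c) (t - T) z ∈ tsupport c := by
    rw [hz, ← hb'.flow_add (hKD hyK), sub_add_cancel, hb'.flow_add_period hl hyD]
    exact (hc.tsupport_add hl).2 hmem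
  obtain ⟨s, hs, hsZ, hav⟩ := exists_first_mem (hb'.continuous_flow hzD)
    (isClosed_tsupport c) (sub_nonneg.2 ht) hmem'
  rw [← hb'.flow_eq_of_avoids_Ico h (isClosed_tsupport c)
    (fun y hy => (add_smul_eq_of_notMem_tsupport ε hy).symm) hzD hs.1 hav] at hsZ
  set y' := D.flow b (-T) z with hy'
  have hy'K : y' ∈ Metric.cthickening δ K :=
    Metric.mem_cthickening_of_dist_le y' (y + l) δ K hyK (hε _ hyK).le
  refine hT y' (subset_translates _ hy'K) (s + T) (by linarith [hs.1]) ?_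
  rw [h.flow_add (h.flow_mem hzD _), h.flow_flow_neg hzD]
  obtain ⟨l', hl', hl'K⟩ := hcK _ hsZ
  exact ⟨l', hl', Metric.self_subset_cthickening _ hl'K⟩

/-- Adding a small multiple of a test field does not make the regular set smaller. -/
theorem eventually_regularSet_subset (hc : D.IsTestField V c) (hV : D.IsOpenSubset V)
    (h : D.IsVelocityField b) (hU : D.PotentialAssumptions U) (hVr : V ⊆ D.regularSet U b) :
    ∀ᶠ ε : ℝ in 𝓝 0, D.regularSet U b ⊆ D.regularSet U (b + ε • c) := by
  obtain ⟨K, hK, hKc, hcK⟩ := hc.exists_isCompact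
  obtain ⟨T, hT0, hT⟩ := hc.exists_isTransient hV h hU hVr
  have hcr := hc.support_subset.trans hVr
  filter_upwards [hT] with ε hε
  exact h.regularSet_subset_of_isTransient (hc.isVelocityField hV h ε) hU (isClosed_tsupport c)
    (fun y hy => add_smul_eq_of_notMem_tsupport ε hy) hK (hKc.trans hcr) hcK hcr hT0.le hε

/-- All small multiples of a test field are admissible perturbations. -/
theorem eventually_mem_infiniteTimeFields (hc : D.IsTestField V c) (hV : D.IsOpenSubset V)
    (hb : b ∈ D.infiniteTimeFields U) (hU : D.PotentialAssumptions U)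
    (hVr : V ⊆ D.regularSet U b) :
    ∀ᶠ ε : ℝ in 𝓝 0, b + ε • c ∈ D.infiniteTimeFields U := by
  filter_upwards [hc.eventually_regularSet_subset hV hb.1 hU hVr] with ε hε
  exact ⟨hc.isVelocityField hV hb.1 ε, measure_mono_null (sdiff_subset_sdiff_right hε) hb.2⟩

theorem continuousOn_flow_time (hc : D.IsTestField V c) (hV : D.IsOpenSubset V)
    (h : D.IsVelocityField b) (T : ℝ) :
    ContinuousOn (fun p : ℝ × EuclideanSpace ℝ (Fin d) => D.flow (b + p.1 • c) T p.2)
      (univ ×ˢ D.cover) :=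
  (hc.continuousOn_flow hV h).comp
    (f := fun p : ℝ × EuclideanSpace ℝ (Fin d) => (p.1, T, p.2)) (by fun_prop)
    fun _ hp => ⟨trivial, trivial, hp.2⟩

theorem continuousOn_jacobian_time (hc : D.IsTestField V c) (hV : D.IsOpenSubset V)
    (h : D.IsVelocityField b) (T : ℝ) :
    ContinuousOn (fun p : ℝ × EuclideanSpace ℝ (Fin d) => D.jacobian (b + p.1 • c) T p.2)
      (univ ×ˢ D.cover) :=
  (hc.continuousOn_jacobian hV h).comp
    (f := fun p : ℝ × EuclideanSpace ℝ (Fin d) => (p.1, T, p.2)) (by fun_prop)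
    fun _ hp => ⟨trivial, trivial, hp.2⟩

theorem continuousOn_intervalIntegral (hc : D.IsTestField V c) (hV : D.IsOpenSubset V)
    (h : D.IsVelocityField b) {k : Fin 2} (hU : ContinuousOn (U k) D.cover) (T : ℝ) :
    ContinuousOn (fun p : ℝ × EuclideanSpace ℝ (Fin d) =>
      ∫ t in (0 : ℝ)..T, D.weightedDensity U (b + p.1 • c) k t p.2) (univ ×ˢ D.cover) := by
  rw [continuousOn_iff_continuous_domRestrict]
  have hcont : Continuous (Function.uncurry
      fun (p : (univ ×ˢ D.cover : Set (ℝ × EuclideanSpace ℝ (Fin d)))) (t : ℝ) =>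
        D.weightedDensity U (b + p.1.1 • c) k t p.1.2) :=
    (hc.continuousOn_weightedDensity hV h hU).comp_continuous
      (f := fun q : (univ ×ˢ D.cover : Set (ℝ × EuclideanSpace ℝ (Fin d))) × ℝ =>
        (q.1.1.1, q.2, q.1.1.2)) (by fun_prop) fun q => ⟨trivial, trivial, q.1.2.2⟩
  exact intervalIntegral.continuous_parametric_intervalIntegral_of_continuous' hcont 0 T

/-- On the support of `c`, the forward integrals of `b + ε c` converge uniformly to those of `b`. -/
theorem eventually_abs_forwardIntegral_sub_lt (hc : D.IsTestField V c) (hV : D.IsOpenSubset V)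
    (h : D.IsVelocityField b) (hU : D.PotentialAssumptions U) (hVr : V ⊆ D.regularSet U b)
    (k : Fin 2) {η : ℝ} (hη : 0 < η) :
    ∀ᶠ ε : ℝ in 𝓝 0, ∀ y ∈ tsupport c,
      |D.forwardIntegral U (b + ε • c) k y - D.forwardIntegral U b k y| < η := by
  obtain ⟨K, hK, hKc, hcK⟩ := hc.exists_isCompact
  obtain ⟨T, hT0, hT⟩ := hc.exists_isTransient hV h hU hVr
  have hcr := hc.support_subset.trans hVr
  -- the forward integral of `b + ε c` at `y` as a function of `(ε, y)`, cut at the time `T` after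
  -- which the support of `c` is not visited
  set Φ : ℝ × EuclideanSpace ℝ (Fin d) → ℝ := fun p =>
    (∫ t in (0 : ℝ)..T, D.weightedDensity U (b + p.1 • c) k t p.2) +
      D.forwardIntegral U b k (D.flow (b + p.1 • c) T p.2) * D.jacobian (b + p.1 • c) T p.2
    with hΦ
  have hsub : (univ ×ˢ D.regularSet U b : Set (ℝ × EuclideanSpace ℝ (Fin d))) ⊆
      univ ×ˢ D.cover := prod_mono_right regularSet_subset
  have hΦc : ContinuousOn Φ (univ ×ˢ D.regularSet U b) :=
    ((hc.continuousOn_intervalIntegral hV h (hU.continuousOn k) T).mono hsub).add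
      (((continuousOn_forwardIntegral k).comp ((hc.continuousOn_flow_time hV h T).mono hsub)
        fun p hp => h.flow_mem_regularSet_of_eqOn_compl (hc.isVelocityField hV h p.1) hU
          (isClosed_tsupport c) (fun y hy => add_smul_eq_of_notMem_tsupport p.1 hy) hcr hp.2 T).mul
        ((hc.continuousOn_jacobian_time hV h T).mono hsub))
  have hev : ∀ᶠ ε : ℝ in 𝓝 0, ∀ y ∈ K, |Φ (ε, y) - D.forwardIntegral U b k y| < η := by
    refine hK.eventually_forall_of_forall_eventually (P := fun ε y =>
      |Φ (ε, y) - D.forwardIntegral U b k y| < η) fun y hy => ?_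
    have hyr := hcr (hKc hy)
    have h1 : ContinuousAt Φ (0, y) :=
      hΦc.continuousAt ((isOpen_univ.prod isOpen_regularSet).mem_nhds ⟨trivial, hyr⟩)
    have h2 : ContinuousAt (D.forwardIntegral U b k) y :=
      (continuousOn_forwardIntegral k).continuousAt (isOpen_regularSet.mem_nhds hyr)
    have h3 : ContinuousAt (fun p : ℝ × EuclideanSpace ℝ (Fin d) => D.forwardIntegral U b k p.2)
        (0, y) := ContinuousAt.comp (f := Prod.snd) (g := D.forwardIntegral U b k) (x := ((0 : ℝ), y)) h2
          continuousAt_snd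
    refine (h1.sub h3).abs.eventually (gt_mem_nhds ?_)
    have := h.forwardIntegral_flow_mul' (regularSet_subset hyr)
      (isIntegrableAt_of_mem_regularSet hyr k) T
    simp only [hΦ, Pi.sub_apply, zero_smul, add_zero]
    rw [this]
    simpa using hη
  filter_upwards [hev, hT] with ε hε hTε y hy
  obtain ⟨l, hl, hyK⟩ := hcK y hy
  have hb' := hc.isVelocityField hV h ε
  have hyD := regularSet_subset (hcr hy)
  have := hε _ hyK
  simp only [hΦ] at this
  rwa [← (h.forwardIntegral_of_avoids hb' hU (isClosed_tsupport c)
    (fun y hy => add_smul_eq_of_notMem_tsupport ε hy) hcr (hcr (hKc hyK)) hT0.le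
    (hTε _ (hKc hyK)) k).2, hb'.forwardIntegral_add_period hU.periodic hl hyD,
    h.forwardIntegral_add_period hU.periodic hl hyD] at this

/-- A continuous periodic function is bounded on the support of a test field. -/
theorem exists_forall_abs_le (hc : D.IsTestField V c) {f : EuclideanSpace ℝ (Fin d) → ℝ}
    (hf : ContinuousOn f (tsupport c))
    (hfp : ∀ l ∈ D.periods, ∀ x ∈ tsupport c, f (x + l) = f x) :
    ∃ C ≥ 0, ∀ x ∈ tsupport c, |f x| ≤ C := by
  obtain ⟨K, hK, hKc, hcK⟩ := hc.exists_isCompact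
  obtain ⟨C, hC⟩ := hK.exists_bound_of_continuousOn (hf.mono hKc)
  refine ⟨max C 0, le_max_right _ _, fun x hx => ?_⟩
  obtain ⟨l, hl, hxK⟩ := hcK x hx
  rw [← hfp l hl x hx]
  exact (hC _ hxK).trans (le_max_left _ _)

theorem volume_cell_inter_tsupport_lt_top (hc : D.IsTestField V c) :
    volume (D.cell ∩ tsupport c) < ⊤ := by
  cases D with
  | euclidean Ω _ _ _ =>
    obtain ⟨K, hK, hcK⟩ := hc.compact_support
    refine (measure_mono ?_).trans_lt hK.measure_lt_top
    rintro x ⟨-, hx⟩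
    obtain ⟨l, hl, hxK⟩ := hcK x hx
    have : l = 0 := by simpa [periods] using hl
    simpa [this] using hxK
  | torus v =>
    exact (measure_mono inter_subset_left).trans_lt
      (ZSpan.fundamentalDomain_isBounded v).measure_lt_top

end IsTestField

/-! ### Integrals along trajectories of functions supported in a transient set -/

namespace IsTransient

variable {Z : Set (EuclideanSpace ℝ (Fin d))} {T : ℝ}

theorem exists_Icc (hT : D.IsTransient b Z T) (h : D.IsVelocityField b) (hx : x ∈ D.cover) :
    ∃ s₀, ∀ s, D.flow b s x ∈ Z → s ∈ Icc (s₀ - T) (s₀ + T) := by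
  by_cases hex : ∃ s, D.flow b s x ∈ Z
  · obtain ⟨s₀, hs₀⟩ := hex
    refine ⟨s₀, fun s hs => ?_⟩
    have key : ∀ r r', D.flow b r x ∈ Z → D.flow b r' x ∈ Z → r' - r ≤ T := by
      intro r r' hr hr'
      by_contra! hlt
      refine hT _ hr (r' - r) hlt.le ?_
      rwa [← h.flow_add hx, sub_add_cancel]
    constructor <;> linarith [key s s₀ hs hs₀, key s₀ s hs₀ hs]
  · push Not at hex
    exact ⟨0, fun s hs => absurd hs (hex s)⟩

theorem integrable_comp_flow (hT : D.IsTransient b Z T) (h : D.IsVelocityField b)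
    (hx : x ∈ D.cover) {q : EuclideanSpace ℝ (Fin d) → ℝ} (hq : Continuous q)
    (hqZ : ∀ y ∉ Z, q y = 0) : Integrable fun s => q (D.flow b s x) := by
  obtain ⟨s₀, hs₀⟩ := hT.exists_Icc h hx
  have hc : Continuous fun s => q (D.flow b s x) := hq.comp (h.continuous_flow hx)
  refine (integrableOn_iff_integrable_of_support_subset (s := Icc (s₀ - T) (s₀ + T))
    fun s hs => hs₀ s ?_).1 hc.integrableOn_Icc
  by_contra hmem
  exact hs (hqZ _ hmem)

theorem lintegral_comp_flow_le (hT : D.IsTransient b Z T)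
    (h : D.IsVelocityField b) (hx : x ∈ D.cover)
    {q : EuclideanSpace ℝ (Fin d) → ℝ} (hqZ : ∀ y ∉ Z, q y = 0) {C : ℝ} (hC0 : 0 ≤ C)
    (hC : ∀ y, |q y| ≤ C) (I : Set ℝ) :
    ∫⁻ s in I, ‖q (D.flow b s x)‖ₑ ≤ ENNReal.ofReal (C * (2 * T)) := by
  obtain ⟨s₀, hs₀⟩ := hT.exists_Icc h hx
  calc ∫⁻ s in I, ‖q (D.flow b s x)‖ₑ ≤ ∫⁻ s, ‖q (D.flow b s x)‖ₑ :=
        setLIntegral_le_lintegral _ _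
    _ ≤ ∫⁻ s, (Icc (s₀ - T) (s₀ + T)).indicator (fun _ => ENNReal.ofReal C) s := by
        refine lintegral_mono fun s => ?_
        by_cases hs : s ∈ Icc (s₀ - T) (s₀ + T)
        · rw [indicator_of_mem hs, ← ofReal_norm]
          exact ENNReal.ofReal_le_ofReal (hC _)
        · rw [indicator_of_notMem hs, hqZ _ fun hmem => hs (hs₀ s hmem)]
          simp
    _ = ENNReal.ofReal (C * (2 * T)) := by
        rw [lintegral_indicator_const measurableSet_Icc, Real.volume_Icc,
          ← ENNReal.ofReal_mul hC0]
        congr 2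
        ring

theorem abs_integral_comp_flow_le (hT : D.IsTransient b Z T) (hT0 : 0 ≤ T)
    (h : D.IsVelocityField b) (hx : x ∈ D.cover)
    {q : EuclideanSpace ℝ (Fin d) → ℝ} (hqZ : ∀ y ∉ Z, q y = 0) {C : ℝ} (hC0 : 0 ≤ C)
    (hC : ∀ y, |q y| ≤ C) (I : Set ℝ) :
    |∫ s in I, q (D.flow b s x)| ≤ C * (2 * T) := by
  have h1 := (enorm_integral_le_lintegral_enorm (μ := volume.restrict I)
    (fun s => q (D.flow b s x))).trans (hT.lintegral_comp_flow_le h hx hqZ hC0 hC I)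
  rw [← ofReal_norm] at h1
  exact (ENNReal.ofReal_le_ofReal_iff (by positivity)).1 h1

end IsTransient

end FlowDomain

namespace FlowDomain

variable {d : ℕ} {D : FlowDomain d} {U : Fin 2 → EuclideanSpace ℝ (Fin d) → ℝ}
  {b b' c : EuclideanSpace ℝ (Fin d) → EuclideanSpace ℝ (Fin d)} {x l : EuclideanSpace ℝ (Fin d)}
  {V : Set (EuclideanSpace ℝ (Fin d))} {ε : ℝ}

/-! ### Transporting the estimator to a perturbed flow -/

/-- The derivative `∇A · c` of the estimator in the direction of the vector field `c`. -/
noncomputable def estimatorDerivAlong (D : FlowDomain d)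
    (U : Fin 2 → EuclideanSpace ℝ (Fin d) → ℝ)
    (b c : EuclideanSpace ℝ (Fin d) → EuclideanSpace ℝ (Fin d))
    (x : EuclideanSpace ℝ (Fin d)) : ℝ :=
  fderiv ℝ (D.estimator U b) x (c x)

/-- The integral of `∇A · c` over the past of the trajectory of `b + ε c` through `x`. Times `ε`,
this is the change of `A` along this trajectory up to the point `x`. -/
noncomputable def estimatorDrift (D : FlowDomain d)
    (U : Fin 2 → EuclideanSpace ℝ (Fin d) → ℝ)
    (b c : EuclideanSpace ℝ (Fin d) → EuclideanSpace ℝ (Fin d)) (ε : ℝ)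
    (x : EuclideanSpace ℝ (Fin d)) : ℝ :=
  ∫ s in Iio (0 : ℝ), D.estimatorDerivAlong U b c (D.flow (b + ε • c) s x)

/-- The function that is constant along the trajectories of `b + ε c` and agrees with the estimator
of `b` at points whose past under `b + ε c` does not meet the support of `c`. -/
noncomputable def transportedEstimator (D : FlowDomain d)
    (U : Fin 2 → EuclideanSpace ℝ (Fin d) → ℝ)
    (b c : EuclideanSpace ℝ (Fin d) → EuclideanSpace ℝ (Fin d)) (ε : ℝ)
    (x : EuclideanSpace ℝ (Fin d)) : ℝ :=
  D.estimator U b x - ε * D.estimatorDrift U b c ε x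

theorem estimatorDerivAlong_of_notMem (hx : x ∉ tsupport c) :
    D.estimatorDerivAlong U b c x = 0 := by
  simp [estimatorDerivAlong, image_eq_zero_of_notMem_tsupport hx]

namespace IsTestField

theorem isPeriodic_estimatorDerivAlong (hc : D.IsTestField V c) (h : D.IsVelocityField b)
    (hU : D.PotentialAssumptions U) : D.IsPeriodic (D.estimatorDerivAlong U b c) := by
  intro l hl x
  rw [estimatorDerivAlong, estimatorDerivAlong, hc.periodic l hl, ← fderiv_comp_add_right]
  congr 2
  funext y
  rw [isPeriodic_estimator hU h l hl]

theorem continuous_estimatorDerivAlong (hc : D.IsTestField V c) (hV : D.IsOpenSubset V)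
    (hA : ContDiffOn ℝ 1 (D.estimator U b) V) : Continuous (D.estimatorDerivAlong U b c) := by
  rw [continuous_iff_continuousAt]
  intro x
  by_cases hx : x ∈ tsupport c
  · have h1 : ContinuousAt (fderiv ℝ (D.estimator U b)) x :=
      (hA.continuousOn_fderiv_of_isOpen hV.isOpen le_rfl).continuousAt
        (hV.isOpen.mem_nhds (hc.support_subset hx))
    exact h1.clm_apply hc.smooth.continuous.continuousAt
  · have : D.estimatorDerivAlong U b c =ᶠ[𝓝 x] fun _ => 0 := by
      filter_upwards [(isClosed_tsupport c).isOpen_compl.mem_nhds hx] with y hy using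
        estimatorDerivAlong_of_notMem hy
    exact continuousAt_const.congr this.symm

theorem exists_abs_estimatorDerivAlong_le (hc : D.IsTestField V c) (hV : D.IsOpenSubset V)
    (h : D.IsVelocityField b) (hU : D.PotentialAssumptions U)
    (hA : ContDiffOn ℝ 1 (D.estimator U b) V) :
    ∃ C ≥ 0, ∀ x, |D.estimatorDerivAlong U b c x| ≤ C := by
  obtain ⟨C, hC0, hC⟩ := hc.exists_forall_abs_le
    (hc.continuous_estimatorDerivAlong hV hA).continuousOn
    fun l hl x _ => hc.isPeriodic_estimatorDerivAlong h hU l hl x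
  refine ⟨C, hC0, fun x => ?_⟩
  by_cases hx : x ∈ tsupport c
  · exact hC x hx
  · rwa [estimatorDerivAlong_of_notMem hx, abs_zero]

/-- Off the support of `c` the flows of `b` and `b + ε c` agree for a short time. -/
theorem eventually_flow_eq (hc : D.IsTestField V c) (hV : D.IsOpenSubset V)
    (h : D.IsVelocityField b) (ε : ℝ) (hx : x ∈ D.cover) (hxc : x ∉ tsupport c) :
    ∀ᶠ s in 𝓝 (0 : ℝ), D.flow (b + ε • c) s x = D.flow b s x ∧
      D.jacobian (b + ε • c) s x = D.jacobian b s x := by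
  have h' := hc.isVelocityField hV h ε
  have hopen : (fun r => D.flow b r x) ⁻¹' (tsupport c)ᶜ ∈ 𝓝 (0 : ℝ) := by
    refine (h.continuous_flow hx).continuousAt.preimage_mem_nhds
      ((isClosed_tsupport c).isOpen_compl.mem_nhds ?_)
    rwa [h.flow_zero hx]
  obtain ⟨δ, hδ, hball⟩ := Metric.mem_nhds_iff.1 hopen
  filter_upwards [Metric.ball_mem_nhds 0 hδ] with s hs
  refine h.flow_eq_of_avoids h' (isClosed_tsupport c)
    (fun y hy => add_smul_eq_of_notMem_tsupport ε hy) hx fun r hr => hball ?_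
  rw [Metric.mem_ball, Real.dist_eq, sub_zero] at hs ⊢
  rw [mem_uIcc] at hr
  rw [abs_lt] at hs ⊢
  rcases hr with hr | hr <;> constructor <;> linarith [hr.1, hr.2, hs.1, hs.2]

/-- Along trajectories of `b + ε c` the estimator of `b` changes at the rate `ε ∇A · c`. -/
theorem hasDerivAt_estimator_flow (hc : D.IsTestField V c) (hV : D.IsOpenSubset V)
    (h : D.IsVelocityField b) (hA : ContDiffOn ℝ 1 (D.estimator U b) V) (ε : ℝ)
    (hx : x ∈ D.cover) (τ : ℝ) :
    HasDerivAt (fun s => D.estimator U b (D.flow (b + ε • c) s x))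
      (ε * D.estimatorDerivAlong U b c (D.flow (b + ε • c) τ x)) τ := by
  have h' := hc.isVelocityField hV h ε
  set y := D.flow (b + ε • c) τ x with hy
  have hyD : y ∈ D.cover := h'.flow_mem hx τ
  by_cases hyV : y ∈ V
  · have hd : HasFDerivAt (D.estimator U b) (fderiv ℝ (D.estimator U b) y) y :=
      ((hA.contDiffAt (hV.isOpen.mem_nhds hyV)).differentiableAt one_ne_zero).hasFDerivAt
    have h1 := HasFDerivAt.comp_hasDerivAt τ hd (h'.hasDerivAt_flow hx τ)
    have h2 : fderiv ℝ (D.estimator U b) y (b y) = 0 := by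
      have hd0 : HasFDerivAt (D.estimator U b) (fderiv ℝ (D.estimator U b) y)
          (D.flow b 0 y) := by rwa [h.flow_zero hyD]
      have h3 := HasFDerivAt.comp_hasDerivAt (0 : ℝ) hd0 (h.hasDerivAt_flow hyD 0)
      rw [h.flow_zero hyD] at h3
      have h4 : D.estimator U b ∘ (fun s => D.flow b s y) = fun _ => D.estimator U b y := by
        funext s
        exact h.estimator_flow hyD s
      rw [h4] at h3
      exact h3.unique (hasDerivAt_const _ _)
    have e : fderiv ℝ (D.estimator U b) y ((b + ε • c) y) =
        ε * D.estimatorDerivAlong U b c y := by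
      simp [estimatorDerivAlong, h2]
    rw [e] at h1
    exact h1
  · -- near `τ` the trajectory is a trajectory of `b`, along which the estimator is constant
    have hyc : y ∉ tsupport c := fun hmem => hyV (hc.support_subset hmem)
    rw [estimatorDerivAlong_of_notMem hyc, mul_zero]
    refine (hasDerivAt_const τ (D.estimator U b y)).congr_of_eventuallyEq ?_
    have hlim : Tendsto (fun s => s - τ) (𝓝 τ) (𝓝 0) := by
      simpa using (continuous_id.sub continuous_const).tendsto (f := fun s => s - τ) τ
    filter_upwards [hlim.eventually (hc.eventually_flow_eq hV h ε hyD hyc)] with s hs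
    have e : D.flow (b + ε • c) s x = D.flow (b + ε • c) (s - τ) y := by
      rw [hy, ← h'.flow_add hx, sub_add_cancel]
    rw [e, hs.1, h.estimator_flow hyD]

theorem isPeriodic_estimatorDrift (hc : D.IsTestField V c) (hV : D.IsOpenSubset V)
    (h : D.IsVelocityField b) (hU : D.PotentialAssumptions U) (ε : ℝ) :
    D.IsPeriodic (D.estimatorDrift U b c ε) := by
  refine isPeriodic_of_forall_cover fun l hl x hx => ?_
  simp only [estimatorDrift, (hc.isVelocityField hV h ε).flow_add_period hl hx,
    hc.isPeriodic_estimatorDerivAlong h hU l hl]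

theorem measurableOnCover_estimatorDrift (hc : D.IsTestField V c) (hV : D.IsOpenSubset V)
    (h : D.IsVelocityField b) (hA : ContDiffOn ℝ 1 (D.estimator U b) V) (ε : ℝ) :
    D.MeasurableOnCover (D.estimatorDrift U b c ε) := by
  have h1 := (hc.isVelocityField hV h ε).measurable_comp_flow
    (measurableOnCover_of_continuousOn (D := D)
      (hc.continuous_estimatorDerivAlong hV hA).continuousOn)
  exact (h1.stronglyMeasurable.integral_prod_right'
    (ν := volume.restrict (Iio (0 : ℝ)))).measurable

theorem isPeriodic_transportedEstimator (hc : D.IsTestField V c) (hV : D.IsOpenSubset V)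
    (h : D.IsVelocityField b) (hU : D.PotentialAssumptions U) (ε : ℝ) :
    D.IsPeriodic (D.transportedEstimator U b c ε) := by
  intro l hl x
  rw [transportedEstimator, transportedEstimator, isPeriodic_estimator hU h l hl,
    hc.isPeriodic_estimatorDrift hV h hU ε l hl]

theorem measurableOnCover_transportedEstimator (hc : D.IsTestField V c) (hV : D.IsOpenSubset V)
    (h : D.IsVelocityField b) (hU : D.PotentialAssumptions U)
    (hA : ContDiffOn ℝ 1 (D.estimator U b) V) (ε : ℝ) :
    D.MeasurableOnCover (D.transportedEstimator U b c ε) :=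
  Measurable.sub (h.measurableOnCover_estimator hU)
    (Measurable.const_mul (hc.measurableOnCover_estimatorDrift hV h hA ε) ε)

/-- The transported estimator is constant along the trajectories of `b + ε c`. -/
theorem transportedEstimator_flow (hc : D.IsTestField V c) (hV : D.IsOpenSubset V)
    (h : D.IsVelocityField b) (hA : ContDiffOn ℝ 1 (D.estimator U b) V) {T : ℝ}
    (hT : D.IsTransient (b + ε • c) (tsupport c) T) (hx : x ∈ D.cover) (τ : ℝ) :
    D.transportedEstimator U b c ε (D.flow (b + ε • c) τ x) =
      D.transportedEstimator U b c ε x := by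
  have h' := hc.isVelocityField hV h ε
  have hq := hc.continuous_estimatorDerivAlong hV hA
  set q := D.estimatorDerivAlong U b c with hqdef
  have hint := hT.integrable_comp_flow h' hx hq fun y hy => estimatorDerivAlong_of_notMem hy
  have hqc : Continuous fun s => q (D.flow (b + ε • c) s x) := hq.comp (h'.continuous_flow hx)
  have h1 : D.estimator U b (D.flow (b + ε • c) τ x) - D.estimator U b x =
      ε * ∫ s in (0 : ℝ)..τ, q (D.flow (b + ε • c) s x) := by
    rw [← intervalIntegral.integral_const_mul, intervalIntegral.integral_eq_sub_of_hasDerivAt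
      (fun s _ => hc.hasDerivAt_estimator_flow hV h hA ε hx s)
      ((hqc.const_mul ε).intervalIntegrable _ _), h'.flow_zero hx]
  have h2 : D.estimatorDrift U b c ε (D.flow (b + ε • c) τ x) - D.estimatorDrift U b c ε x =
      ∫ s in (0 : ℝ)..τ, q (D.flow (b + ε • c) s x) := by
    rw [estimatorDrift, estimatorDrift, ← intervalIntegral.integral_Iic_sub_Iic
      hint.integrableOn hint.integrableOn, integral_Iic_eq_integral_Iio,
      integral_Iic_eq_integral_Iio]
    congr 1
    simp only [← h'.flow_add hx]
    have hm : MeasurePreserving (fun t : ℝ => t + τ) volume volume :=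
      measurePreserving_add_right volume τ
    have := hm.setIntegral_preimage_emb (measurableEmbedding_addRight τ)
      (fun s => q (D.flow (b + ε • c) s x)) (Iio τ)
    rw [← this]
    congr 2
    ext
    simp
  rw [transportedEstimator, transportedEstimator]
  linear_combination h1 - ε * h2

end IsTestField

/-! ### The expansion of the second moment -/

theorem PotentialAssumptions.integrable_baseMeasure_iff (hU : D.PotentialAssumptions U)
    {f : EuclideanSpace ℝ (Fin d) → ℝ} :
    Integrable f (D.baseMeasure U) ↔
      IntegrableOn (fun x => Real.exp (-U 0 x) * f x) D.cell := by
  rw [baseMeasure, integrable_withDensity_iff_integrable_smul₀' hU.aemeasurable_density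
    (Eventually.of_forall fun x => ENNReal.ofReal_lt_top)]
  simp only [ENNReal.toReal_ofReal (Real.exp_pos _).le, smul_eq_mul]
  rfl

theorem IsVelocityField.measurableOnCover_forwardIntegral (h : D.IsVelocityField b)
    (hU : D.PotentialAssumptions U) (k : Fin 2) :
    D.MeasurableOnCover (D.forwardIntegral U b k) := by
  have hcont : Continuous fun p : D.cover × ℝ => D.weightedDensity U b k p.2 p.1 :=
    (h.continuousOn_weightedDensity (hU.continuousOn k)).comp_continuous
      (f := fun p : D.cover × ℝ => (p.2, (p.1 : EuclideanSpace ℝ (Fin d)))) (by fun_prop)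
      fun p => ⟨trivial, p.1.2⟩
  exact (hcont.stronglyMeasurable.integral_prod_right'
    (ν := volume.restrict (Ioi (0 : ℝ)))).measurable

namespace IsTestField

theorem memLp_estimatorDrift (hc : D.IsTestField V c) (hV : D.IsOpenSubset V)
    (h : D.IsVelocityField b) (hU : D.PotentialAssumptions U)
    (hA : ContDiffOn ℝ 1 (D.estimator U b) V) {T : ℝ} (hT0 : 0 ≤ T)
    (hT : D.IsTransient (b + ε • c) (tsupport c) T) :
    MemLp (D.estimatorDrift U b c ε) 2 (D.baseMeasure U) := by
  have := hU.isProbabilityMeasure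
  obtain ⟨C, hC0, hC⟩ := hc.exists_abs_estimatorDerivAlong_le hV h hU hA
  refine MemLp.of_bound (hc.measurableOnCover_estimatorDrift hV h hA
    ε).aemeasurable_base.aestronglyMeasurable (C * (2 * T)) (ae_base_of_ae_cell ?_)
  filter_upwards [D.ae_mem_cell] with x hx
  exact hT.abs_integral_comp_flow_le hT0 (hc.isVelocityField hV h ε) (D.cell_subset_cover hx)
    (fun y hy => estimatorDerivAlong_of_notMem hy) hC0 hC _

/-- Mass transport turns integrals of the drift into integrals over the support of `c`. -/
theorem integral_mul_estimatorDrift (hc : D.IsTestField V c) (hV : D.IsOpenSubset V)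
    (h : D.IsVelocityField b) (hU : D.PotentialAssumptions U)
    (hA : ContDiffOn ℝ 1 (D.estimator U b) V) {T : ℝ}
    (hT : D.IsTransient (b + ε • c) (tsupport c) T)
    {p : EuclideanSpace ℝ (Fin d) → ℝ} (hp : D.IsPeriodic p) (hpm : D.MeasurableOnCover p)
    (hpi : IntegrableOn p D.cell) :
    ∫ x in D.cell, p x * D.estimatorDrift U b c ε x =
      ∫ y in D.cell, D.estimatorDerivAlong U b c y *
        ∫ s in Ioi (0 : ℝ), p (D.flow (b + ε • c) s y) * D.jacobian (b + ε • c) s y := by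
  have h' := hc.isVelocityField hV h ε
  obtain ⟨C, hC0, hC⟩ := hc.exists_abs_estimatorDerivAlong_le hV h hU hA
  refine h'.integral_transport hp (hc.isPeriodic_estimatorDerivAlong h hU) hpm
    (measurableOnCover_of_continuousOn
      (hc.continuous_estimatorDerivAlong hV hA).continuousOn) (ne_of_lt ?_)
  calc ∫⁻ x in D.cell, ‖p x‖ₑ * ∫⁻ s in Iio (0 : ℝ),
        ‖D.estimatorDerivAlong U b c (D.flow (b + ε • c) s x)‖ₑ
      ≤ ∫⁻ x in D.cell, ‖p x‖ₑ * ENNReal.ofReal (C * (2 * T)) := by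
        refine lintegral_mono_ae ?_
        filter_upwards [D.ae_mem_cell] with x hx
        exact mul_le_mul_right (hT.lintegral_comp_flow_le h' (D.cell_subset_cover hx)
          (fun y hy => estimatorDerivAlong_of_notMem hy) hC0 hC _) _
    _ = (∫⁻ x in D.cell, ‖p x‖ₑ) * ENNReal.ofReal (C * (2 * T)) :=
        lintegral_mul_const'' _ hpi.1.enorm
    _ < ⊤ := ENNReal.mul_lt_top hpi.2 ENNReal.ofReal_lt_top

/-- The transported estimator `Ã = A - ε I` and the estimator of `b + ε c` are constant along the
trajectories of `b + ε c`, so that `E₀[Ã A_{b + ε c}] = E₀[Ã w]`; hence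
`M(b + ε c) = 2 E₀[Ã w] - E₀[Ã²] + E₀[(A_{b + ε c} - Ã)²]`. The terms that are linear in `I` are
computed by transporting mass along trajectories. -/
theorem secondMoment_add_smul (hc : D.IsTestField V c) (hV : D.IsOpenSubset V)
    (hb : b ∈ D.infiniteTimeFields U) (hU : D.PotentialAssumptions U)
    (hA : ContDiffOn ℝ 1 (D.estimator U b) V) {T : ℝ} (hT0 : 0 ≤ T)
    (hT : D.IsTransient (b + ε • c) (tsupport c) T)
    (hb' : b + ε • c ∈ D.infiniteTimeFields U) :
    D.secondMoment U (b + ε • c) = D.secondMoment U b +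
      2 * ε * ((∫ y in D.cell, D.estimatorDerivAlong U b c y *
          (D.transportedEstimator U b c ε y * D.forwardIntegral U (b + ε • c) 0 y)) -
        ∫ y in D.cell, D.estimatorDerivAlong U b c y * D.forwardIntegral U (b + ε • c) 1 y) +
      ε ^ 2 * (∫ x, D.estimatorDrift U b c ε x ^ 2 ∂(D.baseMeasure U)) +
      ∫ x, (D.estimator U (b + ε • c) x - D.transportedEstimator U b c ε x) ^ 2
        ∂(D.baseMeasure U) := by
  have := hU.isProbabilityMeasure
  have h := hb.1
  have h' := hb'.1
  set μ := D.baseMeasure U with hμ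
  set A := D.estimator U b with hAdef
  set A' := D.estimator U (b + ε • c) with hA'def
  set I := D.estimatorDrift U b c ε with hIdef
  set At := D.transportedEstimator U b c ε with hAtdef
  set w := likelihoodRatio U with hwdef
  have mA : MemLp A 2 μ := memLp_estimator hU hb
  have mA' : MemLp A' 2 μ := memLp_estimator hU hb'
  have mI : MemLp I 2 μ := hc.memLp_estimatorDrift hV h hU hA hT0 hT
  have mw : MemLp w 2 μ := hU.memLp_likelihoodRatio
  have mAt : MemLp At 2 μ := mA.sub (mI.const_mul ε)
  have prod : ∀ {f g : EuclideanSpace ℝ (Fin d) → ℝ}, MemLp f 2 μ → MemLp g 2 μ →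
      Integrable (fun x => f x * g x) μ := fun hf hg => hf.integrable_mul hg
  have sqi : ∀ {f : EuclideanSpace ℝ (Fin d) → ℝ}, MemLp f 2 μ →
      Integrable (fun x => f x ^ 2) μ := fun hf => hf.integrable_sq
  have hAt : ∀ x, A x = At x + ε * I x := fun x => by
    simp only [hAtdef, transportedEstimator]
    ring
  have hAtp := hc.isPeriodic_transportedEstimator hV h hU ε
  have hAtm := hc.measurableOnCover_transportedEstimator hV h hU hA ε
  have e1 : ∫ x, (A' x - At x) ^ 2 ∂μ =
      (∫ x, A' x ^ 2 ∂μ) - 2 * (∫ x, At x * A' x ∂μ) + ∫ x, At x ^ 2 ∂μ := by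
    have i1 : Integrable (fun x => A' x ^ 2 - 2 * (At x * A' x)) μ :=
      (sqi mA').sub ((prod mAt mA').const_mul 2)
    rw [← integral_const_mul, ← integral_sub (sqi mA') ((prod mAt mA').const_mul 2),
      ← integral_add i1 (sqi mAt)]
    exact integral_congr_ae (Eventually.of_forall fun x => by simp only; ring)
  have e2 : ∫ x, At x * A' x ∂μ = ∫ x, At x * w x ∂μ :=
    integral_mul_estimator hU hb' hAtp hAtm
      (fun x hx s => hc.transportedEstimator_flow hV h hA hT hx s) mAt
  have e3 : ∫ x, A x ^ 2 ∂μ = (∫ x, At x ^ 2 ∂μ) + 2 * ε * (∫ x, At x * I x ∂μ) +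
      ε ^ 2 * ∫ x, I x ^ 2 ∂μ := by
    have i1 : Integrable (fun x => At x ^ 2 + 2 * ε * (At x * I x)) μ :=
      (sqi mAt).add ((prod mAt mI).const_mul _)
    rw [← integral_const_mul, ← integral_const_mul,
      ← integral_add (sqi mAt) ((prod mAt mI).const_mul _),
      ← integral_add i1 ((sqi mI).const_mul _)]
    exact integral_congr_ae (Eventually.of_forall fun x => by simp only [hAt x]; ring)
  have e4 : ∫ x, A x ^ 2 ∂μ = (∫ x, At x * w x ∂μ) + ε * ∫ x, I x * w x ∂μ := by
    have := integral_mul_estimator hU hb (isPeriodic_estimator hU h)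
      (h.measurableOnCover_estimator hU) (fun x hx s => h.estimator_flow hx s) mA
    rw [← integral_const_mul, ← integral_add (prod mAt mw) ((prod mI mw).const_mul _)]
    calc ∫ x, A x ^ 2 ∂μ = ∫ x, A x * A x ∂μ := by simp only [sq]
      _ = ∫ x, A x * w x ∂μ := this
      _ = _ := integral_congr_ae (Eventually.of_forall fun x => by simp only [hAt x]; ring)
  have e5 : ∫ x, At x * I x ∂μ = ∫ y in D.cell, D.estimatorDerivAlong U b c y *
      (At y * D.forwardIntegral U (b + ε • c) 0 y) := by
    rw [hμ, integral_baseMeasure hU]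
    have hi : IntegrableOn (fun x => Real.exp (-U 0 x) * At x) D.cell :=
      hU.integrable_baseMeasure_iff.1 (mAt.integrable one_le_two)
    have hpm : D.MeasurableOnCover fun x => Real.exp (-U 0 x) * At x :=
      Measurable.mul (hU.measurableOnCover_exp 0) hAtm
    have := hc.integral_mul_estimatorDrift hV h hU hA hT
      (fun l hl x => by simp only [hU.periodic 0 l hl x, hAtp l hl x, hAtdef]) hpm hi
    simp only [← mul_assoc]
    rw [this]
    refine setIntegral_congr_fun D.measurableSet_cell fun y hy => ?_
    have hyD := D.cell_subset_cover hy
    simp only [hAtdef, hc.transportedEstimator_flow hV h hA hT hyD]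
    rw [mul_assoc]
    congr 1
    rw [forwardIntegral, ← integral_const_mul]
    refine integral_congr_ae (Eventually.of_forall fun s => ?_)
    simp only [weightedDensity]
    ring
  have e6 : ∫ x, I x * w x ∂μ = ∫ y in D.cell, D.estimatorDerivAlong U b c y *
      D.forwardIntegral U (b + ε • c) 1 y := by
    rw [hμ, integral_baseMeasure hU]
    have := hc.integral_mul_estimatorDrift hV h hU hA hT (p := fun x => Real.exp (-U 1 x))
      (fun l hl x => by simp only [hU.periodic 1 l hl x]) (hU.measurableOnCover_exp 1)
      hU.integrable
    calc ∫ x in D.cell, Real.exp (-U 0 x) * (I x * w x)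
        = ∫ x in D.cell, Real.exp (-U 1 x) * I x := by
          refine integral_congr_ae (Eventually.of_forall fun x => ?_)
          simp only
          rw [← exp_mul_likelihoodRatio]
          ring
      _ = _ := this
  rw [secondMoment, secondMoment, ← e5, ← e6]
  linear_combination -e1 + 2 * e2 + e3 - 2 * e4

end IsTestField

end FlowDomain

namespace FlowDomain

variable {d : ℕ} {D : FlowDomain d} {U : Fin 2 → EuclideanSpace ℝ (Fin d) → ℝ}
  {b b' c : EuclideanSpace ℝ (Fin d) → EuclideanSpace ℝ (Fin d)} {x l : EuclideanSpace ℝ (Fin d)}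
  {V : Set (EuclideanSpace ℝ (Fin d))} {ε : ℝ}

/-! ### The linear term of the expansion -/

/-- The coefficient of `2 ε` in the expansion of the second moment. -/
noncomputable def momentSlope (D : FlowDomain d)
    (U : Fin 2 → EuclideanSpace ℝ (Fin d) → ℝ)
    (b c : EuclideanSpace ℝ (Fin d) → EuclideanSpace ℝ (Fin d)) (ε : ℝ) : ℝ :=
  (∫ y in D.cell, D.estimatorDerivAlong U b c y *
    (D.transportedEstimator U b c ε y * D.forwardIntegral U (b + ε • c) 0 y)) -
  ∫ y in D.cell, D.estimatorDerivAlong U b c y * D.forwardIntegral U (b + ε • c) 1 y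

namespace IsTestField

/-- Dominated convergence for integrals against a bounded function supported in the support of a
test field. -/
theorem tendsto_integral_mul (hc : D.IsTestField V c) {q : EuclideanSpace ℝ (Fin d) → ℝ}
    (hqm : D.MeasurableOnCover q) (hq : ∀ y ∉ tsupport c, q y = 0) {C C' : ℝ}
    (hqC : ∀ y, |q y| ≤ C) {f : ℝ → EuclideanSpace ℝ (Fin d) → ℝ}
    {f₀ : EuclideanSpace ℝ (Fin d) → ℝ} (hfm : ∀ ε, D.MeasurableOnCover (f ε))
    (hfC : ∀ᶠ ε in 𝓝 0, ∀ y ∈ tsupport c, |f ε y| ≤ C')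
    (hlim : ∀ y ∈ tsupport c, Tendsto (fun ε => f ε y) (𝓝 0) (𝓝 (f₀ y))) :
    Tendsto (fun ε => ∫ y in D.cell, q y * f ε y) (𝓝 0) (𝓝 (∫ y in D.cell, q y * f₀ y)) := by
  refine tendsto_integral_filter_of_dominated_convergence
    ((tsupport c).indicator fun _ => C * C') (Eventually.of_forall fun ε => ?_) ?_ ?_ ?_
  · exact (hqm.aemeasurable.mul (hfm ε).aemeasurable).aestronglyMeasurable
  · filter_upwards [hfC] with ε hε
    refine Eventually.of_forall fun y => ?_
    by_cases hy : y ∈ tsupport c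
    · rw [indicator_of_mem hy, Real.norm_eq_abs, abs_mul]
      exact mul_le_mul (hqC y) (hε y hy) (abs_nonneg _) ((abs_nonneg _).trans (hqC y))
    · rw [indicator_of_notMem hy, hq y hy, zero_mul, norm_zero]
  · rw [integrable_indicator_iff (isClosed_tsupport c).measurableSet, IntegrableOn,
      Measure.restrict_restrict (isClosed_tsupport c).measurableSet, inter_comm]
    exact integrableOn_const hc.volume_cell_inter_tsupport_lt_top.ne
  · refine Eventually.of_forall fun y => ?_
    by_cases hy : y ∈ tsupport c
    · exact (hlim y hy).const_mul _
    · simp only [hq y hy, zero_mul]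
      exact tendsto_const_nhds

theorem integrableOn_mul (hc : D.IsTestField V c) {q f : EuclideanSpace ℝ (Fin d) → ℝ}
    (hqm : D.MeasurableOnCover q) (hq : ∀ y ∉ tsupport c, q y = 0) {C C' : ℝ}
    (hqC : ∀ y, |q y| ≤ C) (hfm : D.MeasurableOnCover f)
    (hfC : ∀ y ∈ tsupport c, |f y| ≤ C') : IntegrableOn (fun y => q y * f y) D.cell := by
  have hi : Integrable ((tsupport c).indicator fun _ => C * C') (volume.restrict D.cell) := by
    rw [integrable_indicator_iff (isClosed_tsupport c).measurableSet, IntegrableOn,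
      Measure.restrict_restrict (isClosed_tsupport c).measurableSet, inter_comm]
    exact integrableOn_const hc.volume_cell_inter_tsupport_lt_top.ne
  refine hi.mono' (hqm.aemeasurable.mul hfm.aemeasurable).aestronglyMeasurable
    (Eventually.of_forall fun y => ?_)
  by_cases hy : y ∈ tsupport c
  · rw [indicator_of_mem hy, Real.norm_eq_abs, abs_mul]
    exact mul_le_mul (hqC y) (hfC y hy) (abs_nonneg _) ((abs_nonneg _).trans (hqC y))
  · rw [indicator_of_notMem hy, hq y hy, zero_mul, norm_zero]

theorem tendsto_forwardIntegral (hc : D.IsTestField V c) (hV : D.IsOpenSubset V)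
    (h : D.IsVelocityField b) (hU : D.PotentialAssumptions U) (hVr : V ⊆ D.regularSet U b)
    (k : Fin 2) (hx : x ∈ tsupport c) :
    Tendsto (fun ε : ℝ => D.forwardIntegral U (b + ε • c) k x) (𝓝 0)
      (𝓝 (D.forwardIntegral U b k x)) := by
  rw [Metric.tendsto_nhds]
  intro η hη
  filter_upwards [hc.eventually_abs_forwardIntegral_sub_lt hV h hU hVr k hη] with ε hε
  exact hε x hx

theorem exists_abs_forwardIntegral_le (hc : D.IsTestField V c)
    (h : D.IsVelocityField b) (hU : D.PotentialAssumptions U) (hVr : V ⊆ D.regularSet U b)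
    (k : Fin 2) : ∃ C ≥ 0, ∀ x ∈ tsupport c, |D.forwardIntegral U b k x| ≤ C :=
  hc.exists_forall_abs_le
    ((continuousOn_forwardIntegral k).mono (hc.support_subset.trans hVr))
    fun _ hl _ hx => h.forwardIntegral_add_period hU.periodic hl
      (regularSet_subset (hVr (hc.support_subset hx))) k

theorem exists_eventually_abs_forwardIntegral_le (hc : D.IsTestField V c)
    (hV : D.IsOpenSubset V) (h : D.IsVelocityField b) (hU : D.PotentialAssumptions U)
    (hVr : V ⊆ D.regularSet U b) (k : Fin 2) :
    ∃ C ≥ 0, ∀ᶠ ε : ℝ in 𝓝 0, ∀ x ∈ tsupport c, |D.forwardIntegral U (b + ε • c) k x| ≤ C := by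
  obtain ⟨C, hC0, hC⟩ := hc.exists_abs_forwardIntegral_le h hU hVr k
  refine ⟨C + 1, by positivity, ?_⟩
  filter_upwards [hc.eventually_abs_forwardIntegral_sub_lt hV h hU hVr k one_pos] with ε hε x hx
  have h1 := abs_sub_abs_le_abs_sub (D.forwardIntegral U (b + ε • c) k x)
    (D.forwardIntegral U b k x)
  linarith [hε x hx, hC x hx]

theorem exists_abs_estimator_le (hc : D.IsTestField V c)
    (h : D.IsVelocityField b) (hU : D.PotentialAssumptions U) (hVr : V ⊆ D.regularSet U b) :
    ∃ C ≥ 0, ∀ x ∈ tsupport c, |D.estimator U b x| ≤ C :=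
  hc.exists_forall_abs_le
    (h.continuousOn_estimator.mono (hc.support_subset.trans hVr))
    fun l hl x _ => isPeriodic_estimator hU h l hl x

theorem exists_abs_estimatorDrift_le (hc : D.IsTestField V c) (hV : D.IsOpenSubset V)
    (h : D.IsVelocityField b) (hU : D.PotentialAssumptions U) (hVr : V ⊆ D.regularSet U b)
    (hA : ContDiffOn ℝ 1 (D.estimator U b) V) :
    ∃ C ≥ 0, ∀ᶠ ε : ℝ in 𝓝 0, ∀ x ∈ D.cover, |D.estimatorDrift U b c ε x| ≤ C := by
  obtain ⟨T, hT0, hT⟩ := hc.exists_isTransient hV h hU hVr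
  obtain ⟨C, hC0, hC⟩ := hc.exists_abs_estimatorDerivAlong_le hV h hU hA
  refine ⟨C * (2 * T), by positivity, ?_⟩
  filter_upwards [hT] with ε hε x hx
  exact hε.abs_integral_comp_flow_le hT0.le (hc.isVelocityField hV h ε) hx
    (fun y hy => estimatorDerivAlong_of_notMem hy) hC0 hC _

theorem measurableOnCover_estimatorDerivAlong (hc : D.IsTestField V c) (hV : D.IsOpenSubset V)
    (hA : ContDiffOn ℝ 1 (D.estimator U b) V) :
    D.MeasurableOnCover (D.estimatorDerivAlong U b c) :=
  measurableOnCover_of_continuousOn (hc.continuous_estimatorDerivAlong hV hA).continuousOn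

/-- On the support of `c` one has `⟨G, c⟩ = 2 ∇A · c (A R₊⁰ - R₊¹)` where `R₊ᵏ` is the forward
integral. -/
theorem inner_explicitDerivative (hc : D.IsTestField V c) (h : D.IsVelocityField b)
    (hVr : V ⊆ D.regularSet U b) (x : EuclideanSpace ℝ (Fin d)) :
    ⟪D.explicitDerivative U b x, c x⟫ =
      2 * (D.estimatorDerivAlong U b c x * (D.estimator U b x * D.forwardIntegral U b 0 x) -
        D.estimatorDerivAlong U b c x * D.forwardIntegral U b 1 x) := by
  by_cases hx : x ∈ tsupport c
  · have hxr := hVr (hc.support_subset hx)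
    have hint := isIntegrableAt_of_mem_regularSet hxr
    have hB := h.totalIntegral_pos (regularSet_subset hxr) hint 0
    rw [explicitDerivative, real_inner_smul_left, inner_gradient_left, estimatorDerivAlong,
      estimator, hint.totalIntegral_eq 1]
    rw [hint.totalIntegral_eq 0] at hB ⊢
    field_simp
    ring
  · rw [estimatorDerivAlong_of_notMem hx, image_eq_zero_of_notMem_tsupport hx]
    simp

theorem integral_inner_explicitDerivative (hc : D.IsTestField V c) (hV : D.IsOpenSubset V)
    (h : D.IsVelocityField b) (hU : D.PotentialAssumptions U) (hVr : V ⊆ D.regularSet U b)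
    (hA : ContDiffOn ℝ 1 (D.estimator U b) V) :
    IntegrableOn (fun x => ⟪D.explicitDerivative U b x, c x⟫) D.cell ∧
      ∫ x in D.cell, ⟪D.explicitDerivative U b x, c x⟫ =
        2 * ((∫ y in D.cell, D.estimatorDerivAlong U b c y *
            (D.estimator U b y * D.forwardIntegral U b 0 y)) -
          ∫ y in D.cell, D.estimatorDerivAlong U b c y * D.forwardIntegral U b 1 y) := by
  obtain ⟨C, hC0, hC⟩ := hc.exists_abs_estimatorDerivAlong_le hV h hU hA
  obtain ⟨CA, hCA0, hCA⟩ := hc.exists_abs_estimator_le h hU hVr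
  obtain ⟨C0, hC00, hC0'⟩ := hc.exists_abs_forwardIntegral_le h hU hVr 0
  obtain ⟨C1, hC10, hC1'⟩ := hc.exists_abs_forwardIntegral_le h hU hVr 1
  have hqm := hc.measurableOnCover_estimatorDerivAlong hV hA
  have hm : D.MeasurableOnCover fun y => D.estimator U b y * D.forwardIntegral U b 0 y :=
    Measurable.mul (h.measurableOnCover_estimator hU) (h.measurableOnCover_forwardIntegral hU 0)
  have i1 := hc.integrableOn_mul hqm (fun y hy => estimatorDerivAlong_of_notMem hy) hC hm
    (C' := CA * C0) fun y hy => by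
      rw [abs_mul]
      exact mul_le_mul (hCA y hy) (hC0' y hy) (abs_nonneg _) hCA0
  have i2 := hc.integrableOn_mul hqm (fun y hy => estimatorDerivAlong_of_notMem hy) hC
    (h.measurableOnCover_forwardIntegral hU 1) hC1'
  simp only [hc.inner_explicitDerivative h hVr]
  refine ⟨(i1.sub i2).const_mul 2, ?_⟩
  rw [integral_const_mul, integral_sub i1 i2]

/-- The linear coefficient converges, as `ε → 0`, to the pairing of the explicit derivative with `c`. -/
theorem tendsto_momentSlope (hc : D.IsTestField V c) (hV : D.IsOpenSubset V)
    (h : D.IsVelocityField b) (hU : D.PotentialAssumptions U) (hVr : V ⊆ D.regularSet U b)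
    (hA : ContDiffOn ℝ 1 (D.estimator U b) V) :
    Tendsto (fun ε => 2 * D.momentSlope U b c ε) (𝓝 0)
      (𝓝 (∫ x in D.cell, ⟪D.explicitDerivative U b x, c x⟫)) := by
  rw [(hc.integral_inner_explicitDerivative hV h hU hVr hA).2]
  obtain ⟨C, hC0, hC⟩ := hc.exists_abs_estimatorDerivAlong_le hV h hU hA
  obtain ⟨CA, hCA0, hCA⟩ := hc.exists_abs_estimator_le h hU hVr
  obtain ⟨C0, hC00, hC0'⟩ := hc.exists_eventually_abs_forwardIntegral_le hV h hU hVr 0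
  obtain ⟨C1, hC10, hC1'⟩ := hc.exists_eventually_abs_forwardIntegral_le hV h hU hVr 1
  obtain ⟨CI, hCI0, hCI⟩ := hc.exists_abs_estimatorDrift_le hV h hU hVr hA
  have hqm := hc.measurableOnCover_estimatorDerivAlong hV hA
  have hcD : tsupport c ⊆ D.cover := hc.support_subset.trans hV.subset
  refine Tendsto.const_mul 2 (Tendsto.sub ?_ ?_)
  · refine hc.tendsto_integral_mul hqm (fun y hy => estimatorDerivAlong_of_notMem hy) hC
      (C' := (CA + CI) * C0) (fun ε => ?_) ?_ fun y hy => ?_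
    · exact Measurable.mul (hc.measurableOnCover_transportedEstimator hV h hU hA ε)
        ((hc.isVelocityField hV h ε).measurableOnCover_forwardIntegral hU 0)
    · filter_upwards [hC0', hCI, Metric.ball_mem_nhds (0 : ℝ) one_pos] with ε h1 h2 h3 y hy
      rw [Metric.mem_ball, Real.dist_eq, sub_zero] at h3
      rw [abs_mul]
      refine mul_le_mul ?_ (h1 y hy) (abs_nonneg _) (by positivity)
      rw [transportedEstimator]
      refine (abs_sub _ _).trans (add_le_add (hCA y hy) ?_)
      rw [abs_mul]
      calc |ε| * |D.estimatorDrift U b c ε y| ≤ 1 * CI :=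
            mul_le_mul h3.le (h2 y (hcD hy)) (abs_nonneg _) zero_le_one
        _ = CI := one_mul _
    · refine Tendsto.mul ?_ (hc.tendsto_forwardIntegral hV h hU hVr 0 hy)
      have h0 : Tendsto (fun ε => ε * D.estimatorDrift U b c ε y) (𝓝 0) (𝓝 0) := by
        have hz : Tendsto (fun ε : ℝ => |ε| * CI) (𝓝 0) (𝓝 0) := by
          have : Continuous fun ε : ℝ => |ε| * CI := by fun_prop
          simpa using this.tendsto 0
        refine squeeze_zero_norm' ?_ hz
        filter_upwards [hCI] with ε hε
        rw [Real.norm_eq_abs, abs_mul]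
        exact mul_le_mul_of_nonneg_left (hε y (hcD hy)) (abs_nonneg _)
      simpa [transportedEstimator] using h0.const_sub (D.estimator U b y)
  · exact hc.tendsto_integral_mul hqm (fun y hy => estimatorDerivAlong_of_notMem hy) hC
      (fun ε => (hc.isVelocityField hV h ε).measurableOnCover_forwardIntegral hU 1) hC1'
      fun y hy => hc.tendsto_forwardIntegral hV h hU hVr 1 hy

theorem hasDerivAt_mul_momentSlope (hc : D.IsTestField V c) (hV : D.IsOpenSubset V)
    (h : D.IsVelocityField b) (hU : D.PotentialAssumptions U) (hVr : V ⊆ D.regularSet U b)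
    (hA : ContDiffOn ℝ 1 (D.estimator U b) V) :
    HasDerivAt (fun ε => 2 * ε * D.momentSlope U b c ε)
      (∫ x in D.cell, ⟪D.explicitDerivative U b x, c x⟫) 0 := by
  rw [hasDerivAt_iff_tendsto_slope_zero]
  refine ((hc.tendsto_momentSlope hV h hU hVr hA).mono_left nhdsWithin_le_nhds).congr' ?_
  filter_upwards [self_mem_nhdsWithin] with ε hε
  have : ε ≠ 0 := hε
  simp only [zero_add, mul_zero, zero_mul, sub_zero, smul_eq_mul]
  field_simp

/-- Any derivative of the second moment at `b` in the direction `c` is given by the linear term of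
the expansion, as the remainder is nonnegative. -/
theorem eq_of_hasDerivAt_secondMoment (hc : D.IsTestField V c) (hV : D.IsOpenSubset V)
    (hb : b ∈ D.infiniteTimeFields U) (hU : D.PotentialAssumptions U)
    (hVr : V ⊆ D.regularSet U b) (hA : ContDiffOn ℝ 1 (D.estimator U b) V) {m : ℝ}
    (hm : HasDerivAt (fun ε : ℝ => D.secondMoment U (b + ε • c)) m 0) :
    m = ∫ x in D.cell, ⟪D.explicitDerivative U b x, c x⟫ := by
  -- the remainder is nonnegative and vanishes at `ε = 0`, hence has derivative `0` there
  have hd := hm.sub (hc.hasDerivAt_mul_momentSlope hV hb.1 hU hVr hA)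
  refine sub_eq_zero.1 (IsLocalMin.hasDerivAt_eq_zero ?_ hd)
  obtain ⟨T, hT0, hT⟩ := hc.exists_isTransient hV hb.1 hU hVr
  filter_upwards [hT, hc.eventually_mem_infiniteTimeFields hV hb hU hVr] with ε h1 h2
  have e := hc.secondMoment_add_smul hV hb hU hA hT0.le h1 h2
  simp only [Pi.sub_apply, zero_smul, add_zero, mul_zero, zero_mul, sub_zero, momentSlope]
  rw [e]
  have n1 : 0 ≤ ∫ x, D.estimatorDrift U b c ε x ^ 2 ∂(D.baseMeasure U) :=
    integral_nonneg fun x => sq_nonneg _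
  have n2 : 0 ≤ ∫ x, (D.estimator U (b + ε • c) x - D.transportedEstimator U b c ε x) ^ 2
      ∂(D.baseMeasure U) := integral_nonneg fun x => sq_nonneg _
  nlinarith [mul_nonneg (sq_nonneg ε) n1]

/-- If the estimator of `b + ε c` differs from the transported estimator by `O(ε)`, then the
remainder of the expansion is `O(ε²)`. -/
theorem hasDerivAt_secondMoment (hc : D.IsTestField V c) (hV : D.IsOpenSubset V)
    (hb : b ∈ D.infiniteTimeFields U) (hU : D.PotentialAssumptions U)
    (hVr : V ⊆ D.regularSet U b) (hA : ContDiffOn ℝ 1 (D.estimator U b) V) {C : ℝ}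
    (hC : ∀ᶠ ε : ℝ in 𝓝 0, ∀ x ∈ D.cover,
      |D.estimator U (b + ε • c) x - D.transportedEstimator U b c ε x| ≤ C * |ε|) :
    HasDerivAt (fun ε : ℝ => D.secondMoment U (b + ε • c))
      (∫ x in D.cell, ⟪D.explicitDerivative U b x, c x⟫) 0 := by
  have := hU.isProbabilityMeasure
  obtain ⟨T, hT0, hT⟩ := hc.exists_isTransient hV hb.1 hU hVr
  obtain ⟨CI, hCI0, hCI⟩ := hc.exists_abs_estimatorDrift_le hV hb.1 hU hVr hA
  have bound : ∀ {f : EuclideanSpace ℝ (Fin d) → ℝ} {κ : ℝ}, (∀ x ∈ D.cover, |f x| ≤ κ) →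
      |∫ x, f x ^ 2 ∂(D.baseMeasure U)| ≤ κ ^ 2 := by
    intro f κ hf
    have hae : ∀ᵐ x ∂(D.baseMeasure U), ‖f x ^ 2‖ ≤ κ ^ 2 := by
      refine ae_base_of_ae_cell ?_
      filter_upwards [D.ae_mem_cell] with x hx
      rw [norm_pow, Real.norm_eq_abs]
      exact pow_le_pow_left₀ (abs_nonneg _) (hf x (D.cell_subset_cover hx)) 2
    simpa using norm_integral_le_of_norm_le_const hae
  have hr : HasDerivAt (fun ε : ℝ => D.secondMoment U (b + ε • c) -
      (D.secondMoment U b + 2 * ε * D.momentSlope U b c ε)) 0 0 := by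
    have hO : (fun ε : ℝ => D.secondMoment U (b + ε • c) -
        (D.secondMoment U b + 2 * ε * D.momentSlope U b c ε)) =O[𝓝 0]
        fun ε => ‖ε - 0‖ ^ 2 := by
      refine Asymptotics.IsBigO.of_bound (CI ^ 2 + C ^ 2) ?_
      filter_upwards [hT, hc.eventually_mem_infiniteTimeFields hV hb hU hVr, hCI, hC] with
        ε h1 h2 h3 h4
      have e := hc.secondMoment_add_smul hV hb hU hA hT0.le h1 h2
      have b1 := bound h3
      have b2 := bound h4
      rw [e, momentSlope, sub_zero, norm_pow, norm_norm, Real.norm_eq_abs, Real.norm_eq_abs]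
      rw [mul_pow] at b2
      rw [abs_le] at b1 b2 ⊢
      rw [sq_abs] at *
      constructor <;> nlinarith [sq_nonneg ε, b1.1, b1.2, b2.1, b2.2]
    have := (hO.hasFDerivAt one_lt_two).hasDerivAt
    simpa using this
  have hsum := hr.add ((hc.hasDerivAt_mul_momentSlope hV hb.1 hU hVr hA).const_add
    (D.secondMoment U b))
  rw [zero_add] at hsum
  refine hsum.congr_of_eventuallyEq (Eventually.of_forall fun ε => ?_)
  simp only [Pi.add_apply]
  ring

end IsTestField

end FlowDomain

namespace FlowDomain

variable {d : ℕ} {D : FlowDomain d} {U : Fin 2 → EuclideanSpace ℝ (Fin d) → ℝ}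
  {b b' c : EuclideanSpace ℝ (Fin d) → EuclideanSpace ℝ (Fin d)} {x l : EuclideanSpace ℝ (Fin d)}
  {V : Set (EuclideanSpace ℝ (Fin d))} {ε : ℝ}

/-! ### Differentiable half-line integrals -/

/-- The divergence of `R c`, where `R` is a forward integral of `b`. -/
noncomputable def forwardFlux (D : FlowDomain d)
    (U : Fin 2 → EuclideanSpace ℝ (Fin d) → ℝ)
    (b c : EuclideanSpace ℝ (Fin d) → EuclideanSpace ℝ (Fin d)) (k : Fin 2)
    (x : EuclideanSpace ℝ (Fin d)) : ℝ :=
  fderiv ℝ (D.forwardIntegral U b k) x (c x) + D.forwardIntegral U b k x * divergence c x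

theorem divergence_eq_zero_of_notMem_tsupport (hx : x ∉ tsupport c) : divergence c x = 0 := by
  have : fderiv ℝ c x = 0 := by
    by_contra hne
    exact hx (support_fderiv_subset ℝ (f := c) hne)
  simp [divergence, this]

theorem forwardFlux_of_notMem (hx : x ∉ tsupport c) (k : Fin 2) :
    D.forwardFlux U b c k x = 0 := by
  simp [forwardFlux, image_eq_zero_of_notMem_tsupport hx,
    divergence_eq_zero_of_notMem_tsupport hx]

/-- Along the flow of `b`, the product of the forward integral and the Jacobian has derivative
`-F`. -/
theorem IsVelocityField.hasDerivAt_forwardIntegral_mul_jacobian (h : D.IsVelocityField b)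
    (hU : D.PotentialAssumptions U) (hx : x ∈ D.regularSet U b) (k : Fin 2) :
    HasDerivAt (fun s => D.forwardIntegral U b k (D.flow b s x) * D.jacobian b s x)
      (-Real.exp (-U k x)) 0 := by
  have hxD := regularSet_subset hx
  have hc := h.continuous_weightedDensity (hU.continuousOn k) hxD
  have h1 : HasDerivAt (fun s => ∫ t in (0 : ℝ)..s, D.weightedDensity U b k t x)
      (D.weightedDensity U b k 0 x) 0 :=
    intervalIntegral.integral_hasDerivAt_right (hc.intervalIntegrable _ _)
      (hc.stronglyMeasurableAtFilter _ _) hc.continuousAt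
  rw [h.weightedDensity_zero hxD] at h1
  refine (h1.const_sub (D.forwardIntegral U b k x)).congr_of_eventuallyEq
    (Eventually.of_forall fun s => ?_)
  exact h.forwardIntegral_flow_mul' hxD (isIntegrableAt_of_mem_regularSet hx k) s

/-- The transport equation `div (R b) = -exp(-U_k)` of the forward integral `R` of `b`. -/
theorem IsVelocityField.fderiv_forwardIntegral_field (h : D.IsVelocityField b)
    (hU : D.PotentialAssumptions U) (hx : x ∈ D.regularSet U b) (k : Fin 2)
    (hd : DifferentiableAt ℝ (D.forwardIntegral U b k) x) :
    fderiv ℝ (D.forwardIntegral U b k) x (b x) + D.forwardIntegral U b k x * divergence b x =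
      -Real.exp (-U k x) := by
  have hxD := regularSet_subset hx
  have hd0 : HasFDerivAt (D.forwardIntegral U b k) (fderiv ℝ (D.forwardIntegral U b k) x)
      (D.flow b 0 x) := by
    rw [h.flow_zero hxD]
    exact hd.hasFDerivAt
  have h1 := (HasFDerivAt.comp_hasDerivAt (0 : ℝ) hd0 (h.hasDerivAt_flow hxD 0)).mul
    (h.hasDerivAt_jacobian hxD 0)
  have h2 := h1.unique (h.hasDerivAt_forwardIntegral_mul_jacobian hU hx k)
  simp only [Function.comp_apply, h.flow_zero hxD, h.jacobian_zero hxD, mul_one, one_mul] at h2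
  exact h2

namespace IsTestField

theorem continuous_forwardFlux (hc : D.IsTestField V c) (hV : D.IsOpenSubset V) (k : Fin 2)
    (hR : ContDiffOn ℝ 1 (D.forwardIntegral U b k) V) :
    Continuous (D.forwardFlux U b c k) := by
  rw [continuous_iff_continuousAt]
  intro x
  by_cases hx : x ∈ tsupport c
  · have hn := hV.isOpen.mem_nhds (hc.support_subset hx)
    have h1 : ContinuousAt (fderiv ℝ (D.forwardIntegral U b k)) x :=
      (hR.continuousOn_fderiv_of_isOpen hV.isOpen le_rfl).continuousAt hn
    exact (h1.clm_apply hc.smooth.continuous.continuousAt).add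
      ((hR.continuousOn.continuousAt hn).mul hc.continuous_divergence.continuousAt)
  · have : D.forwardFlux U b c k =ᶠ[𝓝 x] fun _ => 0 := by
      filter_upwards [(isClosed_tsupport c).isOpen_compl.mem_nhds hx] with y hy using
        forwardFlux_of_notMem hy k
    exact continuousAt_const.congr this.symm

theorem exists_abs_forwardFlux_le (hc : D.IsTestField V c) (hV : D.IsOpenSubset V)
    (h : D.IsVelocityField b) (hU : D.PotentialAssumptions U) (k : Fin 2)
    (hR : ContDiffOn ℝ 1 (D.forwardIntegral U b k) V) :
    ∃ C ≥ 0, ∀ x, |D.forwardFlux U b c k x| ≤ C := by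
  have hper : D.IsPeriodic (D.forwardIntegral U b k) :=
    isPeriodic_of_forall_cover fun l hl x hx => h.forwardIntegral_add_period hU.periodic hl hx k
  obtain ⟨C, hC0, hC⟩ := hc.exists_forall_abs_le
    (hc.continuous_forwardFlux hV k hR).continuousOn fun l hl x _ => by
      have e : fderiv ℝ (D.forwardIntegral U b k) (x + l) =
          fderiv ℝ (D.forwardIntegral U b k) x := by
        rw [← fderiv_comp_add_right]
        congr 1
        funext y
        rw [hper l hl]
      rw [forwardFlux, forwardFlux, e, hper l hl, hc.periodic l hl, divergence, divergence,
        hc.fderiv_add_period hl]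
  refine ⟨C, hC0, fun x => ?_⟩
  by_cases hx : x ∈ tsupport c
  · exact hC x hx
  · rwa [forwardFlux_of_notMem hx, abs_zero]

/-- Along the flow of `b + ε c`, the product of the forward integral of `b` and the Jacobian has
derivative `-F + ε J div (R c)`. -/
theorem hasDerivAt_forwardIntegral_mul_jacobian (hc : D.IsTestField V c)
    (hV : D.IsOpenSubset V) (h : D.IsVelocityField b) (hU : D.PotentialAssumptions U)
    (hVr : V ⊆ D.regularSet U b) (k : Fin 2)
    (hR : ContDiffOn ℝ 1 (D.forwardIntegral U b k) V) (ε : ℝ) (hx : x ∈ D.regularSet U b)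
    (t : ℝ) :
    HasDerivAt (fun s => D.forwardIntegral U b k (D.flow (b + ε • c) s x) *
        D.jacobian (b + ε • c) s x)
      (-D.weightedDensity U (b + ε • c) k t x +
        ε * (D.forwardFlux U b c k (D.flow (b + ε • c) t x) * D.jacobian (b + ε • c) t x)) t := by
  have h' := hc.isVelocityField hV h ε
  have hxD := regularSet_subset hx
  have hcr := hc.support_subset.trans hVr
  set z := D.flow (b + ε • c) t x with hz
  have hzr : z ∈ D.regularSet U b := h.flow_mem_regularSet_of_eqOn_compl h' hU
    (isClosed_tsupport c) (fun y hy => add_smul_eq_of_notMem_tsupport ε hy) hcr hx t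
  have hzD := regularSet_subset hzr
  by_cases hzV : z ∈ V
  · have hd : DifferentiableAt ℝ (D.forwardIntegral U b k) z :=
      (hR.contDiffAt (hV.isOpen.mem_nhds hzV)).differentiableAt one_ne_zero
    have h1 := (HasFDerivAt.comp_hasDerivAt t hd.hasFDerivAt (h'.hasDerivAt_flow hxD t)).mul
      (h'.hasDerivAt_jacobian hxD t)
    have e := h.fderiv_forwardIntegral_field hU hzr k hd
    refine h1.congr_deriv ?_
    rw [← hz, hc.divergence_add_smul h ε hzD, weightedDensity, ← hz, forwardFlux]
    simp only [Function.comp_apply, Pi.add_apply, Pi.smul_apply, map_add, map_smul, smul_eq_mul,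
      ← hz]
    linear_combination D.jacobian (b + ε • c) t x * e
  · have hzc : z ∉ tsupport c := fun hmem => hzV (hc.support_subset hmem)
    rw [forwardFlux_of_notMem hzc, zero_mul, mul_zero, add_zero]
    have h1 := (h.hasDerivAt_forwardIntegral_mul_jacobian hU hzr k).mul_const
      (D.jacobian (b + ε • c) t x)
    have hlim : HasDerivAt (fun s => s - t) 1 t := (hasDerivAt_id t).sub_const t
    have h2 : HasDerivAt ((fun s => D.forwardIntegral U b k (D.flow b s z) * D.jacobian b s z *
        D.jacobian (b + ε • c) t x) ∘ fun s => s - t)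
        (-Real.exp (-U k z) * D.jacobian (b + ε • c) t x * 1) t := by
      refine HasDerivAt.comp t ?_ hlim
      rwa [sub_self]
    have hlim0 : Tendsto (fun s => s - t) (𝓝 t) (𝓝 0) := by
      have := hlim.continuousAt.tendsto
      rwa [sub_self] at this
    rw [weightedDensity, ← hz, ← neg_mul]
    rw [mul_one] at h2
    refine h2.congr_of_eventuallyEq ?_
    filter_upwards [hlim0.eventually (hc.eventually_flow_eq hV h ε hzD hzc)] with s hs
    have e1 : D.flow (b + ε • c) s x = D.flow (b + ε • c) (s - t) z := by
      rw [hz, ← h'.flow_add hxD, sub_add_cancel]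
    have e2 : D.jacobian (b + ε • c) s x =
        D.jacobian (b + ε • c) (s - t) z * D.jacobian (b + ε • c) t x := by
      rw [hz, ← h'.jacobian_add hxD, sub_add_cancel]
    rw [e1, e2, hs.1, hs.2, Function.comp_apply]
    ring

/-- If the forward integrals of `b` are `C¹` on `V`, then those of `b + ε c` differ from them by
`O(ε)`, uniformly on the support of `c`. -/
theorem exists_abs_forwardIntegral_sub_le (hc : D.IsTestField V c) (hV : D.IsOpenSubset V)
    (h : D.IsVelocityField b) (hU : D.PotentialAssumptions U) (hVr : V ⊆ D.regularSet U b)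
    (k : Fin 2) (hR : ContDiffOn ℝ 1 (D.forwardIntegral U b k) V) :
    ∃ C ≥ 0, ∀ᶠ ε : ℝ in 𝓝 0, ∀ y ∈ tsupport c,
      |D.forwardIntegral U (b + ε • c) k y - D.forwardIntegral U b k y| ≤ C * |ε| := by
  obtain ⟨K, hK, hKc, hcK⟩ := hc.exists_isCompact
  obtain ⟨T, hT0, hT⟩ := hc.exists_isTransient hV h hU hVr
  obtain ⟨P, hP0, hP⟩ := hc.exists_abs_forwardFlux_le hV h hU k hR
  have hcr := hc.support_subset.trans hVr
  have hcD := hcr.trans regularSet_subset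
  have hcpt : IsCompact (Icc (-1 : ℝ) 1 ×ˢ Icc 0 T ×ˢ K) :=
    isCompact_Icc.prod (isCompact_Icc.prod hK)
  obtain ⟨J, hJ⟩ := hcpt.exists_bound_of_continuousOn ((hc.continuousOn_jacobian hV h).mono
    (prod_mono (subset_univ _) (prod_mono (subset_univ _) (hKc.trans hcD))))
  refine ⟨P * |J| * T, by positivity, ?_⟩
  filter_upwards [hT, Icc_mem_nhds (show (-1 : ℝ) < 0 by norm_num) one_pos] with ε hε hε1 y hy
  have h' := hc.isVelocityField hV h ε
  have hyr := hcr hy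
  have hyD := regularSet_subset hyr
  have hF := h'.continuous_weightedDensity (hU.continuousOn k) hyD
  have hflux : Continuous fun t => D.forwardFlux U b c k (D.flow (b + ε • c) t y) *
      D.jacobian (b + ε • c) t y :=
    ((hc.continuous_forwardFlux hV k hR).comp (h'.continuous_flow hyD)).mul
      (h'.continuous_jacobian hyD)
  have e1 := (h.forwardIntegral_of_avoids h' hU (isClosed_tsupport c)
    (fun y hy => add_smul_eq_of_notMem_tsupport ε hy) hcr hyr hT0.le (hε y hy) k).2
  have e2 := intervalIntegral.integral_eq_sub_of_hasDerivAt (a := 0) (b := T)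
    (fun t _ => hc.hasDerivAt_forwardIntegral_mul_jacobian hV h hU hVr k hR ε hyr t)
    ((hF.neg.add (hflux.const_mul ε)).intervalIntegrable _ _)
  have hFn : Continuous fun t => -D.weightedDensity U (b + ε • c) k t y := hF.neg
  rw [intervalIntegral.integral_add (hFn.intervalIntegrable _ _)
    ((hflux.const_mul ε).intervalIntegrable _ _), intervalIntegral.integral_neg,
    intervalIntegral.integral_const_mul, h'.flow_zero hyD, h'.jacobian_zero hyD, mul_one] at e2
  -- the integrals of `F` cancel between the two expressions for the transported forward integral
  have e3 : D.forwardIntegral U (b + ε • c) k y - D.forwardIntegral U b k y =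
      ε * ∫ t in (0 : ℝ)..T, D.forwardFlux U b c k (D.flow (b + ε • c) t y) *
        D.jacobian (b + ε • c) t y := by
    linear_combination e1 - e2
  have e4 : ‖∫ t in (0 : ℝ)..T, D.forwardFlux U b c k (D.flow (b + ε • c) t y) *
      D.jacobian (b + ε • c) t y‖ ≤ P * |J| * |T - 0| := by
    refine intervalIntegral.norm_integral_le_of_norm_le_const fun t ht => ?_
    rw [uIoc_of_le hT0.le] at ht
    obtain ⟨l, hl, hyK⟩ := hcK y hy
    rw [norm_mul, Real.norm_eq_abs]
    refine mul_le_mul (hP _) ?_ (norm_nonneg _) hP0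
    have := hJ (ε, t, y + l) ⟨hε1, ⟨ht.1.le, ht.2⟩, hyK⟩
    simp only [h'.jacobian_add_period hl hyD] at this
    exact this.trans (le_abs_self J)
  rw [e3, abs_mul, mul_comm |ε|]
  rw [sub_zero, abs_of_pos hT0] at e4
  exact mul_le_mul_of_nonneg_right e4 (abs_nonneg _)

theorem exists_abs_backwardIntegral_sub_le (hc : D.IsTestField V c) (hV : D.IsOpenSubset V)
    (h : D.IsVelocityField b) (hU : D.PotentialAssumptions U) (hVr : V ⊆ D.regularSet U b)
    (k : Fin 2) (hR : ContDiffOn ℝ 1 (D.backwardIntegral U b k) V) :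
    ∃ C ≥ 0, ∀ᶠ ε : ℝ in 𝓝 0, ∀ y ∈ tsupport c,
      |D.backwardIntegral U (b + ε • c) k y - D.backwardIntegral U b k y| ≤ C * |ε| := by
  have hVD := hV.subset
  obtain ⟨C, hC0, hC⟩ := hc.exists_abs_forwardIntegral_sub_le hV h.neg hU
    (by rwa [h.regularSet_neg]) k (hR.congr fun y hy => h.forwardIntegral_neg_field (hVD hy) k)
  refine ⟨C, hC0, ?_⟩
  have hneg : Tendsto (fun ε : ℝ => -ε) (𝓝 0) (𝓝 0) := by
    simpa using (continuous_neg (G := ℝ)).tendsto 0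
  filter_upwards [hneg.eventually hC] with ε hε y hy
  have hyD := hVD (hc.support_subset hy)
  have := hε y hy
  rwa [← neg_add_smul_field, (hc.isVelocityField hV h ε).forwardIntegral_neg_field hyD,
    h.forwardIntegral_neg_field hyD, abs_neg] at this

end IsTestField

theorem contDiffOn_estimator (h : D.IsVelocityField b) (hVr : V ⊆ D.regularSet U b)
    (hR : ∀ k, ContDiffOn ℝ 1 (D.forwardIntegral U b k) V ∧
      ContDiffOn ℝ 1 (D.backwardIntegral U b k) V) : ContDiffOn ℝ 1 (D.estimator U b) V := by
  have hT : ∀ k, ContDiffOn ℝ 1 (D.totalIntegral U b k) V := fun k =>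
    ((hR k).1.add (hR k).2).congr fun x hx =>
      (isIntegrableAt_of_mem_regularSet (hVr hx)).totalIntegral_eq k
  exact (hT 1).div (hT 0) fun x hx => (h.totalIntegral_pos (regularSet_subset (hVr hx))
    (isIntegrableAt_of_mem_regularSet (hVr hx)) 0).ne'

namespace IsTestField

theorem exists_abs_totalIntegral_sub_le (hc : D.IsTestField V c) (hV : D.IsOpenSubset V)
    (h : D.IsVelocityField b) (hU : D.PotentialAssumptions U) (hVr : V ⊆ D.regularSet U b)
    (k : Fin 2) (hR : ContDiffOn ℝ 1 (D.forwardIntegral U b k) V ∧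
      ContDiffOn ℝ 1 (D.backwardIntegral U b k) V) :
    ∃ C ≥ 0, ∀ᶠ ε : ℝ in 𝓝 0, ∀ y ∈ tsupport c,
      |D.totalIntegral U (b + ε • c) k y - D.totalIntegral U b k y| ≤ C * |ε| := by
  obtain ⟨C, hC0, hC⟩ := hc.exists_abs_forwardIntegral_sub_le hV h hU hVr k hR.1
  obtain ⟨C', hC0', hC'⟩ := hc.exists_abs_backwardIntegral_sub_le hV h hU hVr k hR.2
  refine ⟨C + C', by positivity, ?_⟩
  filter_upwards [hC, hC', hc.eventually_regularSet_subset hV h hU hVr] with ε h1 h2 h3 y hy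
  have hyr := hVr (hc.support_subset hy)
  rw [(isIntegrableAt_of_mem_regularSet hyr).totalIntegral_eq,
    (isIntegrableAt_of_mem_regularSet (h3 hyr)).totalIntegral_eq, add_sub_add_comm, add_mul]
  exact (abs_add_le _ _).trans (add_le_add (h1 y hy) (h2 y hy))

theorem exists_abs_estimator_sub_le (hc : D.IsTestField V c) (hV : D.IsOpenSubset V)
    (h : D.IsVelocityField b) (hU : D.PotentialAssumptions U) (hVr : V ⊆ D.regularSet U b)
    (hR : ∀ k, ContDiffOn ℝ 1 (D.forwardIntegral U b k) V ∧
      ContDiffOn ℝ 1 (D.backwardIntegral U b k) V) :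
    ∃ C ≥ 0, ∀ᶠ ε : ℝ in 𝓝 0, ∀ y ∈ tsupport c,
      |D.estimator U (b + ε • c) y - D.estimator U b y| ≤ C * |ε| := by
  obtain ⟨C0, hC00, hC0⟩ := hc.exists_abs_totalIntegral_sub_le hV h hU hVr 0 (hR 0)
  obtain ⟨C1, hC10, hC1⟩ := hc.exists_abs_totalIntegral_sub_le hV h hU hVr 1 (hR 1)
  obtain ⟨CA, hCA0, hCA⟩ := hc.exists_abs_estimator_le h hU hVr
  have hcr := hc.support_subset.trans hVr
  have hpos : ∀ y ∈ tsupport c, 0 < D.totalIntegral U b 0 y := fun y hy =>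
    h.totalIntegral_pos (regularSet_subset (hcr hy)) (isIntegrableAt_of_mem_regularSet (hcr hy)) 0
  obtain ⟨CB, hCB0, hCB⟩ := hc.exists_forall_abs_le
    (f := fun y => (D.totalIntegral U b 0 y)⁻¹)
    (((continuousOn_totalIntegral 0).mono hcr).inv₀ fun y hy => (hpos y hy).ne')
    fun l hl y hy => by
      rw [h.totalIntegral_add_period hU.periodic hl (regularSet_subset (hcr hy))]
  refine ⟨2 * CB * (C1 + CA * C0), by positivity, ?_⟩
  -- for small `ε` the denominators are at least half their unperturbed values
  have hsmall : ∀ᶠ ε : ℝ in 𝓝 0, C0 * |ε| * CB < 1 / 2 := by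
    have : Continuous fun ε : ℝ => C0 * |ε| * CB := by fun_prop
    exact this.continuousAt.eventually (gt_mem_nhds (by simp))
  filter_upwards [hC0, hC1, hsmall] with ε h0 h1 h2 y hy
  set B := D.totalIntegral U b 0 y with hB
  set B' := D.totalIntegral U (b + ε • c) 0 y with hB'
  set N := D.totalIntegral U b 1 y with hN
  set N' := D.totalIntegral U (b + ε • c) 1 y with hN'
  have hBp : 0 < B := hpos y hy
  have hBC : 1 ≤ CB * B := by
    have := hCB y hy
    rw [abs_of_pos (inv_pos.2 hBp), inv_le_iff_one_le_mul₀ hBp] at this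
    exact this
  have hB2 : 1 ≤ 2 * CB * B' := by
    have := (abs_le.1 (h0 y hy)).1
    nlinarith
  have hB'p : 0 < B' := by
    by_contra! hle
    nlinarith
  have hAe : D.estimator U b y * B = N := by
    rw [estimator, ← hB, ← hN, div_mul_cancel₀ _ hBp.ne']
  have hA'e : D.estimator U (b + ε • c) y * B' = N' := by
    rw [estimator, ← hB', ← hN', div_mul_cancel₀ _ hB'p.ne']
  have key : |D.estimator U (b + ε • c) y - D.estimator U b y| * B' ≤
      (C1 + CA * C0) * |ε| := by
    have e : (D.estimator U (b + ε • c) y - D.estimator U b y) * B' =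
        (N' - N) - D.estimator U b y * (B' - B) := by
      linear_combination hA'e - hAe
    have e' : |D.estimator U (b + ε • c) y - D.estimator U b y| * B' =
        |(D.estimator U (b + ε • c) y - D.estimator U b y) * B'| := by
      rw [abs_mul, abs_of_pos hB'p]
    rw [e', e]
    refine (abs_sub _ _).trans ?_
    rw [abs_mul, add_mul, mul_assoc]
    exact add_le_add (h1 y hy) (mul_le_mul (hCA y hy) (h0 y hy) (abs_nonneg _) hCA0)
  calc |D.estimator U (b + ε • c) y - D.estimator U b y|
      ≤ |D.estimator U (b + ε • c) y - D.estimator U b y| * (2 * CB * B') :=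
        le_mul_of_one_le_right (abs_nonneg _) hB2
    _ = 2 * CB * (|D.estimator U (b + ε • c) y - D.estimator U b y| * B') := by ring
    _ ≤ 2 * CB * ((C1 + CA * C0) * |ε|) := by gcongr
    _ = 2 * CB * (C1 + CA * C0) * |ε| := by ring

/-- Every trajectory of `b + ε c` either meets the support of `c`, where the estimators differ by
`O(ε)`, or is a trajectory of `b`. -/
theorem exists_abs_estimator_sub_transportedEstimator_le (hc : D.IsTestField V c)
    (hV : D.IsOpenSubset V) (h : D.IsVelocityField b) (hU : D.PotentialAssumptions U)
    (hVr : V ⊆ D.regularSet U b)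
    (hR : ∀ k, ContDiffOn ℝ 1 (D.forwardIntegral U b k) V ∧
      ContDiffOn ℝ 1 (D.backwardIntegral U b k) V) :
    ∃ C, ∀ᶠ ε : ℝ in 𝓝 0, ∀ x ∈ D.cover,
      |D.estimator U (b + ε • c) x - D.transportedEstimator U b c ε x| ≤ C * |ε| := by
  have hA := contDiffOn_estimator h hVr hR
  obtain ⟨C, hC0, hC⟩ := hc.exists_abs_estimator_sub_le hV h hU hVr hR
  obtain ⟨CI, hCI0, hCI⟩ := hc.exists_abs_estimatorDrift_le hV h hU hVr hA
  obtain ⟨T, hT0, hT⟩ := hc.exists_isTransient hV h hU hVr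
  refine ⟨C + CI, ?_⟩
  filter_upwards [hC, hCI, hT] with ε h1 h2 h3 x hx
  have h' := hc.isVelocityField hV h ε
  by_cases hmeet : ∃ t, D.flow (b + ε • c) t x ∈ tsupport c
  · obtain ⟨t, ht⟩ := hmeet
    rw [← h'.estimator_flow hx t, ← hc.transportedEstimator_flow hV h hA h3 hx t]
    set y := D.flow (b + ε • c) t x
    have e : D.estimator U (b + ε • c) y - D.transportedEstimator U b c ε y =
        (D.estimator U (b + ε • c) y - D.estimator U b y) +
          ε * D.estimatorDrift U b c ε y := by
      rw [transportedEstimator]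
      ring
    rw [e, add_mul]
    refine (abs_add_le _ _).trans (add_le_add (h1 y ht) ?_)
    rw [abs_mul, mul_comm]
    exact mul_le_mul_of_nonneg_right (h2 y (h'.flow_mem hx t)) (abs_nonneg _)
  · push Not at hmeet
    have hflow : ∀ t, D.flow b t x = D.flow (b + ε • c) t x ∧
        D.jacobian b t x = D.jacobian (b + ε • c) t x := fun t =>
      h'.flow_eq_of_avoids h (isClosed_tsupport c)
        (fun y hy => (add_smul_eq_of_notMem_tsupport ε hy).symm) hx fun s _ => hmeet s
    have e1 : D.estimator U (b + ε • c) x = D.estimator U b x := by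
      simp only [estimator, totalIntegral, weightedDensity, (hflow _).1, (hflow _).2]
    have e2 : D.estimatorDrift U b c ε x = 0 := by
      simp only [estimatorDrift, estimatorDerivAlong_of_notMem (hmeet _), integral_zero]
    rw [transportedEstimator, e1, e2, mul_zero, sub_zero, sub_self, abs_zero]
    positivity

end IsTestField

end FlowDomain

namespace FlowDomain

variable {d : ℕ} {D : FlowDomain d} {U : Fin 2 → EuclideanSpace ℝ (Fin d) → ℝ}
  {b b' c : EuclideanSpace ℝ (Fin d) → EuclideanSpace ℝ (Fin d)} {x l : EuclideanSpace ℝ (Fin d)}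
  {V : Set (EuclideanSpace ℝ (Fin d))} {ε : ℝ}

/-! ### Periodization and the fundamental lemma of the calculus of variations -/

theorem exists_le_norm_of_mem_periods (D : FlowDomain d) :
    ∃ r > 0, ∀ l ∈ D.periods, l ≠ 0 → r ≤ ‖l‖ := by
  cases D with
  | euclidean Ω _ _ _ =>
    exact ⟨1, one_pos, fun l hl h => absurd (by simpa [periods] using hl) h⟩
  | torus v =>
    have h : IsOpen ({0} : Set (Submodule.span ℤ (range v))) := isOpen_discrete _
    obtain ⟨r, hr, hball⟩ := Metric.isOpen_singleton_iff.1 h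
    refine ⟨r, hr, fun l hl hne => ?_⟩
    by_contra! hlt
    have := hball ⟨l, hl⟩ (by simpa [Subtype.dist_eq, dist_zero_right] using hlt)
    exact hne (congrArg Subtype.val this)

/-- The sum of the translates of `φ` by periods. -/
noncomputable def periodization (D : FlowDomain d)
    (φ : EuclideanSpace ℝ (Fin d) → EuclideanSpace ℝ (Fin d))
    (x : EuclideanSpace ℝ (Fin d)) : EuclideanSpace ℝ (Fin d) :=
  ∑ᶠ l : D.periods, φ (x + l)

section Periodization

variable {x₀ : EuclideanSpace ℝ (Fin d)} {r : ℝ}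
  {φ : EuclideanSpace ℝ (Fin d) → EuclideanSpace ℝ (Fin d)}

theorem locallyFinite_translates (hr : 0 < r) (hsep : ∀ l ∈ D.periods, l ≠ 0 → 4 * r ≤ ‖l‖)
    (x₀ : EuclideanSpace ℝ (Fin d)) :
    LocallyFinite fun l : D.periods =>
      {x : EuclideanSpace ℝ (Fin d) | x + l ∈ Metric.closedBall x₀ r} := by
  intro x
  refine ⟨Metric.ball x r, Metric.ball_mem_nhds x hr, Set.Subsingleton.finite ?_⟩
  rintro l ⟨y, hy, hyx⟩ l' ⟨y', hy', hyx'⟩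
  simp only [mem_ofPred_eq, Metric.mem_closedBall, Metric.mem_ball, dist_eq_norm] at hy hyx hy' hyx'
  by_contra hne
  have h1 := hsep (l - l') (sub_mem l.2 l'.2) (by
    rw [sub_ne_zero]
    exact fun h => hne (Subtype.ext h))
  have e : (l : EuclideanSpace ℝ (Fin d)) - l' =
      (y + l - x₀) - (y' + l' - x₀) - (y - x) + (y' - x) := by abel
  have h2 : ‖(l : EuclideanSpace ℝ (Fin d)) - l'‖ ≤
      ‖y + l - x₀‖ + ‖y' + l' - x₀‖ + ‖y - x‖ + ‖y' - x‖ := by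
    rw [e]
    exact (norm_add_le _ _).trans (add_le_add_left ((norm_sub_le _ _).trans
      (add_le_add_left (norm_sub_le _ _) _)) _)
  linarith

theorem eq_zero_of_mem_closedBall (hr : 0 < r)
    (hsep : ∀ l ∈ D.periods, l ≠ 0 → 4 * r ≤ ‖l‖) (hl : l ∈ D.periods)
    (hx : x ∈ Metric.closedBall x₀ r) (hxl : x + l ∈ Metric.closedBall x₀ r) : l = 0 := by
  by_contra hne
  have h1 := hsep l hl hne
  rw [Metric.mem_closedBall, dist_eq_norm] at hx hxl
  have e : l = (x + l - x₀) - (x - x₀) := by abel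
  have h2 := norm_sub_le (x + l - x₀) (x - x₀)
  rw [← e] at h2
  linarith

theorem isClosed_translates_closedBall (hr : 0 < r)
    (hsep : ∀ l ∈ D.periods, l ≠ 0 → 4 * r ≤ ‖l‖) (x₀ : EuclideanSpace ℝ (Fin d)) :
    IsClosed (D.translates (Metric.closedBall x₀ r)) := by
  have e : D.translates (Metric.closedBall x₀ r) = ⋃ l : D.periods,
      {x : EuclideanSpace ℝ (Fin d) | x + l ∈ Metric.closedBall x₀ r} := by
    ext x
    simp [translates]
  rw [e]
  exact (locallyFinite_translates hr hsep x₀).isClosed_iUnion fun l =>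
    Metric.isClosed_closedBall.preimage
      (by fun_prop : Continuous fun x => x + (l : EuclideanSpace ℝ (Fin d)))

theorem periodization_of_notMem (hφ0 : ∀ x ∉ Metric.closedBall x₀ r, φ x = 0)
    (hx : x ∉ D.translates (Metric.closedBall x₀ r)) : D.periodization φ x = 0 := by
  rw [periodization, ← finsum_zero (α := D.periods)]
  congr 1
  funext l
  exact hφ0 _ fun h => hx ⟨l, l.2, h⟩

theorem periodization_of_mem (hr : 0 < r) (hsep : ∀ l ∈ D.periods, l ≠ 0 → 4 * r ≤ ‖l‖)
    (hφ0 : ∀ x ∉ Metric.closedBall x₀ r, φ x = 0) (hx : x ∈ Metric.closedBall x₀ r) :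
    D.periodization φ x = φ x := by
  rw [periodization, finsum_eq_single _ (0 : D.periods)]
  · simp
  · intro l hl
    refine hφ0 _ fun h => hl (Subtype.ext ?_)
    exact eq_zero_of_mem_closedBall hr hsep l.2 hx h

/-- The periodization of a smooth vector field supported in a small ball is a test field. -/
theorem isTestField_periodization (hV : D.IsOpenSubset V) (hr : 0 < r)
    (hsep : ∀ l ∈ D.periods, l ≠ 0 → 4 * r ≤ ‖l‖) (hSV : Metric.closedBall x₀ r ⊆ V)
    (hφ : ContDiff ℝ ∞ φ) (hφ0 : ∀ x ∉ Metric.closedBall x₀ r, φ x = 0) :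
    D.IsTestField V (D.periodization φ) := by
  have hsupp : tsupport (D.periodization φ) ⊆ D.translates (Metric.closedBall x₀ r) := by
    refine closure_minimal (fun x hx => ?_) (isClosed_translates_closedBall hr hsep x₀)
    by_contra hmem
    exact hx (periodization_of_notMem hφ0 hmem)
  refine ⟨?_, ?_, ?_, ?_⟩
  · rw [← contMDiff_iff_contDiff]
    refine contMDiff_finsum (fun l => ?_) ?_
    · rw [contMDiff_iff_contDiff]
      exact hφ.comp (contDiff_id.add contDiff_const)
    · refine (locallyFinite_translates hr hsep x₀).subset fun l x hx => ?_
      by_contra hmem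
      exact hx (hφ0 _ hmem)
  · intro m hm x
    rw [periodization, periodization,
      ← finsum_comp_equiv (Equiv.addLeft (⟨m, hm⟩ : D.periods)) (f := fun l => φ (x + l))]
    simp only [Equiv.coe_addLeft, AddSubgroup.coe_add, add_assoc]
  · refine hsupp.trans fun x ⟨l, hl, hxl⟩ => ?_
    have := hV.periodic (-l) (neg_mem hl) _ (hSV hxl)
    rwa [add_neg_cancel_right] at this
  · exact ⟨_, isCompact_closedBall x₀ r, fun x hx => hsupp hx⟩

/-- A small ball, completed by the part of the standard cell that its translates do not cover, is a cell. -/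
theorem isCell_closedBall_union (hr : 0 < r) (hsep : ∀ l ∈ D.periods, l ≠ 0 → 4 * r ≤ ‖l‖)
    (hS : Metric.closedBall x₀ r ⊆ D.cover) :
    D.IsCell (Metric.closedBall x₀ r ∪ (D.cell \ D.translates (Metric.closedBall x₀ r))) where
  measurableSet := Metric.isClosed_closedBall.measurableSet.union
    (D.measurableSet_cell.diff (isClosed_translates_closedBall hr hsep x₀).measurableSet)
  subset := union_subset hS (sdiff_subset.trans D.cell_subset_cover)
  exists_mem := by
    intro x hx
    by_cases hmem : x ∈ D.translates (Metric.closedBall x₀ r)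
    · obtain ⟨l, hl, hxl⟩ := hmem
      exact ⟨l, hl, Or.inl hxl⟩
    · obtain ⟨l, hl, hxl⟩ := D.isCell_cell.exists_mem x hx
      refine ⟨l, hl, Or.inr ⟨hxl, ?_⟩⟩
      rintro ⟨m, hm, hxm⟩
      exact hmem ⟨l + m, add_mem hl hm, by rwa [← add_assoc]⟩
  unique := by
    rintro x l hl (hx | hx) (hxl | hxl)
    · exact eq_zero_of_mem_closedBall hr hsep hl hx hxl
    · exact absurd ⟨-l, neg_mem hl, by rwa [add_neg_cancel_right]⟩ hxl.2
    · exact absurd ⟨l, hl, hxl⟩ hx.2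
    · exact D.isCell_cell.unique x l hl hx.1 hxl.1

/-- Integrating a periodic vector field against a periodization amounts to integrating over the
ball. -/
theorem integral_inner_periodization (hr : 0 < r)
    (hsep : ∀ l ∈ D.periods, l ≠ 0 → 4 * r ≤ ‖l‖) (hS : Metric.closedBall x₀ r ⊆ D.cover)
    (hφ0 : ∀ x ∉ Metric.closedBall x₀ r, φ x = 0) (hper : D.IsPeriodic (D.periodization φ))
    {f : EuclideanSpace ℝ (Fin d) → EuclideanSpace ℝ (Fin d)} (hf : D.IsPeriodic f)
    (hi : IntegrableOn (fun x => ⟪f x, D.periodization φ x⟫) D.cell) :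
    IntegrableOn (fun x => ⟪f x, φ x⟫) (Metric.closedBall x₀ r) ∧
      ∫ x in D.cell, ⟪f x, D.periodization φ x⟫ = ∫ x, ⟪f x, φ x⟫ := by
  have hcell := isCell_closedBall_union hr hsep hS
  have hp : D.IsPeriodic fun x => ⟪f x, D.periodization φ x⟫ := fun l hl x => by
    simp only [hf l hl x, hper l hl x]
  obtain ⟨-, h2, h3⟩ := D.isCell_cell.integral_eq hcell
  set S := Metric.closedBall x₀ r with hSdef
  have hSm : MeasurableSet S := Metric.isClosed_closedBall.measurableSet
  have hz : ∀ x ∈ (S ∪ (D.cell \ D.translates S)) \ S, ⟪f x, D.periodization φ x⟫ = 0 := by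
    rintro x ⟨hx | hx, hxS⟩
    · exact absurd hx hxS
    · rw [periodization_of_notMem hφ0 hx.2, inner_zero_right]
  have he : EqOn (fun x => ⟪f x, D.periodization φ x⟫) (fun x => ⟪f x, φ x⟫) S := fun x hx => by
    simp only [periodization_of_mem hr hsep hφ0 hx]
  refine ⟨(((h3 _ hp).1 hi).mono_set subset_union_left).congr_fun he hSm, ?_⟩
  rw [h2 _ hp, setIntegral_eq_of_subset_of_forall_sdiff_eq_zero hcell.measurableSet
    subset_union_left hz, setIntegral_congr_fun hSm he]
  refine setIntegral_eq_integral_of_forall_compl_eq_zero fun x hx => ?_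
  rw [hφ0 x hx, inner_zero_right]

end Periodization

/-- A periodic vector field whose integrals against all test fields in `V` vanish is zero almost
everywhere on `V`. -/
theorem ae_eq_zero_of_integral_inner_eq_zero (hV : D.IsOpenSubset V)
    {f : EuclideanSpace ℝ (Fin d) → EuclideanSpace ℝ (Fin d)} (hf : D.IsPeriodic f)
    (h : ∀ c, D.IsTestField V c → IntegrableOn (fun x => ⟪f x, c x⟫) D.cell ∧
      ∫ x in D.cell, ⟪f x, c x⟫ = 0) :
    ∀ᵐ x ∂(volume.restrict V), f x = 0 := by
  obtain ⟨R, hR, hRsep⟩ := D.exists_le_norm_of_mem_periods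
  have hloc : ∀ x₀ ∈ V, ∃ ρ > 0, ∀ᵐ x, x ∈ Metric.ball x₀ ρ → f x = 0 := by
    intro x₀ hx₀
    obtain ⟨r₁, hr₁, hball⟩ := Metric.isOpen_iff.1 hV.isOpen x₀ hx₀
    set r := min (r₁ / 2) (R / 4) with hrdef
    have hr : 0 < r := by positivity
    have hsep : ∀ l ∈ D.periods, l ≠ 0 → 4 * r ≤ ‖l‖ := fun l hl hne => by
      have := min_le_right (r₁ / 2) (R / 4)
      linarith [hRsep l hl hne]
    have hSV : Metric.closedBall x₀ r ⊆ V := (Metric.closedBall_subset_ball (by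
      have := min_le_left (r₁ / 2) (R / 4)
      linarith)).trans hball
    have key : ∀ (g : EuclideanSpace ℝ (Fin d) → ℝ), ContDiff ℝ ∞ g →
        (∀ x ∉ Metric.closedBall x₀ r, g x = 0) → ∀ i,
        IntegrableOn (fun x => g x • f x i) (Metric.closedBall x₀ r) ∧
          ∫ x, g x • f x i = 0 := by
      intro g hg hg0 i
      set φ : EuclideanSpace ℝ (Fin d) → EuclideanSpace ℝ (Fin d) := fun x =>
        g x • EuclideanSpace.single i (1 : ℝ) with hφ
      have hφ0 : ∀ x ∉ Metric.closedBall x₀ r, φ x = 0 := fun x hx => by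
        simp only [hφ, hg0 x hx, zero_smul]
      have hc := isTestField_periodization hV hr hsep hSV (hg.smul contDiff_const) hφ0
      have e : ∀ x, ⟪f x, φ x⟫ = g x • f x i := fun x => by
        simp [hφ, inner_smul_right, EuclideanSpace.inner_single_right]
      have := integral_inner_periodization hr hsep (hSV.trans hV.subset) hφ0 hc.periodic hf
        (h _ hc).1
      simp only [e] at this
      exact ⟨this.1, this.2.symm.trans (h _ hc).2⟩
    refine ⟨r / 2, half_pos hr, ?_⟩
    have hcomp : ∀ i, ∀ᵐ x, x ∈ Metric.ball x₀ (r / 2) → f x i = 0 := by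
      intro i
      -- a bump function shows that the components are integrable near `x₀`
      let χ : ContDiffBump x₀ := ⟨r / 2, r, half_pos hr, half_lt_self hr⟩
      have hχ := (key χ χ.contDiff (fun x hx => by
        refine χ.zero_of_le_dist ?_
        rw [Metric.mem_closedBall, not_le] at hx
        exact hx.le) i).1
      have hint : IntegrableOn (fun x => f x i) (Metric.ball x₀ (r / 2)) := by
        refine (hχ.mono_set (Metric.ball_subset_closedBall.trans
          (Metric.closedBall_subset_closedBall (half_le_self hr.le)))).congr_fun
          (fun x hx => ?_) Metric.isOpen_ball.measurableSet
        have : χ x = 1 := χ.one_of_mem_closedBall (Metric.ball_subset_closedBall hx)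
        simp only [this, one_smul]
      refine Metric.isOpen_ball.ae_eq_zero_of_integral_contDiff_smul_eq_zero
        hint.locallyIntegrableOn fun g hg _ hgs => (key g hg (fun x hx => ?_) i).2
      refine image_eq_zero_of_notMem_tsupport fun hmem => hx ?_
      exact Metric.closedBall_subset_closedBall (half_le_self hr.le)
        (Metric.ball_subset_closedBall (hgs hmem))
    filter_upwards [ae_all_iff.2 hcomp] with x hx hxb
    ext i
    exact hx i hxb
  rw [ae_restrict_iff' hV.isOpen.measurableSet, ae_iff]
  refine measure_null_of_locally_null _ fun x₀ hx₀ => ?_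
  have hx₀V : x₀ ∈ V := by
    by_contra hx
    exact hx₀ fun h => absurd h hx
  obtain ⟨ρ, hρ, hae⟩ := hloc x₀ hx₀V
  refine ⟨{x | ¬(x ∈ V → f x = 0)} ∩ Metric.ball x₀ ρ,
    inter_mem_nhdsWithin _ (Metric.ball_mem_nhds x₀ hρ), measure_mono_null (fun x hx => ?_) hae⟩
  exact fun hx0 => hx.1 fun _ => hx0 hx.2

/-! ### Functional derivatives -/

theorem isPeriodic_explicitDerivative (hU : D.PotentialAssumptions U) (h : D.IsVelocityField b) :
    D.IsPeriodic (D.explicitDerivative U b) := by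
  have hT : D.IsPeriodic (D.totalIntegral U b 0) := isPeriodic_of_forall_cover
    fun l hl x hx => h.totalIntegral_add_period hU.periodic hl hx 0
  have hF : ∀ k, D.IsPeriodic (D.forwardIntegral U b k) := fun k => isPeriodic_of_forall_cover
    fun l hl x hx => h.forwardIntegral_add_period hU.periodic hl hx k
  have hB : ∀ k, D.IsPeriodic (D.backwardIntegral U b k) := fun k => isPeriodic_of_forall_cover
    fun l hl x hx => h.backwardIntegral_add_period hU.periodic hl hx k
  intro l hl x
  have e : gradient (D.estimator U b) (x + l) = gradient (D.estimator U b) x := by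
    rw [gradient, gradient, ← fderiv_comp_add_right]
    congr 2
    funext y
    rw [isPeriodic_estimator hU h l hl]
  simp only [explicitDerivative, e, hT l hl x, hF _ l hl x, hB _ l hl x]

/-- Along admissible perturbations the variance and the second moment differ by a constant. -/
theorem hasDerivAt_estimatorVariance_iff (hU : D.PotentialAssumptions U)
    (hadm : ∀ᶠ ε : ℝ in 𝓝 0, b + ε • c ∈ D.infiniteTimeFields U) {m : ℝ} :
    HasDerivAt (fun ε : ℝ => D.estimatorVariance U (b + ε • c)) m 0 ↔
      HasDerivAt (fun ε : ℝ => D.secondMoment U (b + ε • c)) m 0 := by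
  set κ := (∫ x, likelihoodRatio U x ∂(D.baseMeasure U)) ^ 2 with hκ
  have e : (fun ε : ℝ => D.estimatorVariance U (b + ε • c)) =ᶠ[𝓝 0]
      fun ε => D.secondMoment U (b + ε • c) - κ := by
    filter_upwards [hadm] with ε hε using estimatorVariance_eq hU hε
  rw [e.hasDerivAt_iff, hasDerivAt_sub_const_iff]

/-- The variance and the second moment have the same functional derivatives. -/
theorem isFunctionalDerivativeOn_estimatorVariance_iff (hU : D.PotentialAssumptions U)
    {g : EuclideanSpace ℝ (Fin d) → EuclideanSpace ℝ (Fin d)} :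
    D.IsFunctionalDerivativeOn U (D.estimatorVariance U) b V g ↔
      D.IsFunctionalDerivativeOn U (D.secondMoment U) b V g := by
  constructor <;> intro h c hc hadm
  · have := h c hc hadm
    rwa [hasDerivAt_estimatorVariance_iff hU hadm] at this
  · have := h c hc hadm
    rwa [hasDerivAt_estimatorVariance_iff hU hadm]

theorem isFunctionalDerivativeOn_secondMoment (hU : D.PotentialAssumptions U)
    (hb : b ∈ D.infiniteTimeFields U) (hV : D.IsOpenSubset V) (hVr : V ⊆ D.regularSet U b)
    (hR : ∀ k, ContDiffOn ℝ 1 (D.forwardIntegral U b k) V ∧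
      ContDiffOn ℝ 1 (D.backwardIntegral U b k) V) :
    D.IsFunctionalDerivativeOn U (D.secondMoment U) b V (D.explicitDerivative U b) := by
  intro c hc _
  have hA := contDiffOn_estimator hb.1 hVr hR
  obtain ⟨C, hC⟩ := hc.exists_abs_estimator_sub_transportedEstimator_le hV hb.1 hU hVr hR
  exact ⟨(hc.integral_inner_explicitDerivative hV hb.1 hU hVr hA).1,
    hc.hasDerivAt_secondMoment hV hb hU hVr hA hC⟩

/-- Every functional derivative of the second moment is the explicit one: both have the same pairing with
all test fields, each of which is admissible after scaling. -/
theorem ae_eq_explicitDerivative (hU : D.PotentialAssumptions U)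
    (hb : b ∈ D.infiniteTimeFields U) (hV : D.IsOpenSubset V) (hVr : V ⊆ D.regularSet U b)
    (hA : ContDiffOn ℝ 1 (D.estimator U b) V)
    {g : EuclideanSpace ℝ (Fin d) → EuclideanSpace ℝ (Fin d)} (hg : D.IsPeriodic g)
    (h : D.IsFunctionalDerivativeOn U (D.secondMoment U) b V g) :
    g =ᵐ[volume.restrict V] D.explicitDerivative U b := by
  have hG := isPeriodic_explicitDerivative hU hb.1
  have := ae_eq_zero_of_integral_inner_eq_zero hV (f := fun x => g x - D.explicitDerivative U b x)
    (fun l hl x => by simp only [hg l hl x, hG l hl x]) fun c hc => by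
      obtain ⟨h1, h2⟩ := h c hc (hc.eventually_mem_infiniteTimeFields hV hb hU hVr)
      have h3 := (hc.integral_inner_explicitDerivative hV hb.1 hU hVr hA).1
      have h4 := hc.eq_of_hasDerivAt_secondMoment hV hb hU hVr hA h2
      simp only [inner_sub_left]
      exact ⟨h1.sub h3, by rw [integral_sub h1 h3, h4, sub_self]⟩
  filter_upwards [this] with x hx using sub_eq_zero.1 hx

end FlowDomain
theorem mainTheorem7 {d : ℕ} (D : FlowDomain d) (U : Fin 2 → EuclideanSpace ℝ (Fin d) → ℝ)
    (hU : D.PotentialAssumptions U)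
    (b : EuclideanSpace ℝ (Fin d) → EuclideanSpace ℝ (Fin d))
    (hb : b ∈ D.infiniteTimeFields U) :
    (∀ b' ∈ D.infiniteTimeFields U, MemLp (D.estimator U b') 2 (D.baseMeasure U)) ∧
    ∀ V : Set (EuclideanSpace ℝ (Fin d)), D.IsOpenSubset V → V ⊆ D.regularSet U b →
      ((∀ k, ContDiffOn ℝ 1 (D.forwardIntegral U b k) V ∧
          ContDiffOn ℝ 1 (D.backwardIntegral U b k) V) →
        D.IsFunctionalDerivativeOn U (D.secondMoment U) b V (D.explicitDerivative U b) ∧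
        D.IsFunctionalDerivativeOn U (D.estimatorVariance U) b V (D.explicitDerivative U b)) ∧
      (ContDiffOn ℝ 1 (D.estimator U b) V →
        ∀ g : EuclideanSpace ℝ (Fin d) → EuclideanSpace ℝ (Fin d), D.IsPeriodic g →
          (D.IsFunctionalDerivativeOn U (D.secondMoment U) b V g ∨
            D.IsFunctionalDerivativeOn U (D.estimatorVariance U) b V g) →
          g =ᵐ[volume.restrict V] D.explicitDerivative U b) := by
  refine ⟨fun b' hb' => FlowDomain.memLp_estimator hU hb', fun V hV hVr =>
    ⟨fun hR => ?_, fun hA g hg hd => ?_⟩⟩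
  · have h := FlowDomain.isFunctionalDerivativeOn_secondMoment hU hb hV hVr hR
    exact ⟨h, (FlowDomain.isFunctionalDerivativeOn_estimatorVariance_iff hU).2 h⟩
  · refine FlowDomain.ae_eq_explicitDerivative hU hb hV hVr hA hg ?_
    exact hd.elim id (FlowDomain.isFunctionalDerivativeOn_estimatorVariance_iff hU).1
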